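/- **Setting.** For a node $x=(n,m)\in\mathbb Z^2$ let $\Gamma=\Gamma_{nm}=\{(n,m),(n+1,m),(n,m+1),(n-1,m+1),(n-1,m),(n,m-1),(n+1,m-1)\}$ (in this order). Consider systems $$\ddot u_{nm}=F_{nm}\big(t,\{u_{pq}\}_{(p,q)\in\Gamma}\big),\qquad (n,m)\in\mathbb Z^2,\tag{1}$$ where each $F_{nm}$ is smooth on an open set $\Omega_{nm}\subset\mathbb R\times\mathbb R^{7}$, *nonlinear* (at every node some $\partial^2F_{nm}/\partial u_{pq}\partial u_{p'q'}$ is not identically zero) and *coupled* (for every $(p,q)\in\Gamma$, $\partial F_{nm}/\partial u_{pq}$ vanishes identically on no nonempty open subset of $\Omega_{nm}$). A vector field $X=\tau(t,u_{nm})\partial_t+\phi_{nm}(t,u_{nm})\partial_{u_{nm}}$ is a symmetry if $$\phi^{tt}_{nm}-\tau\,\partial_tF_{nm}-\sum_{(p,q)\in\Gamma}\phi_{pq}(t,u_{pq})\,\partial_{u_{pq}}F_{nm}=0\quad\text{whenever }\ddot u_{nm}=F_{nm},\qquad \phi^{tt}_{nm}=D_t^2\phi_{nm}-(D_t^2\tau)\dot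 u_{nm}-2(D_t\tau)\ddot u_{nm},$$ for all points of the domains and all values of $\dot u_{nm}$. The vector fields $$\tau(t)\partial_t+\big[(\tfrac{\dot\tau}{2}+a_{nm})u_{nm}+\lambda_{nm}(t)\big]\partial_{u_{nm}}\qquad(\tau,\lambda_{nm}\in C^\infty(\mathbb R),\ a_{nm}\in\mathbb R)\tag{2}$$ form a Lie algebra under the commutator; a *symmetry algebra* of (1) is a Lie subalgebra $\mathcal L$ of it that consists of symmetries. For functions $f^{(i)}$ on $\mathbb Z^2$ put $\mathcal D[f^{(1)}_{p_1},\dots,f^{(N)}_{p_N}]=\det\big(f^{(i)}_{p_j}\big)_{i,j}$; $1_p$ is the constant function $1$. *Isotropy.* A finite-dimensional space $E$ of functions on $\mathbb Z^2$, of dimension $d$, is in general position if for every node only the zero function in $E$ vanishes at the first $d$ nodes of $\Gamma_{nm}$. $\mathcal L$ is called isotropic if the following spaces are in general position: the span of $1$ and of all functions $a_{nm}$ occurring in $\mathcal L$; and, for each $t$, the space of all functions $(n,m)\mapsto\lambda_{nm}(t)$ with $\lambda_{nm}\partial_{u_{nm}}\in\mathcal L$. *Allowed transformations* are $\tilde t=\tilde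 t(t)$, $u_{nm}=\dot{\tilde t}^{-1/2}P_{nm}\tilde u_{nm}(\tilde t)+Q_{nm}(t)$ for $t$ in an open interval $J$, with $\tilde t,Q_{nm}$ smooth, $\dot{\tilde t}>0$ and constants $P_{nm}\ne0$. They turn (1) into the system with $$\tilde F_{nm}=\dot{\tilde t}^{-3/2}P_{nm}^{-1}(F_{nm}-\ddot Q_{nm})+\tfrac12\dot{\tilde t}^{-3}\big(\dddot{\tilde t}-\tfrac32\dot{\tilde t}^{-1}\ddot{\tilde t}^{\,2}\big)\tilde u_{nm},$$ and the triple $(\tau,a_{nm},\lambda_{nm})$ into $\big(\tau\dot{\tilde t},\ a_{nm},\ \dot{\tilde t}^{1/2}P_{nm}^{-1}[(\tfrac{\dot\tau}2+a_{nm})Q_{nm}+\lambda_{nm}-\tau\dot Q_{nm}]\big)$. *Normal forms.* Let $\mathrm{sl}(2,\mathbb R)=\langle\partial_t,\ t\partial_t+\tfrac12u_{nm}\partial_{u_{nm}},\ t^2\partial_t+tu_{nm}\partial_{u_{nm}}\rangle$. * $NS_{5,1}$: the sum of $\mathrm{sl}(2,\mathbb R)$ and the radical $\langle a^{(1)}_{nm}u_{nm}\partial_{u_{nm}},\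 a^{(2)}_{nm}u_{nm}\partial_{u_{nm}}\rangle$, where $\mathcal D[a^{(1)}_{nm},a^{(2)}_{n+1m},1_{nm+1}]\neq0$ at every node, with $$F_{nm}=u_{nm}\Big[|u_{nm}|^{-\mathcal D[a^{(1)}_{n+1m},a^{(2)}_{nm+1}]}|u_{n+1m}|^{\mathcal D[a^{(1)}_{nm},a^{(2)}_{nm+1}]}|u_{nm+1}|^{-\mathcal D[a^{(1)}_{nm},a^{(2)}_{n+1m}]}\Big]^{4/\mathcal D[a^{(1)}_{nm},a^{(2)}_{n+1m},1_{nm+1}]}f_{nm}(\xi_{pq}),$$ $$\xi_{pq}=|u_{nm}|^{\mathcal D[a^{(1)}_{n+1m},a^{(2)}_{nm+1},1_{pq}]}|u_{n+1m}|^{-\mathcal D[a^{(1)}_{nm},a^{(2)}_{nm+1},1_{pq}]}|u_{nm+1}|^{\mathcal D[a^{(1)}_{nm},a^{(2)}_{n+1m},1_{pq}]}|u_{pq}|^{-\mathcal D[a^{(1)}_{nm},a^{(2)}_{n+1m},1_{nm+1}]}$$ for the four $(p,q)\in\Gamma\setminus\{(n,m),(n+1,m),(n,m+1)\}$, on the set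 where no $u_{pq}$, $(p,q)\in\Gamma$, vanishes. * $NS_{5,2}$: the sum of $\mathrm{sl}(2,\mathbb R)$ and the radical $\langle\partial_{u_{nm}},\ t\partial_{u_{nm}}\rangle$, with $$F_{nm}=\big(\mathcal D[u_{nm},1_{n+1m}]\big)^{-3}f_{nm}(\xi_{pq}),\qquad \xi_{pq}=\frac{\mathcal D[u_{nm},1_{pq}]}{\mathcal D[u_{nm},1_{n+1m}]},\quad (p,q)\in\Gamma\setminus\{(n,m),(n+1,m)\},$$ where $\mathcal D[u_{nm},1_{pq}]=u_{nm}-u_{pq}$, on the set where $u_{nm}\ne u_{n+1m}$. **Theorem.** 1. Every symmetry $\tau(t,u_{nm})\partial_t+\phi_{nm}(t,u_{nm})\partial_{u_{nm}}$ (with coefficients smooth over the domains) of a nonlinear coupled system (1) has the form (2) near every point $(t,u_{nm})$ that lies under $\Omega_{nm}$. 2. (Classification.) Let $\mathcal L$ be an isotropic, $5$-dimensional, nonsolvable symmetry algebra of a nonlinear coupled system (1). Then exactly one of the two classes occurs, the same one at all times: around every $t_0\in\mathbb R$ there is an allowed transformation, defined for $t$ in an open interval $J\ni t_0$, that carries $\mathcal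 L$ onto $NS_{5,1}$ for some $a^{(1)},a^{(2)}$ (respectively onto $NS_{5,2}$) and the radical of $\mathcal L$ onto the stated radical; and for every node and every open interval $I\subset J$ and product $B$ of seven open intervals in the new variables whose product lies over the domain and on which no $\tilde u_{pq}$ vanishes (respectively $\tilde u_{nm}\ne\tilde u_{n+1m}$), there is a function $f_{nm}$, smooth on the set $\xi(B)$, such that on $I\times B$ the transformed interaction $\tilde F_{nm}$ is the interaction of $NS_{5,1}$ (respectively $NS_{5,2}$) displayed above. 3. (Converse.) For all $a^{(1)},a^{(2)}$ with $\mathcal D[a^{(1)}_{nm},a^{(2)}_{n+1m},1_{nm+1}]\neq0$ at every node and all functions $f_{nm}$ smooth on open sets $V_{nm}$, the interaction of $NS_{5,1}$, on the set where $\xi\in V_{nm}$ and no $u_{pq}$ vanishes, has $NS_{5,1}$ as a symmetry algebra; it is a $5$-dimensional nonsolvable Lie algebra with the stated radical. The same holds for $NS_{5,2}$, on the set where $\xi\in V_{nm}$ and $u_{nm}\neq u_{n+1m}$. 4. (Maximality.) There are $a^{(1)},a^{(2)}$ with $\mathcal D[a^{(1)}_{nm},a^{(2)}_{n+1m},1_{nm+1}]\neq0$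 at every node and smooth functions $f_{nm}$ on $\mathbb R^4$ for which the interaction of $NS_{5,1}$ is nonlinear and coupled and $NS_{5,1}$ is the algebra of all its symmetries of the form (2). There are smooth functions $f_{nm}$ on $\mathbb R^5$ for which the same is true of $NS_{5,2}$. -/

import Mathlib

open scoped ContDiff

noncomputable section

/-! ### The triangular lattice -/

/-- Nodes `(n, m)` of the two-dimensional triangular lattice. -/
abbrev Site : Type := ℤ × ℤ

/-- The seven offsets of `Γ`, in the order
`(n,m), (n+1,m), (n,m+1), (n-1,m+1), (n-1,m), (n,m-1), (n+1,m-1)`. -/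
def offset : Fin 7 → Site :=
  ![(0, 0), (1, 0), (0, 1), (-1, 1), (-1, 0), (0, -1), (1, -1)]

/-- The `i`-th point of the neighbourhood `Γ` of the node `x`. -/
def site (x : Site) (i : Fin 7) : Site := x + offset i

/-- `𝒟[f¹_{p₁}, …, f^N_{p_N}]`, the determinant with entries `f^i_{p_j}`. -/
def detD {N : ℕ} (f : Fin N → Site → ℝ) (p : Fin N → Site) : ℝ :=
  Matrix.det (Matrix.of fun i j => f i (p j))

/-! ### Interactions

`F x t w` is `F_{nm}(t, {u_{pq}})` at the node `x = (n, m)`, where `w i` is the value of `u` at the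
`i`-th point of `Γ`; so `w 0` is `u_{nm}`.  `F x` lives on an open set `Ω x` of pairs `(t, w)`. -/

/-- Families of interactions, one for each node. -/
abbrev Interaction : Type := Site → ℝ → (Fin 7 → ℝ) → ℝ

/-- Families of domains, one for each node. -/
abbrev Domain : Type := Site → Set (ℝ × (Fin 7 → ℝ))

/-- The partial derivative of `g` with respect to its `i`-th variable. -/
def partialU (g : (Fin 7 → ℝ) → ℝ) (i : Fin 7) (w : Fin 7 → ℝ) : ℝ :=
  deriv (fun r => g (Function.update w i r)) (w i)

/-- Smooth, nonlinear and coupled interactions.  Nonlinear: at each node some second derivative is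
not identically zero.  Coupled: no first derivative vanishes identically on a nonempty open
subset of the domain. -/
structure IsNonlinearCoupled (F : Interaction) (Ω : Domain) : Prop where
  isOpen : ∀ x, IsOpen (Ω x)
  smooth : ∀ x, ContDiffOn ℝ ∞ (fun p : ℝ × (Fin 7 → ℝ) => F x p.1 p.2) (Ω x)
  nonlinear : ∀ x, ∃ p ∈ Ω x, ∃ i j, partialU (partialU (F x p.1) i) j p.2 ≠ 0
  coupled : ∀ x i, Ω x ⊆ closure {p ∈ Ω x | partialU (F x p.1) i p.2 ≠ 0}

/-! ### Point symmetries -/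

/-- Vector fields `τ(t,u_{nm}) ∂_t + φ_{nm}(t,u_{nm}) ∂_{u_{nm}}`. -/
structure PointField where
  tau : ℝ → ℝ → ℝ
  phi : Site → ℝ → ℝ → ℝ

/-- The coefficients of the vector field are smooth wherever the interactions are defined. -/
def PointField.IsSmoothOn (X : PointField) (Ω : Domain) : Prop :=
  ∀ x, ∀ p ∈ Ω x,
    ContDiffAt ℝ ∞ (fun q : ℝ × ℝ => X.tau q.1 q.2) (p.1, p.2 0) ∧
    ContDiffAt ℝ ∞ (fun q : ℝ × ℝ => X.phi x q.1 q.2) (p.1, p.2 0)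

/-- A curve `s ↦ u(s)` with `u(t) = u`, `u̇(t) = v`, `ü(t) = c`. -/
def jetCurve (t u v c s : ℝ) : ℝ := u + v * (s - t) + c / 2 * (s - t) ^ 2

/-- The total time derivative `D_t g` as a function of `t, u, u̇ = v, ü = c`. -/
def totalDeriv (g : ℝ → ℝ → ℝ) (t u v c : ℝ) : ℝ :=
  deriv (fun s => g s (jetCurve t u v c s)) t

/-- The second total time derivative `D_t² g` as a function of `t, u, u̇ = v, ü = c`. -/
def totalDeriv2 (g : ℝ → ℝ → ℝ) (t u v c : ℝ) : ℝ :=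
  iteratedDeriv 2 (fun s => g s (jetCurve t u v c s)) t

/-- The coefficient `φ^{tt} = D_t² φ - (D_t² τ) u̇ - 2 (D_t τ) ü` of the second prolongation. -/
def PointField.phitt (X : PointField) (x : Site) (t u v c : ℝ) : ℝ :=
  totalDeriv2 (X.phi x) t u v c - totalDeriv2 X.tau t u v c * v - 2 * totalDeriv X.tau t u v c * c

/-- The second prolongation of `X` annihilates `Δ_{nm} = ü_{nm} - F_{nm}` on the solutions of
`ü_{nm} = F_{nm}`; the velocity `u̇_{nm} = v` is free. -/
def PointField.IsSymmetry (X : PointField) (F : Interaction) (Ω : Domain) : Prop :=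
  ∀ x, ∀ p ∈ Ω x, ∀ v : ℝ,
    X.phitt x p.1 (p.2 0) v (F x p.1 p.2)
      - X.tau p.1 (p.2 0) * deriv (fun s => F x s p.2) p.1
      - ∑ i, X.phi (site x i) p.1 (p.2 i) * partialU (F x p.1) i p.2 = 0

/-! ### The Lie algebra of the vector fields `τ ∂_t + ((τ̇/2 + a_{nm}) u_{nm} + λ_{nm}) ∂_{u_{nm}}` -/

/-- The algebra of smooth functions of `t`. -/
def smoothFn : Subalgebra ℝ (ℝ → ℝ) where
  carrier := {f | ContDiff ℝ ∞ f}
  mul_mem' {f g} hf hg := show ContDiff ℝ ∞ (f * g) from ContDiff.mul hf hg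
  add_mem' {f g} hf hg := show ContDiff ℝ ∞ (f + g) from ContDiff.add hf hg
  algebraMap_mem' c := show ContDiff ℝ ∞ (fun _ : ℝ => c) from contDiff_const

/-- The time derivative on smooth functions. -/
def dt : Derivation ℝ smoothFn smoothFn :=
  Derivation.mk'
    { toFun := fun f => ⟨deriv f.1, (contDiff_infty_iff_deriv.1 f.2).2⟩
      map_add' := fun f g => Subtype.ext <| funext fun t =>
        deriv_add ((contDiff_infty_iff_deriv.1 f.2).1 t) ((contDiff_infty_iff_deriv.1 g.2).1 t)
      map_smul' := fun c f => Subtype.ext <| funext fun t =>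
        deriv_const_smul c ((contDiff_infty_iff_deriv.1 f.2).1 t) }
    (fun f g => Subtype.ext <| funext fun t => by
      have h := deriv_mul ((contDiff_infty_iff_deriv.1 f.2).1 t)
        ((contDiff_infty_iff_deriv.1 g.2).1 t)
      change deriv (f.1 * g.1) t = f.1 t * deriv g.1 t + g.1 t * deriv f.1 t
      rw [h]; ring)

/-- Triples `(τ, a, λ)`; such a triple stands for the vector field
`τ(t) ∂_t + ((τ̇(t)/2 + a_{nm}) u_{nm} + λ_{nm}(t)) ∂_{u_{nm}}`. -/
def SymField : Type := smoothFn × (Site → ℝ) × (Site → smoothFn)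

namespace SymField

instance : AddCommGroup SymField :=
  inferInstanceAs (AddCommGroup (smoothFn × (Site → ℝ) × (Site → smoothFn)))

instance : Module ℝ SymField :=
  inferInstanceAs (Module ℝ (smoothFn × (Site → ℝ) × (Site → smoothFn)))

/-- The field with given `τ`, `a`, `λ`. -/
def mk (τ : smoothFn) (a : Site → ℝ) (l : Site → smoothFn) : SymField := (τ, a, l)

/-- The function `τ`. -/
def tau (X : SymField) : smoothFn := X.1

/-- The coefficients `a_{nm}`. -/
def a (X : SymField) : Site → ℝ := X.2.1

/-- The functions `λ_{nm}`. -/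
def lam (X : SymField) : Site → smoothFn := X.2.2

/-- The function `τ̇/2 + a_{nm}`. -/
def b (X : SymField) (x : Site) : smoothFn := (1 / 2 : ℝ) • dt X.tau + algebraMap ℝ smoothFn (X.a x)

@[ext] theorem ext' {X Y : SymField} (h1 : X.tau = Y.tau) (h2 : ∀ x, X.a x = Y.a x)
    (h3 : ∀ x, X.lam x = Y.lam x) : X = Y :=
  Prod.ext h1 (Prod.ext (funext h2) (funext h3))

@[simp] theorem tau_mk (τ : smoothFn) (a : Site → ℝ) (l : Site → smoothFn) : (mk τ a l).tau = τ := rfl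
@[simp] theorem a_mk (τ : smoothFn) (a : Site → ℝ) (l : Site → smoothFn) : (mk τ a l).a = a := rfl
@[simp] theorem lam_mk (τ : smoothFn) (a : Site → ℝ) (l : Site → smoothFn) : (mk τ a l).lam = l := rfl
@[simp] theorem tau_add (X Y : SymField) : (X + Y).tau = X.tau + Y.tau := rfl
@[simp] theorem a_add (X Y : SymField) (x : Site) : (X + Y).a x = X.a x + Y.a x := rfl
@[simp] theorem lam_add (X Y : SymField) (x : Site) : (X + Y).lam x = X.lam x + Y.lam x := rfl
@[simp] theorem tau_zero : (0 : SymField).tau = 0 := rfl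
@[simp] theorem a_zero (x : Site) : (0 : SymField).a x = 0 := rfl
@[simp] theorem lam_zero (x : Site) : (0 : SymField).lam x = 0 := rfl
@[simp] theorem tau_smul (c : ℝ) (X : SymField) : (c • X).tau = c • X.tau := rfl
@[simp] theorem a_smul (c : ℝ) (X : SymField) (x : Site) : (c • X).a x = c * X.a x := rfl
@[simp] theorem lam_smul (c : ℝ) (X : SymField) (x : Site) : (c • X).lam x = c • X.lam x := rfl

/-- The commutator of vector fields. -/
instance : Bracket SymField SymField where
  bracket X Y := mk (X.tau * dt Y.tau - Y.tau * dt X.tau) 0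
    (fun x => (X.tau * dt (Y.lam x) + X.lam x * Y.b x) - (Y.tau * dt (X.lam x) + Y.lam x * X.b x))

@[simp] theorem tau_lie (X Y : SymField) :
    ⁅X, Y⁆.tau = X.tau * dt Y.tau - Y.tau * dt X.tau := rfl
@[simp] theorem a_lie (X Y : SymField) (x : Site) : ⁅X, Y⁆.a x = 0 := rfl
@[simp] theorem lam_lie (X Y : SymField) (x : Site) : ⁅X, Y⁆.lam x =
    (X.tau * dt (Y.lam x) + X.lam x * Y.b x) - (Y.tau * dt (X.lam x) + Y.lam x * X.b x) := rfl

instance : LieRing SymField where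
  add_lie X Y Z := by
    ext1 <;> simp [b, Algebra.smul_def] <;> ring
  lie_add X Y Z := by
    ext1 <;> simp [b, Algebra.smul_def] <;> ring
  lie_self X := by
    ext1 <;> simp
  leibniz_lie X Y Z := by
    ext1 <;> simp [b, Algebra.smul_def] <;> ring

instance : LieAlgebra ℝ SymField where
  lie_smul c X Y := by
    ext1 <;> simp [b, Algebra.smul_def] <;> ring

/-- The vector field that a triple `(τ, a, λ)` stands for. -/
def toPointField (X : SymField) : PointField where
  tau t _ := X.tau.1 t
  phi x t u := (deriv X.tau.1 t / 2 + X.a x) * u + (X.lam x).1 t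

/-- Symmetries of the system `ü_{nm} = F_{nm}`. -/
def IsSymmetry (X : SymField) (F : Interaction) (Ω : Domain) : Prop :=
  X.toPointField.IsSymmetry F Ω

end SymField

/-! ### Isotropy: no node and no direction of the lattice is degenerate for the algebra -/

/-- A space `E` of functions on the lattice, of dimension `d`, is in general position if for every
node `(n,m)` only the zero function of `E` vanishes at the first `d` nodes of
`(n,m), (n+1,m), (n,m+1), …`. -/
def GeneralPosition (E : Submodule ℝ (Site → ℝ)) : Prop :=
  ∀ x : Site, ∀ g ∈ E, (∀ i : Fin 7, (i : ℕ) < Module.finrank ℝ E → g (site x i) = 0) → g = 0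

/-- The space spanned by the constant function and the coefficients `a_{nm}` of the fields in `L`. -/
def multipliers (L : LieSubalgebra ℝ SymField) : Submodule ℝ (Site → ℝ) :=
  Submodule.span ℝ ({fun _ => 1} ∪ {g | ∃ X ∈ L, X.a = g})

/-- The space of the values at time `t` of the coefficients `λ_{nm}` of those fields in `L` that are
of the form `λ_{nm}(t) ∂_{u_{nm}}`. -/
def translations (L : LieSubalgebra ℝ SymField) (t : ℝ) : Submodule ℝ (Site → ℝ) :=
  Submodule.span ℝ {g | ∃ X ∈ L, X.tau = 0 ∧ X.a = 0 ∧ ∀ x, g x = (X.lam x).1 t}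

/-- `L` is isotropic. -/
def IsIsotropic (L : LieSubalgebra ℝ SymField) : Prop :=
  GeneralPosition (multipliers L) ∧ ∀ t, GeneralPosition (translations L t)

/-! ### Allowed transformations -/

/-- Transformations `t̃ = θ(t)`, `u_{nm} = θ̇^{-1/2} P_{nm} ũ_{nm}(t̃) + Q_{nm}(t)` for `t` in an open
interval `J`. -/
structure AllowedTransformation where
  J : Set ℝ
  isOpen : IsOpen J
  isPreconnected : IsPreconnected J
  θ : ℝ → ℝ
  smooth_θ : ContDiffOn ℝ ∞ θ J
  deriv_pos : ∀ t ∈ J, 0 < deriv θ t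
  P : Site → ℝ
  P_ne_zero : ∀ x, P x ≠ 0
  Q : Site → ℝ → ℝ
  smooth_Q : ∀ x, ContDiffOn ℝ ∞ (Q x) J

namespace AllowedTransformation

/-- The old values of `u` on the neighbourhood `Γ` of `x`, from the new ones. -/
def old (T : AllowedTransformation) (x : Site) (t : ℝ) (w : Fin 7 → ℝ) : Fin 7 → ℝ :=
  fun i => deriv T.θ t ^ (-(1 / 2) : ℝ) * T.P (site x i) * w i + T.Q (site x i) t

/-- The transformed interaction `F̃_{nm}` at the new time `θ(t)` and the new values `w` of `u`. -/
def newF (T : AllowedTransformation) (F : Interaction) (x : Site) (t : ℝ) (w : Fin 7 → ℝ) : ℝ :=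
  deriv T.θ t ^ (-(3 / 2) : ℝ) * (T.P x)⁻¹ *
      (F x t (T.old x t w) - iteratedDeriv 2 (T.Q x) t)
    + 1 / 2 * (deriv T.θ t ^ 3)⁻¹ *
      (iteratedDeriv 3 T.θ t - 3 / 2 * (deriv T.θ t)⁻¹ * iteratedDeriv 2 T.θ t ^ 2) * w 0

/-- For times in `J`, the transformation carries the field `X` to the field `Y`. -/
def Related (T : AllowedTransformation) (X Y : SymField) : Prop :=
  (∀ t ∈ T.J, Y.tau.1 (T.θ t) = X.tau.1 t * deriv T.θ t) ∧
  (∀ x, Y.a x = X.a x) ∧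
  (∀ x, ∀ t ∈ T.J, (Y.lam x).1 (T.θ t) =
    deriv T.θ t ^ (1 / 2 : ℝ) * (T.P x)⁻¹ *
      ((deriv X.tau.1 t / 2 + X.a x) * T.Q x t + (X.lam x).1 t - X.tau.1 t * deriv (T.Q x) t))

/-- For times in `J`, the transformation carries `L` onto the space `A` of fields, and the radical
of `L` onto `R`. -/
def Carries (T : AllowedTransformation) (L : LieSubalgebra ℝ SymField)
    (A R : Submodule ℝ SymField) : Prop :=
  (∀ X ∈ L, ∃ Y ∈ A, T.Related X Y) ∧ (∀ Y ∈ A, ∃ X ∈ L, T.Related X Y) ∧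
  (∀ X : L, X ∈ LieAlgebra.radical ℝ L ↔ ∃ Y ∈ R, T.Related X Y)

end AllowedTransformation

/-! ### The normal forms -/

/-- The function `t ↦ t`. -/
def timeFn : smoothFn := ⟨fun t => t, show ContDiff ℝ ∞ (fun t : ℝ => t) from contDiff_id⟩

/-- `∂_t`. -/
def sl2X1 : SymField := SymField.mk 1 0 0

/-- `t ∂_t + (1/2) u_{nm} ∂_{u_{nm}}`. -/
def sl2X2 : SymField := SymField.mk timeFn 0 0

/-- `t² ∂_t + t u_{nm} ∂_{u_{nm}}`. -/
def sl2X3 : SymField := SymField.mk (timeFn ^ 2) 0 0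

/-- `a_{nm} u_{nm} ∂_{u_{nm}}`. -/
def scaleField (a : Site → ℝ) : SymField := SymField.mk 0 a 0

/-- `μ(t) ∂_{u_{nm}}`. -/
def shiftField (μ : smoothFn) : SymField := SymField.mk 0 0 (fun _ => μ)

/-- The radical of `NS_{5,1}`. -/
def radNS51 (a₁ a₂ : Site → ℝ) : Submodule ℝ SymField :=
  Submodule.span ℝ {scaleField a₁, scaleField a₂}

/-- The algebra `NS_{5,1}`. -/
def algNS51 (a₁ a₂ : Site → ℝ) : Submodule ℝ SymField :=
  Submodule.span ℝ {sl2X1, sl2X2, sl2X3} ⊔ radNS51 a₁ a₂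

/-- The radical of `NS_{5,2}`. -/
def radNS52 : Submodule ℝ SymField :=
  Submodule.span ℝ {shiftField 1, shiftField timeFn}

/-- The algebra `NS_{5,2}`. -/
def algNS52 : Submodule ℝ SymField :=
  Submodule.span ℝ {sl2X1, sl2X2, sl2X3} ⊔ radNS52

/-- `𝒟[f_p, g_q]`. -/
def det2 (f g : Site → ℝ) (p q : Site) : ℝ := detD ![f, g] ![p, q]

/-- `𝒟[f_p, g_q, 1_r]`. -/
def det3 (f g : Site → ℝ) (p q r : Site) : ℝ := detD ![f, g, fun _ => 1] ![p, q, r]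

/-- `𝒟[a¹_{nm}, a²_{n+1m}, 1_{nm+1}] ≠ 0` at every node. -/
def NonDegenerate (a₁ a₂ : Site → ℝ) : Prop :=
  ∀ x, det3 a₁ a₂ (site x 0) (site x 1) (site x 2) ≠ 0

/-- The four invariants `ξ_{pq}` of `NS_{5,1}`, one for each
`(p,q) ∈ Γ ∖ {(n,m), (n+1,m), (n,m+1)}`. -/
def xiNS51 (a₁ a₂ : Site → ℝ) (x : Site) (w : Fin 7 → ℝ) (j : Fin 4) : ℝ :=
  let k : Fin 7 := Fin.natAdd 3 j
  |w 0| ^ det3 a₁ a₂ (site x 1) (site x 2) (site x k)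
    * |w 1| ^ (-det3 a₁ a₂ (site x 0) (site x 2) (site x k))
    * |w 2| ^ det3 a₁ a₂ (site x 0) (site x 1) (site x k)
    * |w k| ^ (-det3 a₁ a₂ (site x 0) (site x 1) (site x 2))

/-- The interaction of `NS_{5,1}`. -/
def intNS51 (a₁ a₂ : Site → ℝ) (x : Site) (f : (Fin 4 → ℝ) → ℝ) (w : Fin 7 → ℝ) : ℝ :=
  w 0 * (|w 0| ^ (-det2 a₁ a₂ (site x 1) (site x 2))
      * |w 1| ^ det2 a₁ a₂ (site x 0) (site x 2)
      * |w 2| ^ (-det2 a₁ a₂ (site x 0) (site x 1)))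
        ^ (4 / det3 a₁ a₂ (site x 0) (site x 1) (site x 2))
    * f (xiNS51 a₁ a₂ x w)

/-- The five invariants `ξ_{pq}` of `NS_{5,2}`, one for each `(p,q) ∈ Γ ∖ {(n,m), (n+1,m)}`;
note that `𝒟[u_{nm}, 1_{pq}] = u_{nm} - u_{pq}`. -/
def xiNS52 (w : Fin 7 → ℝ) (j : Fin 5) : ℝ :=
  let k : Fin 7 := Fin.natAdd 2 j
  (w 0 - w k) / (w 0 - w 1)

/-- The interaction of `NS_{5,2}`. -/
def intNS52 (f : (Fin 5 → ℝ) → ℝ) (w : Fin 7 → ℝ) : ℝ :=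
  ((w 0 - w 1) ^ 3)⁻¹ * f (xiNS52 w)

/-- The box `∏ B_i`. -/
def box (B : Fin 7 → Set ℝ) : Set (Fin 7 → ℝ) := {w | ∀ i, w i ∈ B i}

/-- Around the time `t₀` an allowed transformation carries `L` to `NS_{5,1}`, and the interactions to
the interactions of `NS_{5,1}`, on every box where the powers make sense. -/
def EquivNS51At (F : Interaction) (Ω : Domain) (L : LieSubalgebra ℝ SymField) (t₀ : ℝ) : Prop :=
  ∃ (T : AllowedTransformation) (a₁ a₂ : Site → ℝ),
    t₀ ∈ T.J ∧ NonDegenerate a₁ a₂ ∧ T.Carries L (algNS51 a₁ a₂) (radNS51 a₁ a₂) ∧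
    ∀ (x : Site) (I : Set ℝ) (B : Fin 7 → Set ℝ),
      IsOpen I → IsPreconnected I → I ⊆ T.J →
      (∀ i, IsOpen (B i)) → (∀ i, IsPreconnected (B i)) → (∀ i, (0 : ℝ) ∉ B i) →
      (∀ t ∈ I, ∀ w ∈ box B, (t, T.old x t w) ∈ Ω x) →
      ∃ f : (Fin 4 → ℝ) → ℝ, ContDiffOn ℝ ∞ f (xiNS51 a₁ a₂ x '' box B) ∧
        ∀ t ∈ I, ∀ w ∈ box B, T.newF F x t w = intNS51 a₁ a₂ x f w

/-- Around the time `t₀` an allowed transformation carries `L` to `NS_{5,2}`, and the interactions to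
the interactions of `NS_{5,2}`, on every box where `u_{nm} ≠ u_{n+1m}`. -/
def EquivNS52At (F : Interaction) (Ω : Domain) (L : LieSubalgebra ℝ SymField) (t₀ : ℝ) : Prop :=
  ∃ T : AllowedTransformation,
    t₀ ∈ T.J ∧ T.Carries L algNS52 radNS52 ∧
    ∀ (x : Site) (I : Set ℝ) (B : Fin 7 → Set ℝ),
      IsOpen I → IsPreconnected I → I ⊆ T.J →
      (∀ i, IsOpen (B i)) → (∀ i, IsPreconnected (B i)) → Disjoint (B 0) (B 1) →
      (∀ t ∈ I, ∀ w ∈ box B, (t, T.old x t w) ∈ Ω x) →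
      ∃ f : (Fin 5 → ℝ) → ℝ, ContDiffOn ℝ ∞ f (xiNS52 '' box B) ∧
        ∀ t ∈ I, ∀ w ∈ box B, T.newF F x t w = intNS52 f w

/-- `A` is a five-dimensional nonsolvable Lie algebra of symmetries with radical `R`. -/
def IsSymmetryAlgebra5 (A R : Submodule ℝ SymField) (F : Interaction) (Ω : Domain) : Prop :=
  ∃ L : LieSubalgebra ℝ SymField, L.toSubmodule = A ∧ Module.finrank ℝ L = 5 ∧
    ¬ LieAlgebra.IsSolvable L ∧ (∀ X : L, X ∈ LieAlgebra.radical ℝ L ↔ (X : SymField) ∈ R) ∧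
    ∀ X ∈ L, X.IsSymmetry F Ω

/-- The domain of the interaction of `NS_{5,1}` when `f_{nm}` is defined on `V x`. -/
def domNS51 (a₁ a₂ : Site → ℝ) (V : Site → Set (Fin 4 → ℝ)) : Domain :=
  fun x => {p | (∀ i, p.2 i ≠ 0) ∧ xiNS51 a₁ a₂ x p.2 ∈ V x}

/-- The domain of the interaction of `NS_{5,2}` when `f_{nm}` is defined on `V x`. -/
def domNS52 (V : Site → Set (Fin 5 → ℝ)) : Domain :=
  fun x => {p | p.2 0 ≠ p.2 1 ∧ xiNS52 p.2 ∈ V x}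

end

/-! Form of the symmetries. The symmetry condition is a cubic polynomial in the free velocity `v`.
Its coefficients of `v` and `v²` give `2φ_{tu} - τ_{tt} - 3τ_u F = 0` and `φ_{uu} = 2τ_{tu}`. In the
first equation only `F` sees the neighbours, so coupling forces `τ_u = 0`; then `φ` is affine in `u`
with slope `τ̇/2 + const` (`PointField.form_of_isSymmetry`).

Structure of `L`. The map `X ↦ τ` is a homomorphism to vector fields on the line. Its kernel is
solvable, so its image is not. By Lie's argument such an image is `sl(2, ℝ)`: its members have no
common zero, and the order of vanishing at a point filters it with quotients of dimension at most
one, the top order being two (`exists_isSplitTriple`, `exists_isSl2`). Hence the kernel is the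
radical and has dimension `5 - 3 = 2`. Everything then depends on `translationFields L`. If it is
zero, a field of `L` is determined by `τ` and `a`; since all brackets have `a = 0`, the kernel is
central and `sl(2, ℝ)` lifts to `L`. If it is not zero, a trace argument gives a translation `v`
killed by `X₁`; the kernel is spanned by `v` and `⁅X₃, v⁆`, and `sl(2, ℝ)` lifts after a correction
because `ad X₂` has eigenvalues `±1/2` on it (`exists_frame_of_translations`). This alternative does
not mention a time, so the class is the same at all times; the classes differ because only one
radical has nonzero multipliers `a`.

Normal form. Near `t₀` a lifted triple is straightened by the new time `x₂ / x₁` and a shift `Q`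
that removes the `λ` of all three fields. Then `X₁` makes the new interaction independent of time,
`X₂` makes it homogeneous of degree `-3`, and the radical gives two scaling equations or invariance
under translations. Integration along paths in a box shows that it is a fixed factor times a
function of the invariants (`exists_intNS51`, `exists_intNS52`). Isotropy makes the determinants,
respectively the scale factors `P`, nonzero. The independence of `1`, `a₁`, `a₂` comes from
coupling: a multiplier equal to `1` would make the new interaction homogeneous of degrees `1` and
`-3` at once, hence zero.

Converse and maximality. The converse differentiates the behaviour of the factor and of the
invariants under scalings and translations. For maximality the examples are `f = 1 + ∑ ξ` with the
lattice coordinates as `a₁`, `a₂`, and `f = 1 + ∑ ξ²`. Homogeneity splits the determining equation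
into four (`detEq_separate`), which are solved by inserting test points. -/

open scoped ContDiff

/-! ### Smooth functions and the determining equations -/

namespace smoothFn

theorem contDiff (f : smoothFn) : ContDiff ℝ ∞ f.1 := f.2

theorem hasDerivAt (f : smoothFn) (t : ℝ) : HasDerivAt f.1 ((dt f).1 t) t :=
  ((contDiff_infty_iff_deriv.1 f.2).1 t).hasDerivAt

theorem continuous (f : smoothFn) : Continuous f.1 := (contDiff f).continuous

theorem deriv_eq (f : smoothFn) : deriv f.1 = (dt f).1 := rfl

@[simp] theorem mul_apply (f g : smoothFn) (t : ℝ) : (f * g).1 t = f.1 t * g.1 t := rfl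
@[simp] theorem add_apply (f g : smoothFn) (t : ℝ) : (f + g).1 t = f.1 t + g.1 t := rfl
@[simp] theorem sub_apply (f g : smoothFn) (t : ℝ) : (f - g).1 t = f.1 t - g.1 t := rfl
@[simp] theorem neg_apply (f : smoothFn) (t : ℝ) : (-f).1 t = -f.1 t := rfl
@[simp] theorem smul_apply (c : ℝ) (f : smoothFn) (t : ℝ) : (c • f).1 t = c * f.1 t := rfl
@[simp] theorem zero_apply (t : ℝ) : (0 : smoothFn).1 t = 0 := rfl
@[simp] theorem one_apply (t : ℝ) : (1 : smoothFn).1 t = 1 := rfl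
@[simp] theorem timeFn_apply (t : ℝ) : timeFn.1 t = t := rfl
@[simp] theorem timeFn_sq_apply (t : ℝ) : (timeFn ^ 2).1 t = t ^ 2 := rfl

@[ext] theorem ext {f g : smoothFn} (h : ∀ t, f.1 t = g.1 t) : f = g := Subtype.ext (funext h)

@[simp] theorem dt_one : dt 1 = 0 := dt.map_one_eq_zero

@[simp] theorem dt_timeFn : dt timeFn = 1 := by
  ext t
  exact (hasDerivAt_id t).deriv

@[simp] theorem dt_timeFn_sq : dt (timeFn ^ 2) = (2 : ℝ) • timeFn := by
  rw [pow_two, Derivation.leibniz, dt_timeFn]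
  ext t
  simp
  ring

/-- The derivative at a point, linear in the function. -/
theorem eventuallyEq_zero_dt {f : smoothFn} {t : ℝ} (h : f.1 =ᶠ[nhds t] 0) :
    (dt f).1 =ᶠ[nhds t] 0 := by
  have := h.deriv
  simp only [Pi.zero_def, deriv_const'] at this
  exact this

end smoothFn

namespace SymField

@[simp] theorem b_apply (X : SymField) (x : Site) (t : ℝ) :
    (X.b x).1 t = (dt X.tau).1 t / 2 + X.a x := by
  simp [b]
  ring

@[simp] theorem tau_sub (X Y : SymField) : (X - Y).tau = X.tau - Y.tau := rfl
@[simp] theorem a_sub (X Y : SymField) (x : Site) : (X - Y).a x = X.a x - Y.a x := rfl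
@[simp] theorem lam_sub (X Y : SymField) (x : Site) : (X - Y).lam x = X.lam x - Y.lam x := rfl
@[simp] theorem tau_neg (X : SymField) : (-X).tau = -X.tau := rfl
@[simp] theorem a_neg (X : SymField) (x : Site) : (-X).a x = -X.a x := rfl
@[simp] theorem lam_neg (X : SymField) (x : Site) : (-X).lam x = -X.lam x := rfl
@[simp] theorem mk_zero : mk 0 0 0 = 0 := rfl

theorem hasDerivAt_jetCurve (t u v c s : ℝ) :
    HasDerivAt (jetCurve t u v c) (v + c * (s - t)) s := by
  change HasDerivAt (fun s => u + v * (s - t) + c / 2 * (s - t) ^ 2) _ s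
  have h : HasDerivAt (fun s : ℝ => s - t) 1 s := (hasDerivAt_id s).sub_const t
  have := ((h.const_mul v).const_add u).add ((h.pow 2).const_mul (c / 2))
  refine this.congr_deriv ?_
  norm_num
  ring

/-- The velocity cancels: `D_t² φ` contains `τ̈ v / 2` twice, once from each factor of the product
`(τ̇/2 + a) u`, and `-(D_t² τ) v` removes both. -/
theorem phitt_toPointField (X : SymField) (x : Site) (t u v c : ℝ) :
    X.toPointField.phitt x t u v c = (dt (dt (dt X.tau))).1 t / 2 * u + (dt (dt (X.lam x))).1 t
      + (X.a x - 3 / 2 * (dt X.tau).1 t) * c := by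
  have key : ∀ s, HasDerivAt (fun s => X.toPointField.phi x s (jetCurve t u v c s))
      ((dt (dt X.tau)).1 s / 2 * jetCurve t u v c s
        + ((dt X.tau).1 s / 2 + X.a x) * (v + c * (s - t)) + (dt (X.lam x)).1 s) s := fun s =>
    (((smoothFn.hasDerivAt (dt X.tau) s).div_const 2).add_const (X.a x)).mul (hasDerivAt_jetCurve t u v c s)
      |>.add (smoothFn.hasDerivAt (X.lam x) s)
  have key2 : HasDerivAt (fun s => (dt (dt X.tau)).1 s / 2 * jetCurve t u v c s
        + ((dt X.tau).1 s / 2 + X.a x) * (v + c * (s - t)) + (dt (X.lam x)).1 s)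
      ((dt (dt (dt X.tau))).1 t / 2 * u + (dt (dt X.tau)).1 t / 2 * v
       + ((dt (dt X.tau)).1 t / 2 * v + ((dt X.tau).1 t / 2 + X.a x) * c)
       + (dt (dt (X.lam x))).1 t) t := by
    have h1 := (smoothFn.hasDerivAt (dt (dt X.tau)) t).div_const 2 |>.mul (hasDerivAt_jetCurve t u v c t)
    have h2 := ((smoothFn.hasDerivAt (dt X.tau) t).div_const 2).add_const (X.a x) |>.mul
      ((((hasDerivAt_id t).sub_const t).const_mul c).const_add v)
    refine ((h1.add h2).add (smoothFn.hasDerivAt (dt (X.lam x)) t)).congr_deriv ?_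
    simp [jetCurve]
  have e : deriv (fun s => X.toPointField.phi x s (jetCurve t u v c s)) =
      fun s => (dt (dt X.tau)).1 s / 2 * jetCurve t u v c s
        + ((dt X.tau).1 s / 2 + X.a x) * (v + c * (s - t)) + (dt (X.lam x)).1 s :=
    funext fun s => (key s).deriv
  have e1 : totalDeriv2 (X.toPointField.phi x) t u v c =
      (dt (dt (dt X.tau))).1 t / 2 * u + (dt (dt X.tau)).1 t / 2 * v
       + ((dt (dt X.tau)).1 t / 2 * v + ((dt X.tau).1 t / 2 + X.a x) * c)
       + (dt (dt (X.lam x))).1 t := by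
    rw [totalDeriv2, iteratedDeriv_succ, iteratedDeriv_one, e, key2.deriv]
  have e2 : totalDeriv2 X.toPointField.tau t u v c = (dt (dt X.tau)).1 t := by
    rw [totalDeriv2, iteratedDeriv_succ, iteratedDeriv_one]
    rfl
  have e3 : totalDeriv X.toPointField.tau t u v c = (dt X.tau).1 t := rfl
  rw [PointField.phitt, e1, e2, e3]
  ring

/-- The determining equation at a point. -/
def DetEq (X : SymField) (F : Interaction) (x : Site) (t : ℝ) (w : Fin 7 → ℝ) : Prop :=
  (dt (dt (dt X.tau))).1 t / 2 * w 0 + (dt (dt (X.lam x))).1 t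
      + (X.a x - 3 / 2 * (dt X.tau).1 t) * F x t w
      - X.tau.1 t * deriv (fun s => F x s w) t
      - ∑ i, (((dt X.tau).1 t / 2 + X.a (site x i)) * w i + (X.lam (site x i)).1 t)
          * partialU (F x t) i w = 0

/-- The prolongation coefficient is free of the velocity, so testing at velocity zero loses nothing.
-/
theorem isSymmetry_iff (X : SymField) (F : Interaction) (Ω : Domain) :
    X.IsSymmetry F Ω ↔ ∀ x, ∀ p ∈ Ω x, X.DetEq F x p.1 p.2 := by
  unfold SymField.IsSymmetry PointField.IsSymmetry
  simp only [phitt_toPointField]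
  constructor
  · intro h x p hp
    exact h x p hp 0
  · intro h x p hp _
    exact h x p hp

end SymField

/-- The partial derivatives of a differentiable function. -/
theorem partialU_eq_fderiv {g : (Fin 7 → ℝ) → ℝ} {w : Fin 7 → ℝ} (hg : DifferentiableAt ℝ g w)
    (i : Fin 7) : partialU g i w = fderiv ℝ g w (Pi.single i 1) := by
  have h := hasDerivAt_update w i (w i)
  have hg' : HasFDerivAt g (fderiv ℝ g w) (Function.update w i (w i)) := by
    rw [Function.update_eq_self]
    exact hg.hasFDerivAt
  exact (hg'.comp_hasDerivAt _ h).deriv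

/-- This turns the sum over `Γ` in the determining equation into a single directional derivative, on
which linearity can be used. -/
theorem sum_mul_partialU {g : (Fin 7 → ℝ) → ℝ} {w : Fin 7 → ℝ} (hg : DifferentiableAt ℝ g w)
    (v : Fin 7 → ℝ) : ∑ i, v i * partialU g i w = fderiv ℝ g w v := by
  conv_rhs => rw [pi_eq_sum_univ' v]
  simp [map_sum, partialU_eq_fderiv hg]

/-! ### The general form of a point symmetry -/

section TotalDerivatives

variable {g : ℝ → ℝ → ℝ} {t u : ℝ}

theorem hasDerivAt_jet (t u v c s : ℝ) :
    HasDerivAt (fun s => (s, jetCurve t u v c s)) ((1, v + c * (s - t)) : ℝ × ℝ) s :=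
  (hasDerivAt_id s).prodMk (SymField.hasDerivAt_jetCurve t u v c s)

theorem totalDeriv_eq (hg : ContDiffAt ℝ ∞ (fun q : ℝ × ℝ => g q.1 q.2) (t, u)) (v c : ℝ) :
    totalDeriv g t u v c = fderiv ℝ (fun q : ℝ × ℝ => g q.1 q.2) (t, u) (1, v) := by
  have h1 : (t, jetCurve t u v c t) = (t, u) := by simp [jetCurve]
  have h := (hg.differentiableAt (by simp)).hasFDerivAt
  rw [← h1] at h
  have := (h.comp_hasDerivAt t (hasDerivAt_jet t u v c t)).deriv
  rw [h1] at this
  simpa [totalDeriv, Function.comp_def] using this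

theorem totalDeriv2_eq (hg : ContDiffAt ℝ ∞ (fun q : ℝ × ℝ => g q.1 q.2) (t, u)) (v c : ℝ) :
    totalDeriv2 g t u v c =
      fderiv ℝ (fderiv ℝ (fun q : ℝ × ℝ => g q.1 q.2)) (t, u) (1, v) (1, v)
        + fderiv ℝ (fun q : ℝ × ℝ => g q.1 q.2) (t, u) (0, c) := by
  set G : ℝ × ℝ → ℝ := fun q => g q.1 q.2 with hG
  have h1 : (t, jetCurve t u v c t) = (t, u) := by simp [jetCurve]
  have hev : ∀ᶠ q in nhds (t, u), DifferentiableAt ℝ G q :=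
    ((hg.of_le (by exact_mod_cast le_top : (1 : WithTop ℕ∞) ≤ ∞)).eventually (by simp)).mono
      fun q hq => hq.differentiableAt (by simp)
  have hcont : ContinuousAt (fun s => (s, jetCurve t u v c s)) t :=
    (hasDerivAt_jet t u v c t).continuousAt
  have e : deriv (fun s => g s (jetCurve t u v c s)) =ᶠ[nhds t]
      fun s => fderiv ℝ G (s, jetCurve t u v c s) (1, v + c * (s - t)) := by
    have : ∀ᶠ s in nhds t, DifferentiableAt ℝ G (s, jetCurve t u v c s) := by
      refine hcont.eventually (p := fun q => DifferentiableAt ℝ G q) ?_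
      simp only [h1]
      exact hev
    filter_upwards [this] with s hs
    exact (hs.hasFDerivAt.comp_hasDerivAt s (hasDerivAt_jet t u v c s)).deriv
  have h2 : HasFDerivAt (fderiv ℝ G) (fderiv ℝ (fderiv ℝ G) (t, u)) (t, jetCurve t u v c t) := by
    rw [h1]
    exact ((hg.fderiv_right (m := ∞) (by simp)).differentiableAt
      (by simp)).hasFDerivAt
  have h3 := h2.comp_hasDerivAt t (hasDerivAt_jet t u v c t)
  have h4 : HasDerivAt (fun s : ℝ => ((1, v + c * (s - t)) : ℝ × ℝ)) (0, c) t := by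
    have := (hasDerivAt_const t (1 : ℝ)).prodMk
      ((((hasDerivAt_id t).sub_const t).const_mul c).const_add v)
    simpa using this
  have h5 := h3.clm_apply h4
  rw [totalDeriv2, iteratedDeriv_succ, iteratedDeriv_one, e.deriv_eq]
  have := h5.deriv
  simp only [Function.comp_def, h1] at this
  rw [this]
  simp

end TotalDerivatives

theorem clm_prod_apply (A : ℝ × ℝ →L[ℝ] ℝ) (a b : ℝ) : A (a, b) = a * A (1, 0) + b * A (0, 1) := by
  have : ((a, b) : ℝ × ℝ) = a • ((1, 0) : ℝ × ℝ) + b • ((0, 1) : ℝ × ℝ) := by simp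
  rw [this, map_add, map_smul, map_smul]; rfl

theorem clm2_prod_apply (A : ℝ × ℝ →L[ℝ] ℝ × ℝ →L[ℝ] ℝ) (v : ℝ) : A (1, v) (1, v) =
    A (1, 0) (1, 0) + v * (A (1, 0) (0, 1) + A (0, 1) (1, 0)) + v ^ 2 * A (0, 1) (0, 1) := by
  have : ((1, v) : ℝ × ℝ) = ((1, 0) : ℝ × ℝ) + v • ((0, 1) : ℝ × ℝ) := by simp
  rw [this]
  simp only [map_add, map_smul, _root_.add_apply, _root_.smul_apply, smul_eq_mul]
  ring

/-- Four values of `v` determine a cubic. Only the two middle coefficients matter: `A` contains the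
derivatives of the interaction, and `D` gives nothing beyond `τ_u = 0`. -/
theorem coeffs_eq_zero_of_cubic {A B C D : ℝ} (h : ∀ v : ℝ, A + B * v + C * v ^ 2 + D * v ^ 3 = 0) :
    B = 0 ∧ C = 0 := by
  have h0 := h 0
  have h1 := h 1
  have h2 := h (-1)
  have h3 := h 2
  constructor <;> linarith

section

variable {F : Interaction} {Ω : Domain} {X : PointField}

/-- The coefficients of `v` and `v²` in the symmetry condition. -/
theorem PointField.velocity_coeffs (hX : X.IsSmoothOn Ω) (hs : X.IsSymmetry F Ω) {x : Site}
    {p : ℝ × (Fin 7 → ℝ)} (hp : p ∈ Ω x) :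
    let T := fun q : ℝ × ℝ => X.tau q.1 q.2
    let Φ := fun q : ℝ × ℝ => X.phi x q.1 q.2
    let q : ℝ × ℝ := (p.1, p.2 0)
    fderiv ℝ (fderiv ℝ Φ) q (1, 0) (0, 1) + fderiv ℝ (fderiv ℝ Φ) q (0, 1) (1, 0)
      - fderiv ℝ (fderiv ℝ T) q (1, 0) (1, 0) - 3 * fderiv ℝ T q (0, 1) * F x p.1 p.2 = 0 ∧
    fderiv ℝ (fderiv ℝ Φ) q (0, 1) (0, 1)
      - (fderiv ℝ (fderiv ℝ T) q (1, 0) (0, 1) + fderiv ℝ (fderiv ℝ T) q (0, 1) (1, 0)) = 0 := by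
  intro T Φ q
  obtain ⟨hT, hΦ⟩ := hX x p hp
  refine coeffs_eq_zero_of_cubic
    (A := fderiv ℝ (fderiv ℝ Φ) q (1, 0) (1, 0) + F x p.1 p.2 * fderiv ℝ Φ q (0, 1)
      - 2 * fderiv ℝ T q (1, 0) * F x p.1 p.2
      - X.tau p.1 (p.2 0) * deriv (fun s => F x s p.2) p.1
      - ∑ i, X.phi (site x i) p.1 (p.2 i) * partialU (F x p.1) i p.2)
    (D := -fderiv ℝ (fderiv ℝ T) q (0, 1) (0, 1)) fun v => ?_
  have h := hs x p hp v
  have a1 : totalDeriv2 (X.phi x) p.1 (p.2 0) v (F x p.1 p.2) =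
      fderiv ℝ (fderiv ℝ Φ) q (1, 0) (1, 0) + v * (fderiv ℝ (fderiv ℝ Φ) q (1, 0) (0, 1)
        + fderiv ℝ (fderiv ℝ Φ) q (0, 1) (1, 0)) + v ^ 2 * fderiv ℝ (fderiv ℝ Φ) q (0, 1) (0, 1)
        + F x p.1 p.2 * fderiv ℝ Φ q (0, 1) := by
    rw [totalDeriv2_eq hΦ, clm2_prod_apply]
    change _ + fderiv ℝ Φ q (0, F x p.1 p.2) = _
    rw [clm_prod_apply (fderiv ℝ Φ q) 0 (F x p.1 p.2), zero_mul, zero_add]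
  have a2 : totalDeriv2 X.tau p.1 (p.2 0) v (F x p.1 p.2) =
      fderiv ℝ (fderiv ℝ T) q (1, 0) (1, 0) + v * (fderiv ℝ (fderiv ℝ T) q (1, 0) (0, 1)
        + fderiv ℝ (fderiv ℝ T) q (0, 1) (1, 0)) + v ^ 2 * fderiv ℝ (fderiv ℝ T) q (0, 1) (0, 1)
        + F x p.1 p.2 * fderiv ℝ T q (0, 1) := by
    rw [totalDeriv2_eq hT, clm2_prod_apply]
    change _ + fderiv ℝ T q (0, F x p.1 p.2) = _
    rw [clm_prod_apply (fderiv ℝ T q) 0 (F x p.1 p.2), zero_mul, zero_add]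
  have a3 : totalDeriv X.tau p.1 (p.2 0) v (F x p.1 p.2) =
      fderiv ℝ T q (1, 0) + v * fderiv ℝ T q (0, 1) := by
    rw [totalDeriv_eq hT, clm_prod_apply _ 1, one_mul]
  rw [PointField.phitt, a1, a2, a3] at h
  linear_combination h

/-- In the coefficient of `v` everything except `F` depends on `(t, u_{nm})` alone. If `τ_u ≠ 0` at
a point, `F` would not change with `u_{n+1m}` near it. So `τ_u` vanishes where `∂F/∂u_{n+1m} ≠ 0`, a
dense set by coupling, and then everywhere by continuity. -/
theorem PointField.tau_u_eq_zero (hF : IsNonlinearCoupled F Ω) (hX : X.IsSmoothOn Ω)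
    (hs : X.IsSymmetry F Ω) {x : Site} {p : ℝ × (Fin 7 → ℝ)} (hp : p ∈ Ω x) :
    fderiv ℝ (fun q : ℝ × ℝ => X.tau q.1 q.2) (p.1, p.2 0) (0, 1) = 0 := by
  set T := fun q : ℝ × ℝ => X.tau q.1 q.2
  have hdense : ∀ p ∈ Ω x, partialU (F x p.1) 1 p.2 ≠ 0 →
      fderiv ℝ T (p.1, p.2 0) (0, 1) = 0 := by
    intro p hp hne
    by_contra hτ
    have hopen : ∀ᶠ r in nhds (p.2 1), ((p.1, Function.update p.2 1 r) : ℝ × (Fin 7 → ℝ)) ∈ Ω x := by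
      have hc : Continuous fun r : ℝ => ((p.1, Function.update p.2 1 r) : ℝ × (Fin 7 → ℝ)) := by
        fun_prop
      apply hc.continuousAt.eventually ((hF.isOpen x).mem_nhds _)
      simpa using hp
    have hconst : (fun r => F x p.1 (Function.update p.2 1 r)) =ᶠ[nhds (p.2 1)]
        fun _ => F x p.1 p.2 := by
      filter_upwards [hopen] with r hr
      have h1 := (PointField.velocity_coeffs hX hs hp).1
      have h2 := (PointField.velocity_coeffs hX hs hr).1
      have e : Function.update p.2 1 r 0 = p.2 0 := by simp [Function.update]
      simp only [e] at h1 h2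
      have : 3 * fderiv ℝ T (p.1, p.2 0) (0, 1) *
        (F x p.1 (Function.update p.2 1 r) - F x p.1 p.2) = 0 := by linear_combination h1 - h2
      have := (mul_eq_zero.1 this).resolve_left (by simpa using hτ)
      linarith
    apply hne
    rw [partialU, hconst.deriv_eq, deriv_const]
  have hcont : ContinuousAt (fun p : ℝ × (Fin 7 → ℝ) => fderiv ℝ T (p.1, p.2 0) (0, 1)) p := by
    have h1 : ContinuousAt (fderiv ℝ T) (p.1, p.2 0) :=
      ((hX x p hp).1.fderiv_right (m := 0) (by exact_mod_cast le_top)).continuousAt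
    have h2 : ContinuousAt (fun p : ℝ × (Fin 7 → ℝ) => ((p.1, p.2 0) : ℝ × ℝ)) p := by fun_prop
    have h3 : ContinuousAt (fun p : ℝ × (Fin 7 → ℝ) => fderiv ℝ T (p.1, p.2 0)) p :=
      ContinuousAt.comp (f := fun p : ℝ × (Fin 7 → ℝ) => ((p.1, p.2 0) : ℝ × ℝ)) h1 h2
    exact h3.clm_apply continuousAt_const
  by_contra hne
  have hmem := hF.coupled x 1 hp
  rw [mem_closure_iff_frequently] at hmem
  obtain ⟨y, ⟨hy, hy'⟩, hy2⟩ := (hmem.and_eventually (hcont.eventually_ne hne)).exists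
  exact hy2 (hdense y hy hy')

/-- Moving only slot `0` stays inside the open domain, so equations known over the domain hold on a
full ball of the `(t, u_{nm})`-plane. -/
theorem eventually_exists_over (hF : IsNonlinearCoupled F Ω) {x : Site} {p : ℝ × (Fin 7 → ℝ)}
    (hp : p ∈ Ω x) : ∀ᶠ q in nhds ((p.1, p.2 0) : ℝ × ℝ), ∃ p' ∈ Ω x, (p'.1, p'.2 0) = q := by
  have hc : Continuous fun q : ℝ × ℝ => ((q.1, Function.update p.2 0 q.2) : ℝ × (Fin 7 → ℝ)) := by
    fun_prop
  have hc' : ContinuousAt (fun q : ℝ × ℝ =>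
    ((q.1, Function.update p.2 0 q.2) : ℝ × (Fin 7 → ℝ))) (p.1, p.2 0) := hc.continuousAt
  have := hc'.eventually ((hF.isOpen x).mem_nhds (by simpa using hp))
  filter_upwards [this] with q hq
  exact ⟨_, hq, by simp⟩

/-- A function whose derivative in the second direction vanishes on a ball. -/
theorem eq_of_fderiv_snd_eq_zero {G : ℝ × ℝ → ℝ} {q₀ : ℝ × ℝ} {r : ℝ}
    (hd : ∀ q ∈ Metric.ball q₀ r, DifferentiableAt ℝ G q)
    (h0 : ∀ q ∈ Metric.ball q₀ r, fderiv ℝ G q (0, 1) = 0) {q : ℝ × ℝ}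
    (hq : q ∈ Metric.ball q₀ r) : G q = G (q.1, q₀.2) := by
  rw [← ball_prod_same] at hq hd h0
  have hder : ∀ s ∈ Metric.ball q₀.2 r, HasDerivAt (fun s => G (q.1, s)) 0 s := by
    intro s hs
    have hmem : (q.1, s) ∈ Metric.ball q₀.1 r ×ˢ Metric.ball q₀.2 r := ⟨hq.1, hs⟩
    have := (hd _ hmem).hasFDerivAt.comp_hasDerivAt s
      ((hasDerivAt_const s q.1).prodMk (hasDerivAt_id s))
    rw [h0 _ hmem] at this
    exact this
  refine Metric.isOpen_ball.is_const_of_deriv_eq_zero (convex_ball q₀.2 r).isPreconnected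
    (fun s hs => (hder s hs).differentiableAt.differentiableWithinAt)
    (fun s hs => (hder s hs).deriv) hq.2 (Metric.mem_ball_self ?_)
  exact Metric.nonempty_ball.1 ⟨_, hq.2⟩

/-- With `τ_u = 0` the two velocity coefficients become `φ_{uu} = 0` and `φ_{tu} = τ_{tt} / 2`. Thus
`φ` is affine in `u`, and its slope minus `τ̇ / 2` has zero derivative in `t`. -/
theorem PointField.form_of_isSymmetry (hF : IsNonlinearCoupled F Ω) (hX : X.IsSmoothOn Ω)
    (hs : X.IsSymmetry F Ω) {x : Site} {p : ℝ × (Fin 7 → ℝ)} (hp : p ∈ Ω x) :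
    ∃ (τ : ℝ → ℝ) (a : ℝ) (l : ℝ → ℝ), ContDiffAt ℝ ∞ τ p.1 ∧ ContDiffAt ℝ ∞ l p.1 ∧
      ∀ᶠ q in nhds (p.1, p.2 0), X.tau q.1 q.2 = τ q.1 ∧
        X.phi x q.1 q.2 = (deriv τ q.1 / 2 + a) * q.2 + l q.1 := by
  set T := fun q : ℝ × ℝ => X.tau q.1 q.2 with hT
  set Φ := fun q : ℝ × ℝ => X.phi x q.1 q.2 with hΦ
  set q₀ : ℝ × ℝ := (p.1, p.2 0) with hq₀
  obtain ⟨r, hr, hball⟩ := Metric.eventually_nhds_iff_ball.1 (eventually_exists_over hF hp)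
  have hsm : ∀ q ∈ Metric.ball q₀ r, ContDiffAt ℝ ∞ T q ∧ ContDiffAt ℝ ∞ Φ q := by
    intro q hq
    obtain ⟨p', hp', rfl⟩ := hball q hq
    exact hX x p' hp'
  have hTu : ∀ q ∈ Metric.ball q₀ r, fderiv ℝ T q (0, 1) = 0 := by
    intro q hq
    obtain ⟨p', hp', rfl⟩ := hball q hq
    exact PointField.tau_u_eq_zero hF hX hs hp'
  have hcoef : ∀ q ∈ Metric.ball q₀ r,
      fderiv ℝ (fderiv ℝ Φ) q (1, 0) (0, 1) + fderiv ℝ (fderiv ℝ Φ) q (0, 1) (1, 0)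
        - fderiv ℝ (fderiv ℝ T) q (1, 0) (1, 0) = 0 ∧
      fderiv ℝ (fderiv ℝ Φ) q (0, 1) (0, 1)
        - (fderiv ℝ (fderiv ℝ T) q (1, 0) (0, 1) + fderiv ℝ (fderiv ℝ T) q (0, 1) (1, 0)) = 0 := by
    intro q hq
    have h0 := hTu q hq
    obtain ⟨p', hp', rfl⟩ := hball q hq
    have h := PointField.velocity_coeffs hX hs hp'
    refine ⟨?_, h.2⟩
    have h1 := h.1
    simp only [← hT, ← hΦ, h0] at h1
    linear_combination h1
  have hd2 : ∀ {G : ℝ × ℝ → ℝ} {q}, ContDiffAt ℝ ∞ G q → DifferentiableAt ℝ (fderiv ℝ G) q :=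
    fun h => (h.fderiv_right (m := ∞) (by simp)).differentiableAt (by simp)
  have hd2' : ∀ {G : ℝ × ℝ → ℝ} {q} (v : ℝ × ℝ), ContDiffAt ℝ ∞ G q →
      HasFDerivAt (fun q => fderiv ℝ G q v) ((fderiv ℝ (fderiv ℝ G) q).flip v) q := by
    intro G q v h
    have := (hd2 h).hasFDerivAt.clm_apply (hasFDerivAt_const v q)
    refine this.congr_fderiv ?_
    ext <;> simp
  have hTtu : ∀ q ∈ Metric.ball q₀ r, ∀ v, fderiv ℝ (fderiv ℝ T) q v (0, 1) = 0 := by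
    intro q hq v
    have h1 := (hd2' (0, 1) (hsm q hq).1).fderiv
    have h2 : (fun q => fderiv ℝ T q (0, 1)) =ᶠ[nhds q] fun _ => 0 := by
      filter_upwards [Metric.isOpen_ball.mem_nhds hq] with q' hq' using hTu q' hq'
    rw [h2.fderiv_eq] at h1
    have := congrArg (fun A => A v) h1
    simpa using this.symm
  have hsymm : ∀ {G : ℝ × ℝ → ℝ} {q}, ContDiffAt ℝ ∞ G q → ∀ v w,
      fderiv ℝ (fderiv ℝ G) q v w = fderiv ℝ (fderiv ℝ G) q w v := by
    intro G q h v w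
    exact (h.isSymmSndFDerivAt (by
      simp only [minSmoothness_of_isRCLikeNormedField]
      exact WithTop.coe_le_coe.2 (le_top : (2 : ℕ∞) ≤ ⊤))) v w
  have hΦuu : ∀ q ∈ Metric.ball q₀ r, fderiv ℝ (fderiv ℝ Φ) q (0, 1) (0, 1) = 0 := by
    intro q hq
    have := (hcoef q hq).2
    rw [hsymm (hsm q hq).1 (0, 1) (1, 0), hTtu q hq] at this
    linarith
  have hΦtu : ∀ q ∈ Metric.ball q₀ r, fderiv ℝ (fderiv ℝ Φ) q (1, 0) (0, 1)
      = fderiv ℝ (fderiv ℝ T) q (1, 0) (1, 0) / 2 := by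
    intro q hq
    have := (hcoef q hq).1
    rw [hsymm (hsm q hq).2 (0, 1) (1, 0)] at this
    linarith
  -- the derivative of `φ` in `u` depends on `t` only
  have hα : ∀ q ∈ Metric.ball q₀ r, fderiv ℝ Φ q (0, 1) = fderiv ℝ Φ (q.1, q₀.2) (0, 1) := by
    intro q hq
    refine eq_of_fderiv_snd_eq_zero (G := fun q => fderiv ℝ Φ q (0, 1))
      (fun q hq => (hd2' _ (hsm q hq).2).differentiableAt) (fun q hq => ?_) hq
    rw [(hd2' _ (hsm q hq).2).fderiv]
    exact hΦuu q hq
  have hbt : ∀ s ∈ Metric.ball q₀.1 r, ((s, q₀.2) : ℝ × ℝ) ∈ Metric.ball q₀ r := by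
    intro s hs
    rw [← ball_prod_same]
    exact ⟨hs, Metric.mem_ball_self hr⟩
  have hcurve : ∀ s : ℝ, HasDerivAt (fun s : ℝ => ((s, q₀.2) : ℝ × ℝ)) (1, 0) s := fun s =>
    (hasDerivAt_id s).prodMk (hasDerivAt_const s _)
  set τ : ℝ → ℝ := fun s => T (s, q₀.2) with hτ
  set α : ℝ → ℝ := fun s => fderiv ℝ Φ (s, q₀.2) (0, 1) with hαdef
  have hτd : ∀ s ∈ Metric.ball q₀.1 r, deriv τ s = fderiv ℝ T (s, q₀.2) (1, 0) := fun s hs =>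
    HasDerivAt.deriv (f := τ) (HasFDerivAt.comp_hasDerivAt (l := T) s
      ((hsm _ (hbt s hs)).1.differentiableAt (by simp)).hasFDerivAt (hcurve s))
  have hconst : ∀ s ∈ Metric.ball q₀.1 r, HasDerivAt
      (fun s => α s - fderiv ℝ T (s, q₀.2) (1, 0) / 2) 0 s := by
    intro s hs
    have h1 := (hd2' (0, 1) (hsm _ (hbt s hs)).2).comp_hasDerivAt s (hcurve s)
    have h2 := (hd2' (1, 0) (hsm _ (hbt s hs)).1).comp_hasDerivAt s (hcurve s)
    have h3 := h1.sub (h2.div_const 2)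
    refine h3.congr_deriv ?_
    simp [hΦtu _ (hbt s hs)]
  set a := α q₀.1 - fderiv ℝ T q₀ (1, 0) / 2 with ha
  have hαeq : ∀ s ∈ Metric.ball q₀.1 r, α s = deriv τ s / 2 + a := by
    intro s hs
    have := Metric.isOpen_ball.is_const_of_deriv_eq_zero (convex_ball q₀.1 r).isPreconnected
      (fun s hs => (hconst s hs).differentiableAt.differentiableWithinAt)
      (fun s hs => (hconst s hs).deriv) hs (Metric.mem_ball_self hr)
    rw [hτd s hs, ha]
    linarith
  have hq₀m : q₀ ∈ Metric.ball q₀ r := Metric.mem_ball_self hr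
  have hin : ContDiffAt ℝ ∞ (fun s : ℝ => ((s, q₀.2) : ℝ × ℝ)) p.1 := by fun_prop
  refine ⟨τ, a, fun s => Φ (s, q₀.2) - α s * q₀.2, ?_, ?_, ?_⟩
  · exact ContDiffAt.comp p.1 (hsm q₀ hq₀m).1 hin
  · refine (ContDiffAt.comp p.1 (hsm q₀ hq₀m).2 hin).sub (ContDiffAt.mul ?_ contDiffAt_const)
    have : ContDiffAt ℝ ∞ (fun q => fderiv ℝ Φ q (0, 1)) q₀ :=
      ((hsm q₀ hq₀m).2.fderiv_right (m := ∞) (by simp)).clm_apply contDiffAt_const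
    exact ContDiffAt.comp p.1 this hin
  · filter_upwards [Metric.ball_mem_nhds q₀ hr] with q hq
    have hq1 : q.1 ∈ Metric.ball q₀.1 r := by
      rw [← ball_prod_same] at hq; exact hq.1
    refine ⟨?_, ?_⟩
    · exact eq_of_fderiv_snd_eq_zero (G := T)
        (fun q hq => (hsm q hq).1.differentiableAt (by simp)) hTu hq
    · have hder : ∀ s ∈ Metric.ball q₀.2 r, HasDerivAt (fun s => Φ (q.1, s) - α q.1 * s) 0 s := by
        intro s hs
        have hmem : (q.1, s) ∈ Metric.ball q₀ r := by
          rw [← ball_prod_same]; exact ⟨hq1, hs⟩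
        have h1 := ((hsm _ hmem).2.differentiableAt (by simp)).hasFDerivAt.comp_hasDerivAt s
          ((hasDerivAt_const s q.1).prodMk (hasDerivAt_id s))
        have h2 := h1.sub ((hasDerivAt_id s).const_mul (α q.1))
        refine h2.congr_deriv ?_
        rw [hα _ hmem]
        simp [hαdef]
      have hq2 : q.2 ∈ Metric.ball q₀.2 r := by
        rw [← ball_prod_same] at hq; exact hq.2
      have := Metric.isOpen_ball.is_const_of_deriv_eq_zero (convex_ball q₀.2 r).isPreconnected
        (fun s hs => (hder s hs).differentiableAt.differentiableWithinAt)
        (fun s hs => (hder s hs).deriv) hq2 (Metric.mem_ball_self hr)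
      rw [← hαeq _ hq1]
      change Φ q = _
      have e : Φ q = Φ (q.1, q.2) := rfl
      rw [e]
      linear_combination this

end

/-! ### Families of smooth functions on the line -/

/-- Uniqueness for linear differential equations with a nonvanishing leading coefficient near every
point. -/
theorem smoothFn.eq_zero_of_local_ode {ι : Type*} [Fintype ι] (h : ι → smoothFn)
    (hode : ∀ t : ℝ, ∃ p : smoothFn, p.1 t ≠ 0 ∧ ∃ (c : ι → ι → ℝ) (k : ℝ),
      ∀ i, p * dt (h i) = ∑ j, c i j • h j + k • (dt p * h i))
    {t₀ : ℝ} (h0 : ∀ i, (h i).1 t₀ = 0) : ∀ i, h i = 0 := by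
  classical
  -- The common zero set is closed by continuity and open by local uniqueness, so on the connected
  -- line it is everything. The coefficient `p` may therefore change from point to point.
  set S : Set ℝ := {t | ∀ i, (h i).1 t = 0} with hS
  have hclosed : IsClosed S := by
    have : S = ⋂ i, {t | (h i).1 t = 0} := by ext; simp [hS]
    rw [this]
    exact isClosed_iInter fun i => isClosed_eq (smoothFn.continuous (h i)) continuous_const
  have hopen : IsOpen S := by
    rw [isOpen_iff_mem_nhds]
    intro t ht
    obtain ⟨p, hp, c, k, hc⟩ := hode t
    let C : (ι → ℝ) →L[ℝ] (ι → ℝ) := LinearMap.toContinuousLinearMap (Matrix.toLin' (Matrix.of c))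
    -- The system solved for the derivative, `h' = p⁻¹ (C + k p') h`, valid where `p ≠ 0`.
    let A : ℝ → (ι → ℝ) →L[ℝ] (ι → ℝ) := fun s =>
      (p.1 s)⁻¹ • (C + (k * (dt p).1 s) • ContinuousLinearMap.id ℝ (ι → ℝ))
    have hpc : ContinuousAt p.1 t := (smoothFn.continuous p).continuousAt
    have hp'c : ContinuousAt (dt p).1 t := (smoothFn.continuous (dt p)).continuousAt
    have hA : ContinuousAt A t :=
      (hpc.inv₀ hp).smul (continuousAt_const.add
        ((continuousAt_const.mul hp'c).smul continuousAt_const))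
    have hev := hA.norm.eventually_lt_const (lt_add_one ‖A t‖)
    have key : (fun s i => (h i).1 s) =ᶠ[nhds t] (fun _ => (0 : ι → ℝ)) := by
      refine ODE_solution_unique_of_eventually (v := fun s y => A s y) (s := fun _ => Set.univ)
        (K := ‖A t‖₊ + 1) ?_ ?_ ?_ ?_
      · filter_upwards [hev] with s hs
        exact ((A s).lipschitz.weaken (NNReal.coe_le_coe.1 (by
          push_cast
          exact hs.le))).lipschitzOnWith
      · filter_upwards [hpc.eventually_ne hp] with s hs
        refine ⟨?_, Set.mem_univ _⟩
        rw [hasDerivAt_pi]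
        intro i
        refine (smoothFn.hasDerivAt (h i) s).congr_deriv ?_
        have e := congrArg (fun f : smoothFn => f.1 s) (hc i)
        have e2 : (∑ j, c i j • h j).1 s = ∑ j, c i j * (h j).1 s := by
          rw [show (∑ j, c i j • h j).1 = ∑ j, (c i j • h j).1 from
            map_sum smoothFn.val _ _, Finset.sum_apply]
          rfl
        simp only [smoothFn.mul_apply, smoothFn.add_apply, smoothFn.smul_apply, e2] at e
        simp only [A, C, _root_.smul_apply, _root_.add_apply, LinearMap.coe_toContinuousLinearMap',
          ContinuousLinearMap.id_apply, Pi.smul_apply, Pi.add_apply, Matrix.toLin'_apply,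
          Matrix.mulVec, dotProduct, Matrix.of_apply, smul_eq_mul]
        rw [eq_inv_mul_iff_mul_eq₀ hs, e]
        ring
      · refine Filter.Eventually.of_forall fun s => ⟨?_, Set.mem_univ _⟩
        rw [map_zero]
        exact hasDerivAt_const _ _
      · ext i
        exact ht i
    filter_upwards [key] with s hs i using congrFun hs i
  have huniv : S = Set.univ := IsClopen.eq_univ ⟨hclosed, hopen⟩ ⟨t₀, h0⟩
  intro i
  ext t
  have : t ∈ S := huniv ▸ Set.mem_univ t
  exact this i

/-- A finite family of smooth vector fields on the line that spans a perfect Lie algebra has no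
common zero unless all its members vanish. -/
theorem smoothFn.eq_zero_of_perfect {ι : Type*} [Fintype ι] (g : ι → smoothFn)
    (c : ι → ι → ι → ℝ)
    (hc : ∀ i, g i = ∑ j, ∑ k, c i j k • (g j * dt (g k) - g k * dt (g j)))
    {t₀ : ℝ} (h0 : ∀ i, (g i).1 t₀ = 0) : ∀ i, g i = 0 := by
  classical
  set S : Set ℝ := {t | ∀ i, (g i).1 t = 0} with hS
  have hclosed : IsClosed S := by
    have : S = ⋂ i, {t | (g i).1 t = 0} := by ext; simp [hS]
    rw [this]
    exact isClosed_iInter fun i => isClosed_eq (smoothFn.continuous (g i)) continuous_const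
  have hsum : ∀ (u : ι → ι → smoothFn) (s : ℝ),
      (∑ j, ∑ k, u j k).1 s = ∑ j, ∑ k, (u j k).1 s := by
    intro u s
    rw [show (∑ j, ∑ k, u j k).1 = ∑ j, ∑ k, (u j k).1 by
      change smoothFn.val _ = _
      simp only [map_sum]
      rfl]
    simp [Finset.sum_apply]
  have hopen : IsOpen S := by
    rw [isOpen_iff_mem_nhds]
    intro t ht
    -- The derivative of `g_j g_k' - g_k g_j'` is `g_j g_k'' - g_k g_j''`, in which every term has a
    -- factor that vanishes at a common zero.
    have hd : ∀ i, (dt (g i)).1 t = 0 := by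
      intro i
      rw [hc i]
      simp only [map_sum, Derivation.map_smul, map_sub, Derivation.leibniz]
      rw [hsum]
      refine Finset.sum_eq_zero fun j _ => Finset.sum_eq_zero fun k _ => ?_
      simp [ht j, ht k]
      right
      ring
    -- The relations bound the norm of `g(s)` by `B(s)` times itself. Since `B` is continuous and
    -- `B(t) = 0`, the factor is below one near `t` and `g` vanishes there.
    let B : ℝ → ℝ := fun s =>
      ∑ i, ∑ j, ∑ k, |c i j k| * (|(dt (g k)).1 s| + |(dt (g j)).1 s|)
    have hBc : Continuous B := by
      refine continuous_finsetSum _ fun i _ => continuous_finsetSum _ fun j _ =>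
        continuous_finsetSum _ fun k _ => ?_
      exact continuous_const.mul ((smoothFn.continuous (dt (g k))).abs.add (smoothFn.continuous (dt (g j))).abs)
    have hBt : B t = 0 := by simp [B, hd]
    have hev : ∀ᶠ s in nhds t, B s < 1 :=
      hBc.continuousAt.eventually_lt_const (by rw [hBt]; exact one_pos)
    filter_upwards [hev] with s hs
    set H : ι → ℝ := fun i => (g i).1 s with hH
    have hle : ‖H‖ ≤ B s * ‖H‖ := by
      have hB0 : 0 ≤ B s := by
        refine Finset.sum_nonneg fun i _ => Finset.sum_nonneg fun j _ =>
          Finset.sum_nonneg fun k _ => by positivity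
      rw [pi_norm_le_iff_of_nonneg (by positivity)]
      intro i
      have e := congrArg (fun f : smoothFn => f.1 s) (hc i)
      simp only [hsum, smoothFn.smul_apply, smoothFn.sub_apply, smoothFn.mul_apply] at e
      have e1 : ‖H i‖ ≤ ∑ j, ∑ k, |c i j k| * (|(dt (g k)).1 s| + |(dt (g j)).1 s|) * ‖H‖ := by
        rw [show H i = _ from e]
        refine (norm_sum_le _ _).trans (Finset.sum_le_sum fun j _ => ?_)
        refine (norm_sum_le _ _).trans (Finset.sum_le_sum fun k _ => ?_)
        rw [norm_mul, Real.norm_eq_abs, mul_assoc]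
        gcongr
        refine (norm_sub_le _ _).trans ?_
        rw [norm_mul, norm_mul, add_mul]
        have hj := norm_le_pi_norm H j
        have hk := norm_le_pi_norm H k
        simp only [← Real.norm_eq_abs]
        have n1 := norm_nonneg ((dt (g k)).1 s)
        have n2 := norm_nonneg ((dt (g j)).1 s)
        simp only [hH] at hj hk ⊢
        nlinarith
      refine e1.trans ?_
      simp only [← Finset.sum_mul]
      gcongr
      exact Finset.single_le_sum (f := fun i => ∑ j, ∑ k, |c i j k| *
        (|(dt (g k)).1 s| + |(dt (g j)).1 s|)) (fun i _ => Finset.sum_nonneg fun j _ =>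
          Finset.sum_nonneg fun k _ => by positivity) (Finset.mem_univ i)
    have hz : ‖H‖ = 0 := by
      by_contra hne
      have : 0 < ‖H‖ := lt_of_le_of_ne (norm_nonneg _) (Ne.symm hne)
      nlinarith
    intro i
    exact congrFun (norm_eq_zero.1 hz) i
  have huniv : S = Set.univ := IsClopen.eq_univ ⟨hclosed, hopen⟩ ⟨t₀, h0⟩
  intro i
  ext t
  have : t ∈ S := huniv ▸ Set.mem_univ t
  exact this i

/-! ### Lie algebras with a derivation-like functional -/

section Abstract

variable {M : Type*} [LieRing M] [LieAlgebra ℝ M]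

/-- The derived algebra is spanned by `⁅f, g⁆` alone, hence is abelian. -/
theorem isSolvable_of_forall_mem_span_pair {f g : M}
    (h : ∀ x : M, ∃ a b : ℝ, x = a • f + b • g) : LieAlgebra.IsSolvable M := by
  have h1 : ∀ x ∈ LieAlgebra.derivedSeries ℝ M 1, ∃ c : ℝ, x = c • ⁅f, g⁆ := by
    intro x hx
    rw [LieAlgebra.derivedSeries_def, LieAlgebra.derivedSeriesOfIdeal_succ,
      LieAlgebra.derivedSeriesOfIdeal_zero, ← LieSubmodule.mem_toSubmodule,
      LieSubmodule.lieIdeal_oper_eq_linear_span'] at hx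
    refine Submodule.span_induction ?_ ⟨0, by simp⟩ ?_ ?_ hx
    · rintro _ ⟨y, -, z, -, rfl⟩
      obtain ⟨a, b, rfl⟩ := h y
      obtain ⟨a', b', rfl⟩ := h z
      refine ⟨a * b' - b * a', ?_⟩
      simp only [add_lie, lie_add, smul_lie, lie_smul, lie_self, ← lie_skew f g]
      module
    · rintro _ _ - - ⟨c, rfl⟩ ⟨d, rfl⟩
      exact ⟨c + d, by module⟩
    · rintro r _ - ⟨c, rfl⟩
      exact ⟨r * c, by module⟩
  refine LieAlgebra.IsSolvable.mk (R := ℝ) (k := 2) ?_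
  rw [LieAlgebra.derivedSeries_def, LieAlgebra.derivedSeriesOfIdeal_succ, LieSubmodule.lie_eq_bot_iff]
  intro x hx y hy
  obtain ⟨c, rfl⟩ := h1 x hx
  obtain ⟨d, rfl⟩ := h1 y hy
  simp

/-- The relations of the standard basis of `sl(2, ℝ)`. -/
structure IsSplitTriple (e₁ e₂ e₃ : M) : Prop where
  h12 : ⁅e₁, e₂⁆ = e₁
  h13 : ⁅e₁, e₃⁆ = (2 : ℝ) • e₂
  h23 : ⁅e₂, e₃⁆ = e₃

variable (f : M) (l : M →ₗ[ℝ] ℝ)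

/-- The Taylor coefficients of an element along `f`. -/
def taylorCoeff (n : ℕ) : M →ₗ[ℝ] ℝ := l ∘ₗ (LieAlgebra.ad ℝ M f ^ n)

/-- The elements that vanish to order `k`. -/
def orderGE (k : ℕ) : Submodule ℝ M := ⨅ n ∈ Set.Iio k, LinearMap.ker (taylorCoeff f l n)

variable {f l}

theorem mem_orderGE {k : ℕ} {x : M} : x ∈ orderGE f l k ↔ ∀ n < k, taylorCoeff f l n x = 0 := by
  simp [orderGE]

theorem taylorCoeff_zero (x : M) : taylorCoeff f l 0 x = l x := by simp [taylorCoeff]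

theorem taylorCoeff_lie (n : ℕ) (x : M) :
    taylorCoeff f l n ⁅f, x⁆ = taylorCoeff f l (n + 1) x := by
  simp [taylorCoeff, pow_succ]

/-- This is the Leibniz rule for powers of `ad f`. The hypothesis `hl` is what evaluation of time
components at a point satisfies when `f` has value `1` there: the bracket of vector fields on the
line is `g h' - h g'`. -/
theorem taylorCoeff_lie_lie (hl : ∀ g h, l ⁅g, h⁆ = l g * l ⁅f, h⁆ - l h * l ⁅f, g⁆) (n : ℕ)
    (g h : M) : taylorCoeff f l n ⁅g, h⁆ = ∑ i ∈ Finset.range (n + 1), (n.choose i : ℝ) *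
      (taylorCoeff f l i g * taylorCoeff f l (n - i + 1) h
        - taylorCoeff f l (n - i) h * taylorCoeff f l (i + 1) g) := by
  have e : ∀ (m : ℕ) (x : M), (LieAlgebra.ad ℝ M f ^ m) x = (LieDerivation.ad ℝ M f)^[m] x := by
    intro m x
    have e0 : ⇑(LieDerivation.ad ℝ M f) = ⇑(LieAlgebra.ad ℝ M f) := by
      ext y
      simp
    rw [Module.End.pow_apply, e0]
  simp only [taylorCoeff, LinearMap.comp_apply]
  rw [e, LieDerivation.iterate_apply_lie', map_sum]
  refine Finset.sum_congr rfl fun i _ => ?_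
  rw [map_nsmul, hl, nsmul_eq_mul, e, e, e, e, Function.iterate_succ_apply',
    Function.iterate_succ_apply', LieDerivation.ad_apply_apply, LieDerivation.ad_apply_apply]

/-- Lie's argument for vector fields on the line. Vanishing order along `f` filters `M` with
quotients of dimension at most one. Nonsolvability requires a nonzero element of order at least two;
a top order above two is impossible because bracketing would create elements of still higher order.
-/
theorem exists_isSplitTriple [FiniteDimensional ℝ M] (hns : ¬ LieAlgebra.IsSolvable M)
    (hf : l f = 1) (hl : ∀ g h, l ⁅g, h⁆ = l g * l ⁅f, h⁆ - l h * l ⁅f, g⁆)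
    (hnd : ∀ g, (∀ n, taylorCoeff f l n g = 0) → g = 0) :
    ∃ e₁ e₂ e₃ : M, IsSplitTriple e₁ e₂ e₃ ∧ l e₁ = 1 ∧
      ∀ x, x ∈ Submodule.span ℝ {e₁, e₂, e₃} := by
  have hanti : Antitone (orderGE f l) := fun i j hij x hx =>
    mem_orderGE.2 fun n hn => mem_orderGE.1 hx n (hn.trans_le hij)
  -- The decreasing filtration stabilises in finite dimension, and elements of the stable term
  -- vanish to every order.
  have hex : ∃ d, orderGE f l d = ⊥ := by
    obtain ⟨d, hd⟩ := IsArtinian.monotone_stabilizes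
      (⟨fun k => OrderDual.toDual (orderGE f l k), fun i j hij => hanti hij⟩ :
        ℕ →o (Submodule ℝ M)ᵒᵈ)
    refine ⟨d, (Submodule.eq_bot_iff _).2 fun x hx => hnd x fun n => ?_⟩
    have h1 : orderGE f l d = orderGE f l (d + n + 1) := hd (d + n + 1) (by omega)
    rw [h1] at hx
    exact mem_orderGE.1 hx n (by omega)
  classical
  have hmin := Nat.find_spec hex
  set d₀ := Nat.find hex with hd₀
  -- If two Taylor coefficients determined an element, `M` would be spanned by `f` and one element
  -- of order one, hence solvable.
  have hd₀3 : 3 ≤ d₀ := by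
    by_contra hlt
    have h2 : orderGE f l 2 = ⊥ := by
      rw [eq_bot_iff, ← hmin]
      exact hanti (by omega)
    apply hns
    have hf0 : taylorCoeff f l 0 f = 1 := by rw [taylorCoeff_zero, hf]
    by_cases hg : ∃ g ∈ orderGE f l 1, taylorCoeff f l 1 g ≠ 0
    · obtain ⟨g, hg, hg1⟩ := hg
      have hg0 := mem_orderGE.1 hg 0 one_pos
      refine isSolvable_of_forall_mem_span_pair (f := f) (g := g) fun x =>
        ⟨taylorCoeff f l 0 x, (taylorCoeff f l 1 x - taylorCoeff f l 0 x * taylorCoeff f l 1 f)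
          / taylorCoeff f l 1 g, ?_⟩
      rw [← sub_eq_zero, ← Submodule.mem_bot ℝ, ← h2, mem_orderGE]
      intro n hn
      interval_cases n
      · simp [hf0, hg0]
      · simp
        field_simp
        ring
    · push Not at hg
      refine isSolvable_of_forall_mem_span_pair (f := f) (g := 0) fun x =>
        ⟨taylorCoeff f l 0 x, 0, ?_⟩
      rw [← sub_eq_zero, ← Submodule.mem_bot ℝ, ← h2, mem_orderGE]
      have h0 : taylorCoeff f l 0 (x - ((taylorCoeff f l 0) x • f + (0 : ℝ) • (0 : M))) = 0 := by
        simp [hf0]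
      intro n hn
      interval_cases n
      · exact h0
      · refine hg _ (mem_orderGE.2 fun n hn => ?_)
        interval_cases n
        exact h0
  obtain ⟨k, hk⟩ : ∃ k, d₀ = k + 1 := ⟨d₀ - 1, by omega⟩
  have hk2 : 2 ≤ k := by omega
  have hbot : orderGE f l (k + 1) = ⊥ := hk ▸ hmin
  have hne : orderGE f l k ≠ ⊥ := Nat.find_min hex (show k < Nat.find _ by omega)
  obtain ⟨g', hg', hg'0⟩ := Submodule.exists_mem_ne_zero_of_ne_bot hne
  have hg'k : taylorCoeff f l k g' ≠ 0 := by
    intro h0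
    apply hg'0
    rw [← Submodule.mem_bot ℝ, ← hbot, mem_orderGE]
    intro n hn
    rcases Nat.lt_succ_iff_lt_or_eq.1 hn with hn | rfl
    · exact mem_orderGE.1 hg' n hn
    · exact h0
  obtain ⟨g, hg, hgk⟩ : ∃ g, (∀ n < k, taylorCoeff f l n g = 0) ∧ taylorCoeff f l k g = 1 :=
    ⟨(taylorCoeff f l k g')⁻¹ • g', fun n hn => by simp [mem_orderGE.1 hg' n hn],
      by simp [hg'k]⟩
  have hext : ∀ x y, (∀ n < k + 1, taylorCoeff f l n x = taylorCoeff f l n y) → x = y := by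
    intro x y h
    rw [← sub_eq_zero, ← Submodule.mem_bot ℝ, ← hbot, mem_orderGE]
    intro n hn
    rw [map_sub, h n hn, sub_self]
  have hh : ∀ n, n + 1 < k → taylorCoeff f l n ⁅f, g⁆ = 0 := fun n hn => by
    rw [taylorCoeff_lie]; exact hg _ hn
  have hhk : taylorCoeff f l (k - 1) ⁅f, g⁆ = 1 := by
    rw [taylorCoeff_lie, Nat.sub_add_cancel (by omega)]; exact hgk
  -- the top order is two
  have hk' : k = 2 := by
    by_contra hk3
    have hk3 : 3 ≤ k := by omega
    -- The orders of `g` and `⁅f, g⁆` are `k` and `k - 1`, so their bracket has order at least `2k -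
    -- 2`, which exceeds the top order `k` when `k ≥ 3`.
    have hz : ⁅g, ⁅f, g⁆⁆ = 0 := by
      refine hext _ _ fun n hn => ?_
      rw [taylorCoeff_lie_lie hl, map_zero]
      refine Finset.sum_eq_zero fun i hi => ?_
      rw [Finset.mem_range] at hi
      have e1 : taylorCoeff f l i g * taylorCoeff f l (n - i + 1) ⁅f, g⁆ = 0 := by
        rcases Nat.lt_or_ge i k with h | h
        · rw [hg i h, zero_mul]
        · rw [hh _ (by omega), mul_zero]
      have e2 : taylorCoeff f l (n - i) ⁅f, g⁆ * taylorCoeff f l (i + 1) g = 0 := by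
        rcases Nat.lt_or_ge (i + 1) k with h | h
        · rw [hg _ h, mul_zero]
        · rw [hh _ (by omega), zero_mul]
      rw [e1, e2]; simp
    obtain ⟨m, rfl⟩ : ∃ m, k = m + 1 := ⟨k - 1, by omega⟩
    -- At order `2m = 2k - 2` just one term survives in each sum. The coefficient is the difference
    -- of the binomials `2m` over `m + 1` and `2m` over `m`, which is not zero.
    have h1 := taylorCoeff_lie_lie (f := f) (l := l) hl (2 * m) g ⁅f, g⁆
    rw [hz, map_zero] at h1
    simp only [mul_sub, Finset.sum_sub_distrib] at h1
    rw [Finset.sum_eq_single (m + 1), Finset.sum_eq_single m] at h1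
    · simp only [Nat.add_sub_cancel] at hhk
      rw [hgk, show 2 * m - (m + 1) + 1 = m by omega, show 2 * m - m = m by omega, hhk] at h1
      have h2 : ((2 * m).choose (m + 1) : ℝ) = ((2 * m).choose m : ℝ) := by linarith
      have h3 : (2 * m).choose (m + 1) = (2 * m).choose m := by exact_mod_cast h2
      have h4 := Nat.choose_succ_right_eq (2 * m) m
      rw [h3, show 2 * m - m = m by omega] at h4
      have h5 : 0 < (2 * m).choose m := Nat.choose_pos (by omega)
      have h6 := Nat.eq_of_mul_eq_mul_left h5 h4
      omega
    · intro i hi hne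
      rw [Finset.mem_range] at hi
      rcases Nat.lt_or_ge (i + 1) (m + 1) with h | h
      · rw [hg _ h]; simp
      · rw [hh _ (by omega)]; simp
    · intro h; simp at h; omega
    · intro i hi hne
      rw [Finset.mem_range] at hi
      rcases Nat.lt_or_ge i (m + 1) with h | h
      · rw [hg _ h]; simp
      · rw [hh _ (by omega)]; simp
    · intro h; simp at h; omega
  subst hk'
  have hf0 : taylorCoeff f l 0 f = 1 := by rw [taylorCoeff_zero, hf]
  have hg0 := hg 0 (by omega)
  have hg1 := hg 1 (by omega)
  set h := ⁅f, g⁆ with hh_def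
  have hh0 : taylorCoeff f l 0 h = 0 := hh 0 (by omega)
  have hh1 : taylorCoeff f l 1 h = 1 := hhk
  have hhg : ⁅h, g⁆ = g := by
    refine hext _ _ fun n hn => ?_
    rw [taylorCoeff_lie_lie hl]
    interval_cases n
    · simp [hg0, hg1]
    · simp [Finset.sum_range_succ, hg0, hg1, hh0]
    · simp [Finset.sum_range_succ, hg0, hg1, hh0, hh1, hgk]
      norm_num
  have hspan : ∀ x : M, ∃ b c : ℝ, x = taylorCoeff f l 0 x • f + b • h + c • g := by
    intro x
    set b := taylorCoeff f l 1 x - taylorCoeff f l 0 x * taylorCoeff f l 1 f with hb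
    refine ⟨b, taylorCoeff f l 2 x - taylorCoeff f l 0 x * taylorCoeff f l 2 f
      - b * taylorCoeff f l 2 h, hext _ _ fun n hn => ?_⟩
    interval_cases n
    · simp [hf0, hg0, hh0]
    · simp [hg1, hh1, hb]
    · simp [hgk]
  obtain ⟨β, γ, hfh⟩ := hspan ⁅f, h⁆
  have hfh0 : taylorCoeff f l 0 ⁅f, h⁆ = 1 := by rw [taylorCoeff_lie, hh1]
  rw [hfh0, one_smul] at hfh
  -- The Jacobi identity for `f`, `h`, `g` reads `h = h + β g`.
  have hβ : β = 0 := by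
    have hj := leibniz_lie f h g
    rw [hhg, hfh, ← hh_def, lie_self] at hj
    simp only [add_lie, smul_lie, hhg, lie_self, ← hh_def] at hj
    have : β • g = 0 := by
      have : h = h + β • g := by simpa using hj
      simpa using this
    have := congrArg (taylorCoeff f l 2) this
    simpa [hgk] using this
  rw [hβ, zero_smul, add_zero] at hfh
  have hgh : ⁅g, h⁆ = -g := by rw [← lie_skew, hhg]
  -- From `⁅f, h⁆ = f + γ g` and `⁅g, h⁆ = -g`, adding `(γ / 2) g` to `f` gives an eigenvector. The
  -- factor `2` matches the normalisation `⁅e₁, e₃⁆ = 2 e₂`.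
  refine ⟨f + (γ / 2) • g, h, (2 : ℝ) • g, ⟨?_, ?_, ?_⟩, ?_, ?_⟩
  · rw [add_lie, smul_lie, hfh, hgh]
    module
  · rw [add_lie, smul_lie, lie_smul, lie_smul, lie_self, ← hh_def]
    module
  · rw [lie_smul, hhg]
  · rw [map_add, map_smul, hf, ← taylorCoeff_zero (f := f) g, hg0]
    simp
  · intro x
    obtain ⟨b, c, hx⟩ := hspan x
    rw [hx, Submodule.mem_span_triple]
    refine ⟨taylorCoeff f l 0 x, b, (c - taylorCoeff f l 0 x * (γ / 2)) / 2, ?_⟩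
    module

end Abstract

/-! ### The time components of a nonsolvable algebra -/

/-- The relations of the standard basis of `sl(2, ℝ)`, for vector fields on the line. -/
structure IsSl2 (x₁ x₂ x₃ : smoothFn) : Prop where
  h12 : x₁ * dt x₂ - x₂ * dt x₁ = x₁
  h13 : x₁ * dt x₃ - x₃ * dt x₁ = (2 : ℝ) • x₂
  h23 : x₂ * dt x₃ - x₃ * dt x₂ = x₃

namespace IsSl2

variable {x₁ x₂ x₃ : smoothFn}

theorem neg (h : IsSl2 x₁ x₂ x₃) : IsSl2 (-x₁) x₂ (-x₃) where
  h12 := by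
    rw [map_neg]
    linear_combination -h.h12
  h13 := by
    rw [← h.h13, map_neg, map_neg]
    ring
  h23 := by
    rw [map_neg]
    linear_combination -h.h23

/-- The derivatives can be eliminated from the three relations. With `θ = x₂ / x₁` this identifies
the triple with `x₁`, `x₁ θ`, `x₁ θ²`, that is, with `∂_t`, `t ∂_t`, `t² ∂_t` in the time `θ`. -/
theorem mul_eq_sq (h : IsSl2 x₁ x₂ x₃) : x₁ * x₃ = x₂ ^ 2 := by
  have h13 := h.h13
  have e : (2 : ℝ) • x₂ = 2 * x₂ := by
    rw [Algebra.smul_def]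
    congr 1
  rw [e] at h13
  have : (2 : smoothFn) * (x₁ * x₃) = 2 * x₂ ^ 2 := by
    linear_combination (-x₃) * h.h12 + x₂ * h13 - x₁ * h.h23
  ext t
  have := congrArg (fun f : smoothFn => f.1 t) this
  have h2 : (2 : smoothFn).1 t = 2 := rfl
  simp only [smoothFn.mul_apply, h2] at this
  simp only [smoothFn.mul_apply]
  linarith

end IsSl2

namespace SymField

/-- The projection of a field to its time component. -/
def tauHom : SymField →ₗ⁅ℝ⁆ SymField where
  toFun X := mk X.tau 0 0
  map_add' X Y := by ext1 <;> simp
  map_smul' c X := by ext1 <;> simp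
  map_lie' {X Y} := by ext1 <;> simp

@[simp] theorem tauHom_apply (X : SymField) : tauHom X = mk X.tau 0 0 := rfl

/-- The time component of a field, as a linear map. -/
def tauL : SymField →ₗ[ℝ] smoothFn where
  toFun X := X.tau
  map_add' _ _ := rfl
  map_smul' _ _ := rfl

@[simp] theorem tauL_apply (X : SymField) : tauL X = X.tau := rfl

/-- The coefficient `λ_x` of a field, as a linear map. -/
def lamL (x : Site) : SymField →ₗ[ℝ] smoothFn where
  toFun X := X.lam x
  map_add' _ _ := rfl
  map_smul' _ _ := rfl

@[simp] theorem lamL_apply (x : Site) (X : SymField) : lamL x X = X.lam x := rfl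

/-- The coefficients `a` of a field, as a linear map. -/
def aL : SymField →ₗ[ℝ] (Site → ℝ) where
  toFun X := X.a
  map_add' _ _ := rfl
  map_smul' _ _ := rfl

@[simp] theorem aL_apply (X : SymField) : aL X = X.a := rfl

end SymField

/-- Evaluation of a smooth function at a point. -/
def evalAt (t : ℝ) : smoothFn →ₗ[ℝ] ℝ where
  toFun f := f.1 t
  map_add' _ _ := rfl
  map_smul' _ _ := rfl

@[simp] theorem evalAt_apply (t : ℝ) (f : smoothFn) : evalAt t f = f.1 t := rfl

/-- Brackets of fields without `τ` have neither `τ` nor `a`; they are translations, and translations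
commute. -/
theorem derivedSeries_eq_bot_of_tau_eq_zero {L : LieSubalgebra ℝ SymField} {I : LieIdeal ℝ L}
    (h : ∀ X ∈ I, (X : SymField).tau = 0) : ⁅⁅I, I⁆, ⁅I, I⁆⁆ = ⊥ := by
  have h1 : ∀ X ∈ ⁅I, I⁆, (X : SymField).tau = 0 ∧ ∀ x, (X : SymField).a x = 0 := by
    intro X hX
    rw [← LieSubmodule.mem_toSubmodule, LieSubmodule.lieIdeal_oper_eq_linear_span'] at hX
    refine Submodule.span_induction ?_ (by simp) ?_ ?_ hX
    · rintro _ ⟨Y, hY, Z, hZ, rfl⟩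
      simp [h Y hY, h Z hZ]
    · rintro Y Z - - ⟨hY, hY'⟩ ⟨hZ, hZ'⟩
      simp [hY, hY', hZ, hZ']
    · rintro c Y - ⟨hY, hY'⟩
      simp [hY, hY']
  rw [LieSubmodule.lie_eq_bot_iff]
  intro X hX Y hY
  obtain ⟨hX1, hX2⟩ := h1 X hX
  obtain ⟨hY1, hY2⟩ := h1 Y hY
  apply Subtype.ext
  ext1
  · simp [hX1, hY1]
  · simp
  · ext t
    simp [hX1, hX2, hY1, hY2]

/-- The derived series stabilises in finite dimension, and its stable term is perfect; it is nonzero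
since the algebra is not solvable. -/
theorem exists_stable_derivedSeries {M : Type*} [LieRing M] [LieAlgebra ℝ M]
    [FiniteDimensional ℝ M] (hns : ¬ LieAlgebra.IsSolvable M) :
    ∃ P : LieIdeal ℝ M, P ≠ ⊥ ∧ ⁅P, P⁆ = P := by
  obtain ⟨k, hk⟩ := IsArtinian.monotone_stabilizes
    (⟨fun k => OrderDual.toDual (LieAlgebra.derivedSeries ℝ M k).toSubmodule, fun i j hij =>
      LieAlgebra.derivedSeriesOfIdeal_antitone ⊤ hij⟩ : ℕ →o (Submodule ℝ M)ᵒᵈ)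
  refine ⟨LieAlgebra.derivedSeries ℝ M k, fun h => hns (LieAlgebra.IsSolvable.mk h), ?_⟩
  have h1 : (LieAlgebra.derivedSeries ℝ M k).toSubmodule
    = (LieAlgebra.derivedSeries ℝ M (k + 1)).toSubmodule := hk (k + 1) (by omega)
  have h2 := LieSubmodule.toSubmodule_injective h1
  conv_rhs => rw [h2]
  rw [LieAlgebra.derivedSeries_def, LieAlgebra.derivedSeries_def,
    LieAlgebra.derivedSeriesOfIdeal_succ]

theorem linearMap_eq_sum_repr {ι V W : Type*} [Fintype ι] [AddCommGroup V] [Module ℝ V]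
    [AddCommGroup W] [Module ℝ W] (b : Module.Basis ι ℝ V) (φ : V →ₗ[ℝ] W) (v : V) :
    φ v = ∑ i, b.repr v i • φ (b i) := by
  conv_lhs => rw [← b.sum_repr v, map_sum]
  simp only [map_smul]

/-! ### Lie algebras of fields determined by their time components -/

section

variable {M : LieSubalgebra ℝ SymField} [FiniteDimensional ℝ M]

/-- If all time components vanished at `t₀`, so would those of the perfect ideal in the derived
series, and `smoothFn.eq_zero_of_perfect` would make that ideal zero. -/
theorem exists_tau_ne_zero (hinj : ∀ X ∈ M, X.tau = 0 → X = 0)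
    (hns : ¬ LieAlgebra.IsSolvable M) (t₀ : ℝ) : ∃ X ∈ M, X.tau.1 t₀ ≠ 0 := by
  by_contra! hall
  obtain ⟨P, hP0, hP⟩ := exists_stable_derivedSeries hns
  let b := Module.finBasis ℝ P
  let g : Fin (Module.finrank ℝ P) → smoothFn := fun i => ((b i : M) : SymField).tau
  have hrepr : ∀ X : M, X ∈ P → ∃ c : Fin (Module.finrank ℝ P) → ℝ,
      (X : SymField).tau = ∑ i, c i • g i := by
    intro X hX
    let φ : P →ₗ[ℝ] smoothFn :=
      { toFun := fun Y => ((Y : M) : SymField).tau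
        map_add' := fun _ _ => rfl
        map_smul' := fun _ _ => rfl }
    exact ⟨b.repr ⟨X, hX⟩, linearMap_eq_sum_repr b φ ⟨X, hX⟩⟩
  have hbr : ∀ X : M, X ∈ P → ∃ c : Fin (Module.finrank ℝ P) → Fin (Module.finrank ℝ P) → ℝ,
      (X : SymField).tau = ∑ j, ∑ k, c j k • (g j * dt (g k) - g k * dt (g j)) := by
    intro X hX
    rw [← hP, ← LieSubmodule.mem_toSubmodule, LieSubmodule.lieIdeal_oper_eq_linear_span'] at hX
    refine Submodule.span_induction ?_ ⟨0, by simp⟩ ?_ ?_ hX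
    · rintro _ ⟨Y, hY, Z, hZ, rfl⟩
      obtain ⟨c, hc⟩ := hrepr Y hY
      obtain ⟨d, hd⟩ := hrepr Z hZ
      refine ⟨fun j k => c j * d k, ?_⟩
      rw [LieSubalgebra.coe_bracket, SymField.tau_lie, hc, hd, map_sum, map_sum]
      simp only [Derivation.map_smul, Finset.sum_mul_sum, smul_sub, Finset.sum_sub_distrib,
        smul_mul_smul_comm]
      congr 1
      rw [Finset.sum_comm]
      simp only [mul_comm (d _) (c _)]
    · rintro Y Z - - ⟨c, hc⟩ ⟨d, hd⟩
      refine ⟨c + d, ?_⟩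
      simp [hc, hd, add_smul, Finset.sum_add_distrib]
    · rintro r Y - ⟨c, hc⟩
      refine ⟨r • c, ?_⟩
      simp [hc, Finset.smul_sum, mul_smul]
  choose c hc using fun i => hbr (b i : M) (b i).2
  have hz := smoothFn.eq_zero_of_perfect g c hc (t₀ := t₀) fun i =>
    hall _ (b i : M).2
  apply hP0
  rw [LieSubmodule.eq_bot_iff]
  intro X hX
  obtain ⟨d, hd⟩ := hrepr X hX
  apply Subtype.ext
  refine hinj _ X.2 ?_
  rw [hd]
  simp [hz]

/-- `exists_isSplitTriple` applies with `l` the evaluation of `τ` at `t₀`, normalised by a field `f`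
that does not vanish there. -/
theorem exists_isSl2_of_injective (hinj : ∀ X ∈ M, X.tau = 0 → X = 0)
    (hns : ¬ LieAlgebra.IsSolvable M) (t₀ : ℝ) :
    ∃ e₁ e₂ e₃ : M, IsSplitTriple e₁ e₂ e₃ ∧ (e₁ : SymField).tau.1 t₀ ≠ 0 ∧
      ∀ x : M, x ∈ Submodule.span ℝ {e₁, e₂, e₃} := by
  obtain ⟨f, hfM, hf⟩ := exists_tau_ne_zero hinj hns t₀
  let f' : M := ⟨f, hfM⟩
  let l : M →ₗ[ℝ] ℝ := (f.tau.1 t₀)⁻¹ • (evalAt t₀ ∘ₗ SymField.tauL ∘ₗ M.toSubmodule.subtype)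
  have hlapp : ∀ X : M, l X = (f.tau.1 t₀)⁻¹ * (X : SymField).tau.1 t₀ := fun X => rfl
  have hl : ∀ g h, l ⁅g, h⁆ = l g * l ⁅f', h⁆ - l h * l ⁅f', g⁆ := by
    intro g h
    simp only [hlapp, LieSubalgebra.coe_bracket, SymField.tau_lie, smoothFn.sub_apply,
      smoothFn.mul_apply, f']
    field_simp
    ring
  -- The elements flat at `t₀`. Smooth functions need not be analytic, so flatness alone does not
  -- give zero. But `N` is an ideal, and a field `p` nonvanishing at a given time yields the linear
  -- system `p h' = ⁅p, h⁆ + p' h` for its members, with zero initial values at `t₀`.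
  let N : Submodule ℝ M := ⨅ n, LinearMap.ker (taylorCoeff f' l n)
  have hN : ∀ {X}, X ∈ N ↔ ∀ n, taylorCoeff f' l n X = 0 := by simp [N]
  have hNideal : ∀ (X Y : M), Y ∈ N → ⁅X, Y⁆ ∈ N := by
    intro X Y hY
    rw [hN] at hY ⊢
    intro n
    rw [taylorCoeff_lie_lie hl]
    exact Finset.sum_eq_zero fun i _ => by simp [hY]
  have hNbot : ∀ X ∈ N, X = 0 := by
    let b := Module.finBasis ℝ N
    let h : Fin (Module.finrank ℝ N) → smoothFn := fun i => ((b i : M) : SymField).tau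
    have hrepr : ∀ X : M, X ∈ N → ∃ c : Fin (Module.finrank ℝ N) → ℝ,
        (X : SymField).tau = ∑ i, c i • h i := by
      intro X hX
      let φ : N →ₗ[ℝ] smoothFn :=
        { toFun := fun Y => ((Y : M) : SymField).tau
          map_add' := fun _ _ => rfl
          map_smul' := fun _ _ => rfl }
      exact ⟨b.repr ⟨X, hX⟩, linearMap_eq_sum_repr b φ ⟨X, hX⟩⟩
    have hz := smoothFn.eq_zero_of_local_ode h (t₀ := t₀) (fun t => by
      obtain ⟨p, hpM, hp⟩ := exists_tau_ne_zero hinj hns t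
      choose c hc using fun i => hrepr ⁅⟨p, hpM⟩, (b i : M)⁆ (hNideal _ _ (b i).2)
      refine ⟨p.tau, hp, c, 1, fun i => ?_⟩
      rw [← hc i, LieSubalgebra.coe_bracket, SymField.tau_lie]
      simp only [h, one_smul]
      ring) (fun i => by
        have := (hN.1 (b i).2) 0
        rw [taylorCoeff_zero, hlapp] at this
        exact (mul_eq_zero.1 this).resolve_left (inv_ne_zero hf))
    intro X hX
    obtain ⟨c, hc⟩ := hrepr X hX
    apply Subtype.ext
    refine hinj _ X.2 ?_
    rw [hc]
    simp [hz]
  obtain ⟨e₁, e₂, e₃, he, hl1, hspan⟩ := exists_isSplitTriple hns (f := f') (l := l)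
    (by rw [hlapp]; exact inv_mul_cancel₀ hf) hl (fun g hg => hNbot g (hN.2 hg))
  refine ⟨e₁, e₂, e₃, he, fun h0 => ?_, hspan⟩
  rw [hlapp, h0] at hl1
  simp at hl1

end

/-- The result for injective `τ` is applied to the image of `L`. The sign of `x₁` is adjusted by
replacing `x₁`, `x₃` with their negatives. -/
theorem exists_isSl2 (L : LieSubalgebra ℝ SymField) [FiniteDimensional ℝ L]
    (hns : ¬ LieAlgebra.IsSolvable L) (t₀ : ℝ) :
    ∃ x₁ x₂ x₃ : smoothFn, IsSl2 x₁ x₂ x₃ ∧ 0 < x₁.1 t₀ ∧ (∃ X ∈ L, X.tau = x₁) ∧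
      (∃ X ∈ L, X.tau = x₂) ∧ (∃ X ∈ L, X.tau = x₃) ∧
      ∀ X ∈ L, X.tau ∈ Submodule.span ℝ {x₁, x₂, x₃} := by
  let φ : L →ₗ⁅ℝ⁆ SymField := SymField.tauHom.comp L.incl
  let M : LieSubalgebra ℝ SymField := φ.range
  have hMfin : FiniteDimensional ℝ M := by
    have : M.toSubmodule = LinearMap.range (φ : L →ₗ[ℝ] SymField) := rfl
    change FiniteDimensional ℝ M.toSubmodule
    rw [this]
    infer_instance
  have hmem : ∀ Y ∈ M, ∃ X ∈ L, Y = SymField.mk X.tau 0 0 := by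
    intro Y hY
    obtain ⟨X, rfl⟩ := (LieHom.mem_range φ Y).1 hY
    exact ⟨X, X.2, rfl⟩
  have hinj : ∀ Y ∈ M, Y.tau = 0 → Y = 0 := by
    intro Y hY h0
    obtain ⟨X, -, rfl⟩ := hmem Y hY
    rw [SymField.tau_mk] at h0
    rw [h0, SymField.mk_zero]
  -- If the image were solvable, some term of the derived series of `L` would have `τ = 0`, and two
  -- further steps would annihilate it.
  have hMns : ¬ LieAlgebra.IsSolvable M := by
    intro hM
    obtain ⟨k, hk⟩ := LieAlgebra.IsSolvable.solvable ℝ M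
    have hle := LieIdeal.derivedSeries_map_le (R := ℝ) (f := φ.rangeRestrict) k
    have h0 : ∀ X ∈ LieAlgebra.derivedSeries ℝ L k, (X : SymField).tau = 0 := by
      intro X hX
      have h1 := hle (LieIdeal.mem_map hX)
      change φ.rangeRestrict X ∈ LieAlgebra.derivedSeries ℝ M k at h1
      rw [hk, LieSubmodule.mem_bot] at h1
      have h2 : SymField.tau ((φ.rangeRestrict X : M) : SymField) = 0 := by rw [h1]; rfl
      exact h2
    refine hns (LieAlgebra.IsSolvable.mk (R := ℝ) (k := k + 2) ?_)
    have := derivedSeries_eq_bot_of_tau_eq_zero h0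
    rw [LieAlgebra.derivedSeries_def] at this ⊢
    rwa [LieAlgebra.derivedSeriesOfIdeal_succ, LieAlgebra.derivedSeriesOfIdeal_succ]
  obtain ⟨e₁, e₂, e₃, he, hne, hspan⟩ := exists_isSl2_of_injective hinj hMns t₀
  have hrel : ∀ {e f g : M}, ⁅e, f⁆ = g → (e : SymField).tau * dt (f : SymField).tau
      - (f : SymField).tau * dt (e : SymField).tau = (g : SymField).tau := by
    rintro e f g rfl
    rfl
  have hs : IsSl2 (e₁ : SymField).tau (e₂ : SymField).tau (e₃ : SymField).tau :=
    ⟨hrel he.h12, hrel he.h13, hrel he.h23⟩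
  have hex : ∀ e : M, ∃ X ∈ L, X.tau = (e : SymField).tau := by
    intro e
    obtain ⟨X, hX, h⟩ := hmem e e.2
    exact ⟨X, hX, by rw [h]; rfl⟩
  have hsp : ∀ X ∈ L, X.tau ∈ Submodule.span ℝ
      {(e₁ : SymField).tau, (e₂ : SymField).tau, (e₃ : SymField).tau} := by
    intro X hX
    obtain ⟨a, b, c, h⟩ := Submodule.mem_span_triple.1 (hspan (φ.rangeRestrict ⟨X, hX⟩))
    refine Submodule.mem_span_triple.2 ⟨a, b, c, ?_⟩
    exact congrArg (fun Y : M => (Y : SymField).tau) h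
  rcases lt_or_gt_of_ne hne with h | h
  · refine ⟨_, _, _, hs.neg, by simpa using h, ?_, hex e₂, ?_, ?_⟩
    · obtain ⟨X, hX, h⟩ := hex e₁
      exact ⟨-X, L.neg_mem hX, by simp [h]⟩
    · obtain ⟨X, hX, h⟩ := hex e₃
      exact ⟨-X, L.neg_mem hX, by simp [h]⟩
    · intro X hX
      obtain ⟨a, b, c, h⟩ := Submodule.mem_span_triple.1 (hsp X hX)
      refine Submodule.mem_span_triple.2 ⟨-a, b, -c, ?_⟩
      rw [← h]
      module
  · exact ⟨_, _, _, hs, h, hex e₁, hex e₂, hex e₃, hsp⟩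

/-- The radical of an algebra of fields whose time components form `sl(2, ℝ)`. -/
theorem mem_radical_iff (L : LieSubalgebra ℝ SymField) [FiniteDimensional ℝ L]
    {x₁ x₂ x₃ : smoothFn} (hs : IsSl2 x₁ x₂ x₃) (h1 : x₁ ≠ 0)
    (hX1 : ∃ X ∈ L, X.tau = x₁) (hX2 : ∃ X ∈ L, X.tau = x₂) (hX3 : ∃ X ∈ L, X.tau = x₃)
    (hsp : ∀ X ∈ L, X.tau ∈ Submodule.span ℝ {x₁, x₂, x₃}) (X : L) :
    X ∈ LieAlgebra.radical ℝ L ↔ (X : SymField).tau = 0 := by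
  obtain ⟨X₁, hX₁, rfl⟩ := hX1
  obtain ⟨X₂, hX₂, rfl⟩ := hX2
  obtain ⟨X₃, hX₃, rfl⟩ := hX3
  -- This is the simplicity of `sl(2, ℝ)`. Brackets with `X₁` lower `α x₁ + β x₂ + γ x₃` to `β x₁ +
  -- 2γ x₂` and then to `2γ x₁`, so a multiple of `x₁` is reached; brackets with `X₃` climb back to
  -- `x₂` and `x₃`.
  have hgen : ∀ I : LieIdeal ℝ L, (∃ Y ∈ I, (Y : SymField).tau ≠ 0) →
      (∃ Y ∈ I, (Y : SymField).tau = X₁.tau) ∧ (∃ Y ∈ I, (Y : SymField).tau = X₂.tau) ∧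
        (∃ Y ∈ I, (Y : SymField).tau = X₃.tau) := by
    have step : ∀ I : LieIdeal ℝ L, (∃ Y ∈ I, (Y : SymField).tau = X₁.tau) →
        (∃ Y ∈ I, (Y : SymField).tau = X₁.tau) ∧ (∃ Y ∈ I, (Y : SymField).tau = X₂.tau) ∧
        (∃ Y ∈ I, (Y : SymField).tau = X₃.tau) := by
      rintro I ⟨Y, hY, hY1⟩
      have h2 : ∃ Y ∈ I, (Y : SymField).tau = X₂.tau := by
        refine ⟨(-(1 / 2) : ℝ) • ⁅(⟨X₃, hX₃⟩ : L), Y⁆, I.smul_mem _ (lie_mem_right ℝ L I _ _ hY), ?_⟩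
        change (-(1 / 2) : ℝ) • (X₃.tau * dt (Y : SymField).tau - (Y : SymField).tau * dt X₃.tau) = _
        rw [hY1]
        have : X₂.tau = (1 / 2 : ℝ) • ((2 : ℝ) • X₂.tau) := by module
        rw [this, ← hs.h13]
        module
      obtain ⟨Z, hZ, hZ2⟩ := h2
      refine ⟨⟨Y, hY, hY1⟩, ⟨Z, hZ, hZ2⟩, ⟨-⁅(⟨X₃, hX₃⟩ : L), Z⁆,
        I.neg_mem (lie_mem_right ℝ L I _ _ hZ), ?_⟩⟩
      change -(X₃.tau * dt (Z : SymField).tau - (Z : SymField).tau * dt X₃.tau) = _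
      rw [hZ2, neg_sub, hs.h23]
    rintro I ⟨Y, hY, hY0⟩
    apply step
    obtain ⟨α, β, γ, h⟩ := Submodule.mem_span_triple.1 (hsp Y Y.2)
    let Z : L := ⁅(⟨X₁, hX₁⟩ : L), Y⁆
    have hZ : Z ∈ I := lie_mem_right ℝ L I _ _ hY
    have hZt : (Z : SymField).tau = β • X₁.tau + (2 * γ) • X₂.tau := by
      change X₁.tau * dt (Y : SymField).tau - (Y : SymField).tau * dt X₁.tau = _
      rw [← h]
      have e1 := hs.h12
      have e2 := hs.h13
      simp only [map_add, Derivation.map_smul]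
      simp only [Algebra.smul_def, map_mul (algebraMap ℝ smoothFn)] at e2 ⊢
      linear_combination (algebraMap ℝ smoothFn β) * e1 + (algebraMap ℝ smoothFn γ) * e2
    let W : L := ⁅(⟨X₁, hX₁⟩ : L), Z⁆
    have hW : W ∈ I := lie_mem_right ℝ L I _ _ hZ
    have hWt : (W : SymField).tau = (2 * γ) • X₁.tau := by
      change X₁.tau * dt (Z : SymField).tau - (Z : SymField).tau * dt X₁.tau = _
      rw [hZt]
      have e1 := hs.h12
      simp only [map_add, Derivation.map_smul]
      simp only [Algebra.smul_def]
      linear_combination (algebraMap ℝ smoothFn (2 * γ)) * e1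
    by_cases hγ : γ = 0
    · by_cases hβ : β = 0
      · have hα : α ≠ 0 := by
          rintro rfl
          apply hY0
          rw [← h, hγ, hβ]
          simp
        refine ⟨α⁻¹ • Y, I.smul_mem _ hY, ?_⟩
        change α⁻¹ • (Y : SymField).tau = _
        rw [← h, hγ, hβ]
        simp [smul_smul, hα]
      · refine ⟨β⁻¹ • Z, I.smul_mem _ hZ, ?_⟩
        change β⁻¹ • (Z : SymField).tau = _
        rw [hZt, hγ]
        simp [smul_smul, hβ]
    · refine ⟨(2 * γ)⁻¹ • W, I.smul_mem _ hW, ?_⟩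
      change (2 * γ)⁻¹ • (W : SymField).tau = _
      rw [hWt, smul_smul,
        inv_mul_cancel₀ (by simpa using hγ), one_smul]
  constructor
  · intro hX
    by_contra hne
    set R := LieAlgebra.radical ℝ L
    -- An ideal with a nonzero time component contains lifts of `x₁` and `x₂`, whose bracket again
    -- lies over `x₁`. So no derived term of the radical could vanish.
    have hall : ∀ k, ∃ Y ∈ LieAlgebra.derivedSeriesOfIdeal ℝ L k R, (Y : SymField).tau ≠ 0 := by
      intro k
      induction k with
      | zero => exact ⟨X, hX, hne⟩
      | succ k ih =>
        obtain ⟨⟨Y, hY, hY1⟩, ⟨Z, hZ, hZ1⟩, -⟩ := hgen _ ih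
        refine ⟨⁅Y, Z⁆, ?_, ?_⟩
        · rw [LieAlgebra.derivedSeriesOfIdeal_succ]
          exact LieSubmodule.lie_mem_lie hY hZ
        · rw [LieSubalgebra.coe_bracket, SymField.tau_lie, hY1, hZ1, hs.h12]
          exact h1
    obtain ⟨k, hk⟩ := LieAlgebra.IsSolvable.solvable ℝ R
    rw [LieIdeal.derivedSeries_eq_bot_iff] at hk
    obtain ⟨Y, hY, hY0⟩ := hall k
    rw [hk, LieSubmodule.mem_bot] at hY
    apply hY0
    rw [hY]
    rfl
  · intro hX
    let K : LieIdeal ℝ L :=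
      { (LinearMap.ker (SymField.tauL ∘ₗ L.toSubmodule.subtype)) with
        lie_mem := by
          intro Y Z hZ
          have hZ' : (Z : SymField).tau = 0 := hZ
          change (⁅Y, Z⁆ : L).1.tau = 0
          obtain ⟨α, β, γ, h⟩ := Submodule.mem_span_triple.1 (hsp Y Y.2)
          rw [LieSubalgebra.coe_bracket, SymField.tau_lie, hZ']
          simp }
    have hK : ∀ Y ∈ K, (Y : SymField).tau = 0 := fun Y hY => hY
    have hsol : LieAlgebra.IsSolvable K := LieAlgebra.IsSolvable.mk (R := ℝ) (k := 2) (by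
      rw [LieIdeal.derivedSeries_eq_bot_iff]
      exact derivedSeries_eq_bot_of_tau_eq_zero hK)
    exact (LieAlgebra.LieIdeal.solvable_iff_le_radical (R := ℝ) (L := L) K).1 hsol hX

/-! ### The structure of a five-dimensional nonsolvable algebra near a time -/

/-- Bracketing a relation with `x₁` lowers it twice: first to `g₁ x₁ + 2 g₂ x₂ = 0`, then to `2 g₂
x₁ = 0`. -/
theorem IsSl2.linearIndependent {x₁ x₂ x₃ : smoothFn} (h : IsSl2 x₁ x₂ x₃) (h1 : x₁ ≠ 0) :
    LinearIndependent ℝ ![x₁, x₂, x₃] := by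
  rw [Fintype.linearIndependent_iff]
  intro g hg
  simp only [Fin.sum_univ_three, Matrix.cons_val_zero, Matrix.cons_val_one, Matrix.cons_val] at hg
  have hd := congrArg dt hg
  simp only [map_add, Derivation.map_smul, map_zero] at hd
  have e12 := h.h12
  have e13 := h.h13
  simp only [Algebra.smul_def] at hg hd e13
  have s1 : g 1 • x₁ + (2 * g 2) • x₂ = 0 := by
    simp only [Algebra.smul_def, map_mul (algebraMap ℝ smoothFn)]
    linear_combination x₁ * hd - dt x₁ * hg - algebraMap ℝ smoothFn (g 1) * e12
      - algebraMap ℝ smoothFn (g 2) * e13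
  have hd' := congrArg dt s1
  simp only [map_add, Derivation.map_smul, map_zero] at hd'
  have s2 : (2 * g 2) • x₁ = 0 := by
    have s1' := s1
    simp only [Algebra.smul_def, map_mul (algebraMap ℝ smoothFn)] at hd' s1' ⊢
    linear_combination x₁ * hd' - dt x₁ * s1'
      - algebraMap ℝ smoothFn 2 * algebraMap ℝ smoothFn (g 2) * e12
  have hg2 : g 2 = 0 := by
    have := (smul_eq_zero.1 s2).resolve_right h1
    linarith
  have hg1 : g 1 = 0 := by
    rw [hg2] at s1
    simpa [h1] using s1
  have hg0 : g 0 = 0 := by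
    rw [hg1, hg2] at hg
    simp only [map_zero, zero_mul, add_zero] at hg
    rw [← Algebra.smul_def] at hg
    exact (smul_eq_zero.1 hg).resolve_right h1
  intro i
  fin_cases i <;> assumption

/-! ### The kernel of the time projection and the lifting of `sl(2, ℝ)` -/

section

variable {L : LieSubalgebra ℝ SymField}

theorem finiteDimensional_of_finrank_eq_five (hdim : Module.finrank ℝ L = 5) :
    FiniteDimensional ℝ L := Module.finite_of_finrank_pos (by omega)

theorem finrank_tau_ker (hdim : Module.finrank ℝ L = 5) {x₁ x₂ x₃ : smoothFn}
    (hs : IsSl2 x₁ x₂ x₃) (h1 : x₁ ≠ 0) (hX1 : ∃ X ∈ L, X.tau = x₁) (hX2 : ∃ X ∈ L, X.tau = x₂)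
    (hX3 : ∃ X ∈ L, X.tau = x₃) (hsp : ∀ X ∈ L, X.tau ∈ Submodule.span ℝ {x₁, x₂, x₃}) :
    Module.finrank ℝ (LinearMap.ker (SymField.tauL ∘ₗ L.toSubmodule.subtype)) = 2 := by
  have hfin : FiniteDimensional ℝ L.toSubmodule := finiteDimensional_of_finrank_eq_five hdim
  have hrange : LinearMap.range (SymField.tauL ∘ₗ L.toSubmodule.subtype)
      = Submodule.span ℝ (Set.range ![x₁, x₂, x₃]) := by
    have hset : Set.range ![x₁, x₂, x₃] = {x₁, x₂, x₃} := by
      ext y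
      simp [eq_comm]
      tauto
    rw [hset]
    apply le_antisymm
    · rintro _ ⟨X, rfl⟩
      exact hsp X X.2
    · rw [Submodule.span_le]
      rintro y (rfl | rfl | rfl)
      · obtain ⟨X, hX, h⟩ := hX1
        exact ⟨⟨X, hX⟩, h⟩
      · obtain ⟨X, hX, h⟩ := hX2
        exact ⟨⟨X, hX⟩, h⟩
      · obtain ⟨X, hX, h⟩ := hX3
        exact ⟨⟨X, hX⟩, h⟩
  have h := LinearMap.finrank_range_add_finrank_ker (SymField.tauL ∘ₗ L.toSubmodule.subtype)
  rw [hrange, finrank_span_eq_card (hs.linearIndependent h1)] at h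
  have h5 : Module.finrank ℝ L.toSubmodule = 5 := hdim
  simp only [Fintype.card_fin] at h
  omega

/-- Brackets have `a = 0`, so lifts without multipliers are found among the brackets of arbitrary
lifts. -/
theorem exists_lift (hs : IsSl2 x₁ x₂ x₃) (hX1 : ∃ X ∈ L, X.tau = x₁) (hX2 : ∃ X ∈ L, X.tau = x₂)
    (hX3 : ∃ X ∈ L, X.tau = x₃) : ∃ X₁ ∈ L, ∃ X₂ ∈ L, ∃ X₃ ∈ L,
      (X₁.tau = x₁ ∧ ∀ x, X₁.a x = 0) ∧ (X₂.tau = x₂ ∧ ∀ x, X₂.a x = 0) ∧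
      (X₃.tau = x₃ ∧ ∀ x, X₃.a x = 0) := by
  obtain ⟨Y₁, hY₁, rfl⟩ := hX1
  obtain ⟨Y₂, hY₂, rfl⟩ := hX2
  obtain ⟨Y₃, hY₃, rfl⟩ := hX3
  refine ⟨⁅Y₁, Y₂⁆, L.lie_mem hY₁ hY₂, (1 / 2 : ℝ) • ⁅Y₁, Y₃⁆, L.smul_mem _ (L.lie_mem hY₁ hY₃),
    ⁅Y₂, Y₃⁆, L.lie_mem hY₂ hY₃, ⟨hs.h12, fun x => rfl⟩, ⟨?_, fun x => ?_⟩, ⟨hs.h23, fun x => rfl⟩⟩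
  · rw [SymField.tau_smul, SymField.tau_lie, hs.h13]
    module
  · simp

variable (L) in
/-- The translations in `L`, that is, the fields of the form `λ_{nm}(t) ∂_{u_{nm}}`. -/
def translationFields : Submodule ℝ SymField :=
  L.toSubmodule ⊓ LinearMap.ker SymField.tauL ⊓ LinearMap.ker SymField.aL

theorem mem_translationFields {X : SymField} :
    X ∈ translationFields L ↔ X ∈ L ∧ X.tau = 0 ∧ ∀ x, X.a x = 0 := by
  simp [translationFields, and_assoc, funext_iff]

theorem lie_eq_zero_of_translation {X Y : SymField} (hX : X.tau = 0 ∧ ∀ x, X.a x = 0)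
    (hY : Y.tau = 0 ∧ ∀ x, Y.a x = 0) : ⁅X, Y⁆ = 0 := by
  ext1
  · simp [hX.1, hY.1]
  · simp
  · ext t
    simp [hX.1, hY.1, hX.2, hY.2]

theorem lie_mem_translationFields {X Y : SymField} (hX : X ∈ L) (hY : Y ∈ translationFields L) :
    ⁅X, Y⁆ ∈ translationFields L := by
  rw [mem_translationFields] at hY ⊢
  exact ⟨L.lie_mem hX hY.1, by simp [hY.2.1], fun x => rfl⟩

theorem sub_mem_translationFields {X Y : SymField} (hX : X ∈ L) (hY : Y ∈ L)
    (ht : X.tau = Y.tau) (ha : ∀ x, X.a x = Y.a x) : X - Y ∈ translationFields L :=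
  mem_translationFields.2 ⟨L.sub_mem hX hY, by simp [ht], by simp [ha]⟩

/-- Translations transform as densities of weight `-1/2` in time. This formula is the source of the
exponents `±1/2` below. -/
theorem lam_lie_of_translation {X Y : SymField} (hX : ∀ x, X.a x = 0)
    (hY : Y.tau = 0 ∧ ∀ x, Y.a x = 0) (x : Site) :
    ⁅X, Y⁆.lam x = X.tau * dt (Y.lam x) - (1 / 2 : ℝ) • (dt X.tau * Y.lam x) := by
  ext t
  simp [hX, hY.1, hY.2]
  ring

/-- A translation that vanishes near a time vanishes. -/
theorem eq_zero_of_eventuallyEq_zero [FiniteDimensional ℝ L] (hns : ¬ LieAlgebra.IsSolvable L)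
    {t₀ : ℝ} {v : SymField} (hv : v ∈ translationFields L)
    (h0 : ∀ x, (v.lam x).1 =ᶠ[nhds t₀] 0) : v = 0 := by
  -- This space is stable under brackets with `L`. At a fixed node the coefficients of its basis
  -- therefore solve a linear system whose leading coefficient, the `τ` of a suitable lift, is
  -- nonzero at any prescribed time.
  let N : Submodule ℝ SymField :=
    { carrier := {v | v ∈ translationFields L ∧ ∀ x, (v.lam x).1 =ᶠ[nhds t₀] 0}
      add_mem' := by
        rintro u v ⟨hu, hu0⟩ ⟨hv, hv0⟩
        refine ⟨add_mem hu hv, fun x => ?_⟩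
        filter_upwards [hu0 x, hv0 x] with t h1 h2
        simp_all
      zero_mem' := ⟨zero_mem _, fun x => Filter.Eventually.of_forall fun t => rfl⟩
      smul_mem' := by
        rintro c u ⟨hu, hu0⟩
        refine ⟨Submodule.smul_mem _ c hu, fun x => ?_⟩
        filter_upwards [hu0 x] with t h1
        simp_all }
  have hNL : N ≤ L.toSubmodule := fun u hu => (mem_translationFields.1 hu.1).1
  have hfinL : FiniteDimensional ℝ L.toSubmodule := ‹FiniteDimensional ℝ L›
  have hfin : FiniteDimensional ℝ N := Submodule.finiteDimensional_of_le hNL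
  let b := Module.finBasis ℝ N
  have hz : ∀ x i, ((b i : SymField)).lam x = 0 := by
    intro x
    have hrepr : ∀ u ∈ N, ∃ c : Fin (Module.finrank ℝ N) → ℝ,
        u.lam x = ∑ i, c i • (b i : SymField).lam x := fun u hu =>
      ⟨b.repr ⟨u, hu⟩, linearMap_eq_sum_repr b (SymField.lamL x ∘ₗ N.subtype) ⟨u, hu⟩⟩
    refine smoothFn.eq_zero_of_local_ode (fun i => ((b i : SymField)).lam x) (t₀ := t₀)
      (fun t => ?_) (fun i => ((b i).2.2 x).self_of_nhds)
    obtain ⟨x₁, x₂, x₃, hs, hpos, hX1, hX2, hX3, -⟩ := exists_isSl2 L hns t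
    obtain ⟨X, hX, -, -, -, -, ⟨rfl, hXa⟩, -⟩ := exists_lift hs hX1 hX2 hX3
    have hXN : ∀ u ∈ N, ⁅X, u⁆ ∈ N := by
      rintro u ⟨hu, hu0⟩
      refine ⟨lie_mem_translationFields hX hu, fun y => ?_⟩
      rw [lam_lie_of_translation hXa (mem_translationFields.1 hu).2]
      filter_upwards [hu0 y, smoothFn.eventuallyEq_zero_dt (hu0 y)] with t h1 h2
      simp_all
    choose c hc using fun i => hrepr _ (hXN _ (b i).2)
    refine ⟨X.tau, hpos.ne', c, 1 / 2, fun i => ?_⟩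
    rw [← hc i, lam_lie_of_translation hXa (mem_translationFields.1 (b i).2.1).2]
    simp
  have hvN : v ∈ N := ⟨hv, h0⟩
  have hv' := mem_translationFields.1 hv
  refine SymField.ext' hv'.2.1 hv'.2.2 fun x => ?_
  have := linearMap_eq_sum_repr b (SymField.lamL x ∘ₗ N.subtype) ⟨v, hvN⟩
  simpa [hz] using this

/-- Lifts of the standard basis of `sl(2, ℝ)` to fields of `L` with vanishing `a`. -/
structure IsFrame (L : LieSubalgebra ℝ SymField) (x₁ x₂ x₃ : smoothFn) (X₁ X₂ X₃ : SymField) :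
    Prop where
  isSl2 : IsSl2 x₁ x₂ x₃
  mem₁ : X₁ ∈ L
  mem₂ : X₂ ∈ L
  mem₃ : X₃ ∈ L
  tau₁ : X₁.tau = x₁
  tau₂ : X₂.tau = x₂
  tau₃ : X₃.tau = x₃
  a₁ : ∀ x, X₁.a x = 0
  a₂ : ∀ x, X₂.a x = 0
  a₃ : ∀ x, X₃.a x = 0
  h12 : ⁅X₁, X₂⁆ = X₁
  h13 : ⁅X₁, X₃⁆ = (2 : ℝ) • X₂
  h23 : ⁅X₂, X₃⁆ = X₃
  span : ∀ X ∈ L, X.tau ∈ Submodule.span ℝ {x₁, x₂, x₃}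

/-- Without translations a field of `L` is determined by `τ` and `a`, so the relations of the time
components hold for the lifts themselves. -/
theorem exists_frame_of_no_translations (hdim : Module.finrank ℝ L = 5)
    (hns : ¬ LieAlgebra.IsSolvable L) (hK : translationFields L = ⊥) (t₀ : ℝ) :
    ∃ (x₁ x₂ x₃ : smoothFn) (X₁ X₂ X₃ : SymField), IsFrame L x₁ x₂ x₃ X₁ X₂ X₃ ∧ 0 < x₁.1 t₀ := by
  have := finiteDimensional_of_finrank_eq_five hdim
  obtain ⟨x₁, x₂, x₃, hs, hpos, hX1, hX2, hX3, hsp⟩ := exists_isSl2 L hns t₀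
  obtain ⟨X₁, hX₁, X₂, hX₂, X₃, hX₃, ⟨t1, a1⟩, ⟨t2, a2⟩, ⟨t3, a3⟩⟩ := exists_lift hs hX1 hX2 hX3
  have heq : ∀ X Y : SymField, X ∈ L → Y ∈ L → X.tau = Y.tau → (∀ x, X.a x = Y.a x) → X = Y := by
    intro X Y hX hY ht ha
    have := sub_mem_translationFields hX hY ht ha
    rwa [hK, Submodule.mem_bot, sub_eq_zero] at this
  refine ⟨x₁, x₂, x₃, X₁, X₂, X₃, ⟨hs, hX₁, hX₂, hX₃, t1, t2, t3, a1, a2, a3, ?_, ?_, ?_, hsp⟩, hpos⟩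
  · exact heq _ _ (L.lie_mem hX₁ hX₂) hX₁ (by simp [t1, t2, hs.h12]) (by simp [a1])
  · exact heq _ _ (L.lie_mem hX₁ hX₃) (L.smul_mem _ hX₂) (by simp [t1, t3, t2, hs.h13])
      (by simp [a2])
  · exact heq _ _ (L.lie_mem hX₂ hX₃) hX₃ (by simp [t2, t3, hs.h23]) (by simp [a3])

/-- A bracket with a field without `τ` is a translation. Hence the kernel of the time projection is
central. -/
theorem lie_eq_zero_of_no_translations (hK : translationFields L = ⊥) {X Y : SymField}
    (hX : X ∈ L) (hY : Y ∈ L) (h : Y.tau = 0) : ⁅X, Y⁆ = 0 := by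
  have : ⁅X, Y⁆ ∈ translationFields L :=
    mem_translationFields.2 ⟨L.lie_mem hX hY, by simp [h], fun x => rfl⟩
  rwa [hK, Submodule.mem_bot] at this

/-- Two independent elements span the kernel of the projection to the time components. -/
theorem exists_scalings (hdim : Module.finrank ℝ L = 5) (hns : ¬ LieAlgebra.IsSolvable L)
    (hK : translationFields L = ⊥) : ∃ k₁ ∈ L, ∃ k₂ ∈ L, k₁.tau = 0 ∧ k₂.tau = 0 ∧
      (∀ α β : ℝ, (∀ x, α * k₁.a x + β * k₂.a x = 0) → α = 0 ∧ β = 0) ∧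
      ∀ X ∈ L, X.tau = 0 → ∃ α β : ℝ, X = α • k₁ + β • k₂ := by
  have := finiteDimensional_of_finrank_eq_five hdim
  obtain ⟨x₁, x₂, x₃, hs, hpos, hX1, hX2, hX3, hsp⟩ := exists_isSl2 L hns 0
  have h1 : x₁ ≠ 0 := by
    rintro rfl
    simp at hpos
  have hfr := finrank_tau_ker hdim hs h1 hX1 hX2 hX3 hsp
  set K := LinearMap.ker (SymField.tauL ∘ₗ L.toSubmodule.subtype) with hKdef
  have hfinL : FiniteDimensional ℝ L.toSubmodule := finiteDimensional_of_finrank_eq_five hdim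
  let b := Module.finBasisOfFinrankEq ℝ K hfr
  have hb : ∀ i, ((b i : L.toSubmodule) : SymField).tau = 0 := fun i => (b i).2
  have hlin : ∀ α β : ℝ, α • ((b 0 : L.toSubmodule) : SymField)
      + β • ((b 1 : L.toSubmodule) : SymField) = 0 → α = 0 ∧ β = 0 := by
    intro α β h
    have h' : α • b 0 + β • b 1 = 0 := Subtype.ext (Subtype.ext h)
    have := Fintype.linearIndependent_iff.1 b.linearIndependent ![α, β]
      (by simpa [Fin.sum_univ_two] using h')
    exact ⟨this 0, this 1⟩
  refine ⟨_, (b 0 : L.toSubmodule).2, _, (b 1 : L.toSubmodule).2, hb 0, hb 1, fun α β h => ?_,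
    fun X hX ht => ?_⟩
  · apply hlin
    rw [← Submodule.mem_bot ℝ, ← hK, mem_translationFields]
    exact ⟨L.add_mem (L.smul_mem _ (b 0 : L.toSubmodule).2) (L.smul_mem _ (b 1 : L.toSubmodule).2),
      by simp [hb], fun x => h x⟩
  · let X' : K := ⟨⟨X, hX⟩, ht⟩
    have := linearMap_eq_sum_repr b (L.toSubmodule.subtype ∘ₗ K.subtype) X'
    rw [Fin.sum_univ_two] at this
    exact ⟨_, _, this⟩

/-- An injective `A` is invertible, and the relation becomes `B - A⁻¹ B A = 1`. The left side has
trace zero, so the dimension is zero. -/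
theorem eq_zero_of_finrank_smul {V : Type*} [AddCommGroup V] [Module ℝ V] [FiniteDimensional ℝ V]
    (A B : V →ₗ[ℝ] V) (h : A ∘ₗ B - B ∘ₗ A = A) (hA : Function.Injective A) : ∀ v : V, v = 0 := by
  let e := LinearEquiv.ofInjectiveEndo A hA
  have h1 : B - e.symm.conj B = LinearMap.id := by
    ext v
    apply hA
    have h2 := congrArg (fun f : V →ₗ[ℝ] V => f v) h
    have h3 : A (e.symm.conj B v) = B (A v) := by
      rw [LinearEquiv.conj_apply_apply]
      exact e.apply_symm_apply _
    simp only [LinearMap.sub_apply, LinearMap.comp_apply] at h2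
    rw [LinearMap.sub_apply, map_sub, h3, h2]
    rfl
  have h2 := congrArg (LinearMap.trace ℝ V) h1
  rw [map_sub, LinearMap.trace_conj', sub_self, LinearMap.trace_id] at h2
  have h3 : Module.finrank ℝ V = 0 := by exact_mod_cast h2.symm
  have := Module.finrank_zero_iff.1 h3
  exact fun v => Subsingleton.elim _ _

/-- If there are translations, they form the two-dimensional standard representation of
`sl(2, ℝ)`, and the standard basis of `sl(2, ℝ)` lifts to `L`. -/
theorem exists_frame_of_translations (hdim : Module.finrank ℝ L = 5)
    (hns : ¬ LieAlgebra.IsSolvable L) (hK : translationFields L ≠ ⊥) (t₀ : ℝ) :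
    ∃ (x₁ x₂ x₃ : smoothFn) (X₁ X₂ X₃ v : SymField), IsFrame L x₁ x₂ x₃ X₁ X₂ X₃ ∧ 0 < x₁.1 t₀ ∧
      v ∈ translationFields L ∧ v ≠ 0 ∧ ⁅X₁, v⁆ = 0 ∧
      ∀ X ∈ L, X.tau = 0 → ∃ α β : ℝ, X = α • v + β • ⁅X₃, v⁆ := by
  have hfin := finiteDimensional_of_finrank_eq_five hdim
  have hfinL : FiniteDimensional ℝ L.toSubmodule := hfin
  obtain ⟨x₁, x₂, x₃, hs, hpos, hX1, hX2, hX3, hsp⟩ := exists_isSl2 L hns t₀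
  have h1 : x₁ ≠ 0 := by
    rintro rfl
    simp at hpos
  have hfr := finrank_tau_ker hdim hs h1 hX1 hX2 hX3 hsp
  obtain ⟨X₁, hX₁, X₂, hX₂, X₃, hX₃, ⟨t1, a1⟩, ⟨t2, a2⟩, ⟨t3, a3⟩⟩ := exists_lift hs hX1 hX2 hX3
  set K₀ := translationFields L with hK₀
  have hK₀L : K₀ ≤ L.toSubmodule := fun u hu => (mem_translationFields.1 hu).1
  have hfinK : FiniteDimensional ℝ K₀ := Submodule.finiteDimensional_of_le hK₀L
  have hab : ∀ u ∈ K₀, ∀ w ∈ K₀, ⁅u, w⁆ = 0 := fun u hu w hw =>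
    lie_eq_zero_of_translation (mem_translationFields.1 hu).2 (mem_translationFields.1 hw).2
  have m12 : ⁅X₁, X₂⁆ - X₁ ∈ K₀ := sub_mem_translationFields (L.lie_mem hX₁ hX₂) hX₁
    (by simp [t1, t2, hs.h12]) (by simp [a1])
  have m13 : ⁅X₁, X₃⁆ - (2 : ℝ) • X₂ ∈ K₀ := sub_mem_translationFields (L.lie_mem hX₁ hX₃)
    (L.smul_mem _ hX₂) (by simp [t1, t3, t2, hs.h13]) (by simp [a2])
  have m23 : ⁅X₂, X₃⁆ - X₃ ∈ K₀ := sub_mem_translationFields (L.lie_mem hX₂ hX₃) hX₃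
    (by simp [t2, t3, hs.h23]) (by simp [a3])
  -- a vector annihilated by the first field
  obtain ⟨v, hv, hv0, hX₁v⟩ : ∃ v ∈ K₀, v ≠ 0 ∧ ⁅X₁, v⁆ = 0 := by
    by_contra! hno
    let A : K₀ →ₗ[ℝ] K₀ := (LieAlgebra.ad ℝ SymField X₁).restrict fun u hu =>
      lie_mem_translationFields hX₁ hu
    let B : K₀ →ₗ[ℝ] K₀ := (LieAlgebra.ad ℝ SymField X₂).restrict fun u hu =>
      lie_mem_translationFields hX₂ hu
    -- The lifts satisfy `⁅X₁, X₂⁆ = X₁` only up to a translation, but translations act trivially on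
    -- translations. Were `ad X₁` injective, `eq_zero_of_finrank_smul` would leave no translations.
    have hAB : A ∘ₗ B - B ∘ₗ A = A := by
      refine LinearMap.ext fun u => Subtype.ext ?_
      change ⁅X₁, ⁅X₂, (u : SymField)⁆⁆ - ⁅X₂, ⁅X₁, (u : SymField)⁆⁆ = ⁅X₁, (u : SymField)⁆
      have := hab _ m12 u u.2
      rw [sub_lie, sub_eq_zero] at this
      exact (lie_lie X₁ X₂ (u : SymField)).symm.trans this
    have hA : Function.Injective A := by
      rw [injective_iff_map_eq_zero]
      intro u hu
      by_contra hne
      exact hno u u.2 (fun h => hne (Subtype.ext h)) (congrArg Subtype.val hu)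
    have := eq_zero_of_finrank_smul A B hAB hA
    apply hK
    rw [Submodule.eq_bot_iff]
    intro u hu
    exact congrArg Subtype.val (this ⟨u, hu⟩)
  have hvt := (mem_translationFields.1 hv).2
  have hne : ∀ᶠ t in nhds t₀, x₁.1 t ≠ 0 := (smoothFn.continuous x₁).continuousAt.eventually_ne hpos.ne'
  have hX₁lam : ∀ x, x₁ * dt (v.lam x) = (1 / 2 : ℝ) • (dt x₁ * v.lam x) := by
    intro x
    have := lam_lie_of_translation a1 hvt x
    rw [hX₁v, t1] at this
    rw [← sub_eq_zero, ← this]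
    rfl
  -- Where `x₁ ≠ 0`, the equation `x₁ λ' = x₁' λ / 2` and `x₁ x₂' - x₂ x₁' = x₁` give `x₂ λ' - x₂' λ
  -- / 2 = -λ / 2`. An identity near `t₀` suffices, since a translation vanishing there is zero.
  have hX₂v : ⁅X₂, v⁆ = (-(1 / 2) : ℝ) • v := by
    rw [← sub_eq_zero]
    refine eq_zero_of_eventuallyEq_zero hns (t₀ := t₀)
      (sub_mem (lie_mem_translationFields hX₂ hv) (Submodule.smul_mem _ _ hv)) fun x => ?_
    filter_upwards [hne] with t ht
    have e1 := congrArg (fun f : smoothFn => f.1 t) (hX₁lam x)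
    have e2 := congrArg (fun f : smoothFn => f.1 t) hs.h12
    rw [SymField.lam_sub, lam_lie_of_translation a2 hvt, t2]
    simp only [smoothFn.mul_apply, smoothFn.smul_apply, smoothFn.sub_apply, SymField.lam_smul,
      Pi.zero_apply] at e1 e2 ⊢
    apply mul_left_cancel₀ ht
    linear_combination x₂.1 t * e1 - (v.lam x).1 t / 2 * e2
  set w := ⁅X₃, v⁆ with hw
  have hwK : w ∈ K₀ := lie_mem_translationFields hX₃ hv
  have hX₁w : ⁅X₁, w⁆ = -v := by
    have := hab _ m13 v hv
    rw [sub_lie, sub_eq_zero, smul_lie, hX₂v] at this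
    rw [hw, leibniz_lie, this, hX₁v, lie_zero, add_zero]
    module
  have hX₂w : ⁅X₂, w⁆ = (1 / 2 : ℝ) • w := by
    have := hab _ m23 v hv
    rw [sub_lie, sub_eq_zero] at this
    rw [hw, leibniz_lie, this, hX₂v, lie_smul, ← hw]
    module
  have hlin : ∀ α β : ℝ, α • v + β • w = 0 → α = 0 ∧ β = 0 := by
    intro α β h
    have e := congrArg (fun Y => ⁅X₁, Y⁆) h
    simp only [lie_add, lie_smul, hX₁v, hX₁w, lie_zero, smul_zero, zero_add, smul_neg,
      neg_eq_zero, smul_eq_zero, hv0, or_false] at e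
    rw [e, zero_smul, add_zero] at h
    exact ⟨(smul_eq_zero.1 h).resolve_right hv0, e⟩
  have hspan : ∀ X ∈ L, X.tau = 0 → ∃ α β : ℝ, X = α • v + β • w := by
    intro X hX ht
    set K := LinearMap.ker (SymField.tauL ∘ₗ L.toSubmodule.subtype) with hKdef
    let v' : K := ⟨⟨v, hK₀L hv⟩, hvt.1⟩
    let w' : K := ⟨⟨w, hK₀L hwK⟩, (mem_translationFields.1 hwK).2.1⟩
    have hli : LinearIndependent ℝ ![v', w'] := by
      rw [LinearIndependent.pair_iff]
      intro s t h
      exact hlin s t (congrArg (fun Y : K => ((Y : L.toSubmodule) : SymField)) h)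
    have htop := hli.span_eq_top_of_card_eq_finrank (by simp [hfr])
    have hmem : (⟨⟨X, hX⟩, ht⟩ : K) ∈ Submodule.span ℝ (Set.range ![v', w']) := by
      rw [htop]; trivial
    rw [Matrix.range_cons, Matrix.range_cons, Matrix.range_empty, Set.union_empty,
      Set.singleton_union, Submodule.mem_span_pair] at hmem
    obtain ⟨α, β, h⟩ := hmem
    exact ⟨α, β, (congrArg (fun Y : K => ((Y : L.toSubmodule) : SymField)) h).symm⟩
  -- The eigenvalues of `ad X₂` are `-1/2` on `v` and `1/2` on `w`. Since `±1` do not occur, `1 ± ad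
  -- X₂` is invertible on the translations.
  have hsq : ∀ k ∈ K₀, ⁅X₂, ⁅X₂, k⁆⁆ = (1 / 4 : ℝ) • k := by
    intro k hk
    obtain ⟨α, β, rfl⟩ := hspan k (hK₀L hk) (mem_translationFields.1 hk).2.1
    simp only [lie_add, lie_smul, hX₂v, hX₂w]
    module
  -- the correction of the lifts
  set k₁ := ⁅X₁, X₂⁆ - X₁ with hk₁
  set k₃ := ⁅X₂, X₃⁆ - X₃ with hk₃
  -- The corrections must satisfy `(1 + ad X₂) c₁ = k₁` and `(1 - ad X₂) c₃ = k₃`. As `(ad X₂)² =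
  -- 1/4`, the product `(1 + ad X₂)(1 - ad X₂)` is `3/4`, which gives both formulas.
  set c₁ := (4 / 3 : ℝ) • (k₁ - ⁅X₂, k₁⁆) with hc₁
  set c₃ := (4 / 3 : ℝ) • (k₃ + ⁅X₂, k₃⁆) with hc₃
  have hc₁K : c₁ ∈ K₀ := Submodule.smul_mem _ _ (sub_mem m12 (lie_mem_translationFields hX₂ m12))
  have hc₃K : c₃ ∈ K₀ := Submodule.smul_mem _ _ (add_mem m23 (lie_mem_translationFields hX₂ m23))
  have hc₁t := (mem_translationFields.1 hc₁K).2
  have hc₃t := (mem_translationFields.1 hc₃K).2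
  have e12 : ⁅X₁, X₂⁆ = X₁ + k₁ := by rw [hk₁]; abel
  have e23 : ⁅X₂, X₃⁆ = X₃ + k₃ := by rw [hk₃]; abel
  have f12 : ⁅X₁ + c₁, X₂⁆ = X₁ + c₁ := by
    have : ⁅X₂, c₁⁆ = (4 / 3 : ℝ) • ⁅X₂, k₁⁆ - (1 / 3 : ℝ) • k₁ := by
      rw [hc₁, lie_smul, lie_sub, hsq _ m12]
      module
    rw [add_lie, e12, ← lie_skew c₁ X₂, this, hc₁]
    module
  have f23 : ⁅X₂, X₃ + c₃⁆ = X₃ + c₃ := by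
    have : ⁅X₂, c₃⁆ = (4 / 3 : ℝ) • ⁅X₂, k₃⁆ + (1 / 3 : ℝ) • k₃ := by
      rw [hc₃, lie_smul, lie_add, hsq _ m23]
      module
    rw [lie_add, e23, this, hc₃]
    module
  have f13 : ⁅X₁ + c₁, X₃ + c₃⁆ = (2 : ℝ) • X₂ := by
    have hmem : ⁅X₁ + c₁, X₃ + c₃⁆ - (2 : ℝ) • X₂ ∈ K₀ :=
      sub_mem_translationFields (L.lie_mem (L.add_mem hX₁ (hK₀L hc₁K)) (L.add_mem hX₃ (hK₀L hc₃K)))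
        (L.smul_mem _ hX₂) (by simp [t1, t3, t2, hs.h13, hc₁t.1, hc₃t.1]) (by simp [a2])
    -- The last relation needs no correction: by the Jacobi identity its defect is killed by `ad
    -- X₂`, whose square is `1/4` on translations.
    have hz : ⁅X₂, ⁅X₁ + c₁, X₃ + c₃⁆ - (2 : ℝ) • X₂⁆ = 0 := by
      rw [lie_sub, lie_smul, lie_self, smul_zero, sub_zero, leibniz_lie, f23,
        ← lie_skew X₂ (X₁ + c₁), f12, neg_lie]
      abel
    have := hsq _ hmem
    rw [hz, lie_zero] at this
    rw [← sub_eq_zero]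
    exact (smul_eq_zero.1 this.symm).resolve_left (by norm_num)
  refine ⟨x₁, x₂, x₃, X₁ + c₁, X₂, X₃ + c₃, v, ⟨hs, L.add_mem hX₁ (hK₀L hc₁K), hX₂,
    L.add_mem hX₃ (hK₀L hc₃K), ?_, t2, ?_, ?_, a2, ?_, f12, f13, f23, hsp⟩, hpos, hv, hv0, ?_, ?_⟩
  · simp [t1, hc₁t.1]
  · simp [t3, hc₃t.1]
  · simp [a1, hc₁t.2]
  · simp [a3, hc₃t.2]
  · rw [add_lie, hX₁v, hab _ hc₁K v hv, add_zero]
  · intro X hX ht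
    rw [add_lie, hab _ hc₃K v hv, add_zero]
    exact hspan X hX ht

end

/-! ### The straightening transformation of a frame -/

section Straightening

variable {L : LieSubalgebra ℝ SymField} {x₁ x₂ x₃ : smoothFn} {X₁ X₂ X₃ : SymField}

/-- The new time `x₂ / x₁`. -/
noncomputable def newTime (x₁ x₂ : smoothFn) (t : ℝ) : ℝ := x₂.1 t / x₁.1 t

/-- The shift of `u` that removes the `λ` of a frame. -/
noncomputable def shiftQ (X₁ X₂ : SymField) (x : Site) (t : ℝ) : ℝ :=
  2 * (newTime X₁.tau X₂.tau t * (X₁.lam x).1 t - (X₂.lam x).1 t)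

/-- The first derivative of `shiftQ`. -/
noncomputable def shiftQ1 (X₁ X₂ : SymField) (x : Site) (t : ℝ) : ℝ :=
  ((X₁.lam x).1 t + (dt X₁.tau).1 t / 2 * shiftQ X₁ X₂ x t) / X₁.tau.1 t

/-- The second derivative of `shiftQ`. -/
noncomputable def shiftQ2 (X₁ X₂ : SymField) (x : Site) (t : ℝ) : ℝ :=
  ((dt (X₁.lam x)).1 t + (dt (dt X₁.tau)).1 t / 2 * shiftQ X₁ X₂ x t
    - (dt X₁.tau).1 t / 2 * shiftQ1 X₁ X₂ x t) / X₁.tau.1 t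

/-- The third derivative of `shiftQ`. -/
noncomputable def shiftQ3 (X₁ X₂ : SymField) (x : Site) (t : ℝ) : ℝ :=
  ((dt (dt (X₁.lam x))).1 t + (dt (dt (dt X₁.tau))).1 t / 2 * shiftQ X₁ X₂ x t
    - 3 / 2 * (dt X₁.tau).1 t * shiftQ2 X₁ X₂ x t) / X₁.tau.1 t

/-- The first relation makes the derivative of `x₂ / x₁` equal to `1 / x₁`, so that `x₁ ∂_t` becomes
the unit field. -/
theorem IsSl2.hasDerivAt_newTime (hs : IsSl2 x₁ x₂ x₃) {t : ℝ} (ht : x₁.1 t ≠ 0) :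
    HasDerivAt (newTime x₁ x₂) (x₁.1 t)⁻¹ t := by
  refine ((smoothFn.hasDerivAt x₂ t).div (smoothFn.hasDerivAt x₁ t) ht).congr_deriv ?_
  have e := congrArg (fun f : smoothFn => f.1 t) hs.h12
  simp only [smoothFn.mul_apply, smoothFn.sub_apply] at e
  field_simp
  linear_combination e

theorem IsFrame.lam_rel12 (hfr : IsFrame L x₁ x₂ x₃ X₁ X₂ X₃) (x : Site) (t : ℝ) :
    x₁.1 t * (dt (X₂.lam x)).1 t + (X₁.lam x).1 t * ((dt x₂).1 t / 2)
      - x₂.1 t * (dt (X₁.lam x)).1 t - (X₂.lam x).1 t * ((dt x₁).1 t / 2) = (X₁.lam x).1 t := by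
  have e := congrArg (fun Y : SymField => (Y.lam x).1 t) hfr.h12
  simp only [SymField.lam_lie, smoothFn.sub_apply, smoothFn.add_apply, smoothFn.mul_apply,
    SymField.b_apply, hfr.tau₁, hfr.tau₂, hfr.a₁, hfr.a₂] at e
  linear_combination e

theorem IsFrame.lam_rel12' (hfr : IsFrame L x₁ x₂ x₃ X₁ X₂ X₃) (x : Site) (t : ℝ) :
    (dt x₁).1 t * (dt (X₂.lam x)).1 t + x₁.1 t * (dt (dt (X₂.lam x))).1 t
      + (dt (X₁.lam x)).1 t * ((dt x₂).1 t / 2) + (X₁.lam x).1 t * ((dt (dt x₂)).1 t / 2)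
      - (dt x₂).1 t * (dt (X₁.lam x)).1 t - x₂.1 t * (dt (dt (X₁.lam x))).1 t
      - (dt (X₂.lam x)).1 t * ((dt x₁).1 t / 2) - (X₂.lam x).1 t * ((dt (dt x₁)).1 t / 2)
      = (dt (X₁.lam x)).1 t := by
  have e : x₁ * dt (X₂.lam x) + X₁.lam x * ((1 / 2 : ℝ) • dt x₂) - x₂ * dt (X₁.lam x)
      - X₂.lam x * ((1 / 2 : ℝ) • dt x₁) = X₁.lam x := by
    ext t
    have := hfr.lam_rel12 x t
    simp only [smoothFn.sub_apply, smoothFn.add_apply, smoothFn.mul_apply, smoothFn.smul_apply]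
    linear_combination this
  have e' := congrArg (fun f : smoothFn => (dt f).1 t) e
  simp only [map_add, map_sub, Derivation.leibniz, Derivation.map_smul, smul_eq_mul,
    smoothFn.sub_apply, smoothFn.add_apply, smoothFn.mul_apply, smoothFn.smul_apply] at e'
  linear_combination e'

theorem IsFrame.lam_rel13 (hfr : IsFrame L x₁ x₂ x₃ X₁ X₂ X₃) (x : Site) (t : ℝ) :
    x₁.1 t * (dt (X₃.lam x)).1 t + (X₁.lam x).1 t * ((dt x₃).1 t / 2)
      - x₃.1 t * (dt (X₁.lam x)).1 t - (X₃.lam x).1 t * ((dt x₁).1 t / 2)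
      = 2 * (X₂.lam x).1 t := by
  have e := congrArg (fun Y : SymField => (Y.lam x).1 t) hfr.h13
  simp only [SymField.lam_lie, smoothFn.sub_apply, smoothFn.add_apply, smoothFn.mul_apply,
    SymField.b_apply, hfr.tau₁, hfr.tau₃, hfr.a₁, hfr.a₃, SymField.lam_smul,
    smoothFn.smul_apply] at e
  linear_combination e

theorem IsFrame.lam_rel23 (hfr : IsFrame L x₁ x₂ x₃ X₁ X₂ X₃) (x : Site) (t : ℝ) :
    x₂.1 t * (dt (X₃.lam x)).1 t + (X₂.lam x).1 t * ((dt x₃).1 t / 2)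
      - x₃.1 t * (dt (X₂.lam x)).1 t - (X₃.lam x).1 t * ((dt x₂).1 t / 2)
      = (X₃.lam x).1 t := by
  have e := congrArg (fun Y : SymField => (Y.lam x).1 t) hfr.h23
  simp only [SymField.lam_lie, smoothFn.sub_apply, smoothFn.add_apply, smoothFn.mul_apply,
    SymField.b_apply, hfr.tau₂, hfr.tau₃, hfr.a₂, hfr.a₃] at e
  linear_combination e

theorem IsSl2.rel12 (hs : IsSl2 x₁ x₂ x₃) (t : ℝ) :
    x₁.1 t * (dt x₂).1 t - x₂.1 t * (dt x₁).1 t = x₁.1 t :=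
  congrArg (fun f : smoothFn => f.1 t) hs.h12

theorem IsSl2.rel13 (hs : IsSl2 x₁ x₂ x₃) (t : ℝ) :
    x₁.1 t * (dt x₃).1 t - x₃.1 t * (dt x₁).1 t = 2 * x₂.1 t :=
  congrArg (fun f : smoothFn => f.1 t) hs.h13

theorem IsSl2.rel12' (hs : IsSl2 x₁ x₂ x₃) (t : ℝ) :
    x₁.1 t * (dt (dt x₂)).1 t - x₂.1 t * (dt (dt x₁)).1 t = (dt x₁).1 t := by
  have e := congrArg (fun f : smoothFn => (dt f).1 t) hs.h12
  simp only [map_sub, Derivation.leibniz, smul_eq_mul,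
    smoothFn.sub_apply, smoothFn.add_apply, smoothFn.mul_apply] at e
  linear_combination e

theorem IsSl2.rel12'' (hs : IsSl2 x₁ x₂ x₃) (t : ℝ) :
    (dt x₁).1 t * (dt (dt x₂)).1 t + x₁.1 t * (dt (dt (dt x₂))).1 t
      - (dt x₂).1 t * (dt (dt x₁)).1 t - x₂.1 t * (dt (dt (dt x₁))).1 t = (dt (dt x₁)).1 t := by
  have e : x₁ * dt (dt x₂) - x₂ * dt (dt x₁) = dt x₁ := by
    ext t
    exact hs.rel12' t
  have e := congrArg (fun f : smoothFn => (dt f).1 t) e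
  simp only [map_sub, Derivation.leibniz, smul_eq_mul,
    smoothFn.sub_apply, smoothFn.add_apply, smoothFn.mul_apply] at e
  linear_combination e

/-- Removing the `λ` of `X₁` and `X₂` requires `x_i Q' = x_i' Q / 2 + λ_i` for `i = 1, 2`.
Eliminating `Q'`, with `x₂' - (x₂ / x₁) x₁' = 1`, leaves the algebraic formula `shiftQ`; that it
solves the first equation follows from `⁅X₁, X₂⁆ = X₁`. Its higher derivatives come from
differentiating that equation. -/
theorem IsFrame.hasDerivAt_shiftQ (hfr : IsFrame L x₁ x₂ x₃ X₁ X₂ X₃) (x : Site) {t : ℝ} (ht : x₁.1 t ≠ 0) :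
    HasDerivAt (shiftQ X₁ X₂ x) (shiftQ1 X₁ X₂ x t) t := by
  have h1 := hfr.isSl2.hasDerivAt_newTime ht
  rw [← hfr.tau₁, ← hfr.tau₂] at h1
  refine (((h1.mul (smoothFn.hasDerivAt (X₁.lam x) t)).sub
    (smoothFn.hasDerivAt (X₂.lam x) t)).const_mul 2).congr_deriv ?_
  have e1 := hfr.lam_rel12 x t
  have e2 := hfr.isSl2.rel12 t
  simp only [shiftQ1, shiftQ, newTime, hfr.tau₁, hfr.tau₂]
  field_simp
  linear_combination (-2 * x₁.1 t) * e1 + (X₁.lam x).1 t * e2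

theorem IsFrame.hasDerivAt_shiftQ1 (hfr : IsFrame L x₁ x₂ x₃ X₁ X₂ X₃) (x : Site) {t : ℝ} (ht : x₁.1 t ≠ 0) :
    HasDerivAt (shiftQ1 X₁ X₂ x) (shiftQ2 X₁ X₂ x t) t := by
  have ht' : X₁.tau.1 t ≠ 0 := by rwa [hfr.tau₁]
  refine (((smoothFn.hasDerivAt (X₁.lam x) t).add (((smoothFn.hasDerivAt (dt X₁.tau) t).div_const
    2).mul (hfr.hasDerivAt_shiftQ x ht))).div (smoothFn.hasDerivAt X₁.tau t) ht').congr_deriv ?_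
  simp only [shiftQ1, shiftQ2, Pi.add_apply, Pi.mul_apply]
  field_simp
  ring

theorem IsFrame.hasDerivAt_shiftQ2 (hfr : IsFrame L x₁ x₂ x₃ X₁ X₂ X₃) (x : Site) {t : ℝ} (ht : x₁.1 t ≠ 0) :
    HasDerivAt (shiftQ2 X₁ X₂ x) (shiftQ3 X₁ X₂ x t) t := by
  have ht' : X₁.tau.1 t ≠ 0 := by rwa [hfr.tau₁]
  refine ((((smoothFn.hasDerivAt (dt (X₁.lam x)) t).add (((smoothFn.hasDerivAt (dt (dt X₁.tau))
    t).div_const 2).mul (hfr.hasDerivAt_shiftQ x ht))).sub (((smoothFn.hasDerivAt (dt X₁.tau)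
    t).div_const 2).mul (hfr.hasDerivAt_shiftQ1 x ht))).div
      (smoothFn.hasDerivAt X₁.tau t) ht').congr_deriv ?_
  simp only [shiftQ3, shiftQ2, Pi.add_apply, Pi.mul_apply, Pi.sub_apply]
  field_simp
  ring

/-- The transformation that straightens a frame. -/
noncomputable def IsFrame.transf (hfr : IsFrame L x₁ x₂ x₃ X₁ X₂ X₃) (J : Set ℝ) (hJ : IsOpen J)
    (hJc : IsPreconnected J) (hpos : ∀ t ∈ J, 0 < x₁.1 t) (P : Site → ℝ) (hP : ∀ x, P x ≠ 0) :
    AllowedTransformation where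
  J := J
  isOpen := hJ
  isPreconnected := hJc
  θ := newTime x₁ x₂
  smooth_θ := (smoothFn.contDiff x₂).contDiffOn.div (smoothFn.contDiff x₁).contDiffOn
    fun t ht => (hpos t ht).ne'
  deriv_pos t ht := by
    rw [(hfr.isSl2.hasDerivAt_newTime (hpos t ht).ne').deriv]
    exact inv_pos.2 (hpos t ht)
  P := P
  P_ne_zero := hP
  Q := shiftQ X₁ X₂
  smooth_Q x := by
    have h : ContDiffOn ℝ ∞ (newTime X₁.tau X₂.tau) J :=
      (smoothFn.contDiff _).contDiffOn.div (smoothFn.contDiff _).contDiffOn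
        fun t ht => by rw [hfr.tau₁]; exact (hpos t ht).ne'
    exact contDiffOn_const.mul ((h.mul (smoothFn.contDiff (X₁.lam x)).contDiffOn).sub
      (smoothFn.contDiff (X₂.lam x)).contDiffOn)

variable (hfr : IsFrame L x₁ x₂ x₃ X₁ X₂ X₃) {J : Set ℝ} {hJ : IsOpen J} {hJc : IsPreconnected J} {hpos : ∀ t ∈ J, 0 < x₁.1 t}
  {P : Site → ℝ} {hP : ∀ x, P x ≠ 0}

theorem inv_rpow_half (a : ℝ) : a⁻¹ ^ (1 / 2 : ℝ) = (√a)⁻¹ := by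
  rw [← Real.sqrt_eq_rpow, Real.sqrt_inv]

theorem inv_rpow_neg_half {a : ℝ} (ha : 0 < a) : a⁻¹ ^ (-(1 / 2) : ℝ) = √a := by
  rw [Real.rpow_neg (by positivity), inv_rpow_half a, inv_inv]

theorem inv_rpow_neg_three_half {a : ℝ} (ha : 0 < a) : a⁻¹ ^ (-(3 / 2) : ℝ) = √a ^ 3 := by
  rw [show (-(3 / 2) : ℝ) = -(1 / 2) * (3 : ℕ) by norm_num, Real.rpow_mul (by positivity),
    Real.rpow_natCast, inv_rpow_neg_half ha]

theorem iteratedDeriv_two_eq {f f1 : ℝ → ℝ} {f2 t : ℝ} (h1 : ∀ᶠ s in nhds t, HasDerivAt f (f1 s) s)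
    (h2 : HasDerivAt f1 f2 t) : iteratedDeriv 2 f t = f2 := by
  rw [iteratedDeriv_succ, iteratedDeriv_one]
  have : deriv f =ᶠ[nhds t] f1 := h1.mono fun s hs => hs.deriv
  rw [this.deriv_eq, h2.deriv]

theorem iteratedDeriv_three_eq {f f1 f2 : ℝ → ℝ} {f3 t : ℝ}
    (h1 : ∀ᶠ s in nhds t, HasDerivAt f (f1 s) s) (h2 : ∀ᶠ s in nhds t, HasDerivAt f1 (f2 s) s)
    (h3 : HasDerivAt f2 f3 t) : iteratedDeriv 3 f t = f3 := by
  rw [iteratedDeriv_succ]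
  have : iteratedDeriv 2 f =ᶠ[nhds t] f2 := by
    filter_upwards [h1.eventually_nhds, h2] with s hs hs2
    exact iteratedDeriv_two_eq hs hs2
  rw [this.deriv_eq, h3.deriv]

/-- The coefficient of `ũ` in the transformed interaction. -/
noncomputable def schwarzian (x₁ : smoothFn) (t : ℝ) : ℝ :=
  1 / 4 * (dt x₁).1 t ^ 2 - 1 / 2 * (x₁.1 t * (dt (dt x₁)).1 t)

theorem transf_deriv_θ {t : ℝ} (ht : t ∈ J) :
    deriv (hfr.transf J hJ hJc hpos P hP).θ t = (x₁.1 t)⁻¹ :=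
  (hfr.isSl2.hasDerivAt_newTime (hpos t ht).ne').deriv

theorem transf_deriv_Q (x : Site) {t : ℝ} (ht : t ∈ J) :
    deriv ((hfr.transf J hJ hJc hpos P hP).Q x) t = shiftQ1 X₁ X₂ x t :=
  (hfr.hasDerivAt_shiftQ x (hpos t ht).ne').deriv

theorem transf_old (x : Site) {t : ℝ} (ht : t ∈ J) (w : Fin 7 → ℝ) (i : Fin 7) :
    (hfr.transf J hJ hJc hpos P hP).old x t w i
      = √(x₁.1 t) * P (site x i) * w i + shiftQ X₁ X₂ (site x i) t := by
  rw [AllowedTransformation.old, transf_deriv_θ hfr ht, inv_rpow_neg_half (hpos t ht)]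
  rfl

theorem transf_newF (F : Interaction) (x : Site) {t : ℝ} (ht : t ∈ J) (w : Fin 7 → ℝ) :
    (hfr.transf J hJ hJc hpos P hP).newF F x t w
      = √(x₁.1 t) ^ 3 * (P x)⁻¹ * (F x t ((hfr.transf J hJ hJc hpos P hP).old x t w)
          - shiftQ2 X₁ X₂ x t) + schwarzian x₁ t * w 0 := by
  have hJev : ∀ᶠ s in nhds t, s ∈ J := hJ.mem_nhds ht
  have hx := hpos t ht
  have d1 : ∀ᶠ s in nhds t, HasDerivAt (newTime x₁ x₂) (x₁.1 s)⁻¹ s :=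
    hJev.mono fun s hs => hfr.isSl2.hasDerivAt_newTime (hpos s hs).ne'
  have d2 : ∀ᶠ s in nhds t, HasDerivAt (fun s => (x₁.1 s)⁻¹) (-(dt x₁).1 s / x₁.1 s ^ 2) s :=
    hJev.mono fun s hs => (smoothFn.hasDerivAt x₁ s).inv (hpos s hs).ne'
  have d3 : HasDerivAt (fun s => -(dt x₁).1 s / x₁.1 s ^ 2)
      (-(dt (dt x₁)).1 t / x₁.1 t ^ 2 + 2 * (dt x₁).1 t ^ 2 / x₁.1 t ^ 3) t := by
    refine ((smoothFn.hasDerivAt (dt x₁) t).neg.div ((smoothFn.hasDerivAt x₁ t).pow 2)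
      (pow_ne_zero 2 hx.ne')).congr_deriv ?_
    simp only [Pi.neg_apply, Pi.pow_apply]
    field_simp
    ring
  have i2 : iteratedDeriv 2 (hfr.transf J hJ hJc hpos P hP).θ t = -(dt x₁).1 t / x₁.1 t ^ 2 :=
    iteratedDeriv_two_eq d1 d2.self_of_nhds
  have i3 : iteratedDeriv 3 (hfr.transf J hJ hJc hpos P hP).θ t = _ :=
    iteratedDeriv_three_eq d1 d2 d3
  have q2 : iteratedDeriv 2 ((hfr.transf J hJ hJc hpos P hP).Q x) t = shiftQ2 X₁ X₂ x t :=
    iteratedDeriv_two_eq (hJev.mono fun s hs => hfr.hasDerivAt_shiftQ x (hpos s hs).ne')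
      (hfr.hasDerivAt_shiftQ1 x hx.ne')
  rw [AllowedTransformation.newF, i2, i3, q2, transf_deriv_θ hfr ht, inv_rpow_neg_three_half hx]
  simp only [schwarzian]
  have : (hfr.transf J hJ hJc hpos P hP).P x = P x := rfl
  rw [this]
  congr 1
  field_simp
  ring

/-- The effect of the transformation on the `λ` of the frame. -/
theorem IsFrame.shifted_lam (hfr : IsFrame L x₁ x₂ x₃ X₁ X₂ X₃) (x : Site) {t : ℝ}
    (ht : x₁.1 t ≠ 0) :
    (dt x₁).1 t / 2 * shiftQ X₁ X₂ x t + (X₁.lam x).1 t - x₁.1 t * shiftQ1 X₁ X₂ x t = 0 ∧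
    (dt x₂).1 t / 2 * shiftQ X₁ X₂ x t + (X₂.lam x).1 t - x₂.1 t * shiftQ1 X₁ X₂ x t = 0 ∧
    (dt x₃).1 t / 2 * shiftQ X₁ X₂ x t + (X₃.lam x).1 t - x₃.1 t * shiftQ1 X₁ X₂ x t = 0 := by
  have r12 := hfr.isSl2.rel12 t
  have r13 := hfr.isSl2.rel13 t
  have l12 := hfr.lam_rel12 x t
  have l13 := hfr.lam_rel13 x t
  have l23 := hfr.lam_rel23 x t
  have sq : x₁.1 t * x₃.1 t = x₂.1 t ^ 2 := by
    have := congrArg (fun f : smoothFn => f.1 t) hfr.isSl2.mul_eq_sq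
    rw [pow_two] at this ⊢
    exact this
  simp only [shiftQ1, shiftQ, newTime, hfr.tau₁, hfr.tau₂]
  generalize x₁.1 t = a at *
  generalize x₂.1 t = b at *
  generalize x₃.1 t = c at *
  generalize (dt x₁).1 t = a' at *
  generalize (dt x₂).1 t = b' at *
  generalize (dt x₃).1 t = c' at *
  generalize (X₁.lam x).1 t = p at *
  generalize (X₂.lam x).1 t = q at *
  generalize (X₃.lam x).1 t = r at *
  generalize (dt (X₁.lam x)).1 t = p' at *
  generalize (dt (X₂.lam x)).1 t = q' at *
  generalize (dt (X₃.lam x)).1 t = r' at *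
  have hc : c = b ^ 2 / a := by field_simp; linear_combination sq
  have hb' : b' = 1 + b * a' / a := by field_simp; linear_combination r12
  have hc' : c' = (2 * b + c * a') / a := by field_simp; linear_combination r13
  have hq' : q' = (p - p * (b' / 2) + b * p' + q * (a' / 2)) / a := by
    field_simp; linear_combination 2 * l12
  -- Eliminating `r'` between `l13` and `l23` leaves `r` with coefficient `3a/2` by `r12`. So the
  -- `λ` of `X₃` is determined by those of `X₁` and `X₂`.
  have hr : r = (2 / 3) * (2 * b * q - b * (p * (c' / 2)) + b * c * p' + a * (q * (c' / 2))
      - a * c * q') / a := by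
    rw [eq_div_iff ht]
    linear_combination (2 / 3) * (b * l13 - a * l23) - (r / 3) * r12
  refine ⟨?_, ?_, ?_⟩
  · field_simp
    ring
  · rw [hb']
    field_simp
    ring
  · rw [hr, hq', hc', hb', hc]
    field_simp
    ring

end Straightening

/-! ### The action of the straightening transformation on fields -/

theorem AllowedTransformation.Related.add {T : AllowedTransformation} {X X' Y Y' : SymField}
    (h : T.Related X Y) (h' : T.Related X' Y') : T.Related (X + X') (Y + Y') := by
  refine ⟨fun t ht => ?_, fun x => ?_, fun x t ht => ?_⟩
  · have e1 := h.1 t ht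
    have e2 := h'.1 t ht
    simp only [SymField.tau_add, smoothFn.add_apply]
    rw [e1, e2, add_mul]
  · simp [h.2.1 x, h'.2.1 x]
  · have e1 := h.2.2 x t ht
    have e2 := h'.2.2 x t ht
    simp only [smoothFn.deriv_eq] at e1 e2 ⊢
    simp only [SymField.tau_add, SymField.lam_add, SymField.a_add, map_add, smoothFn.add_apply]
    rw [e1, e2]
    ring

theorem AllowedTransformation.Related.smul {T : AllowedTransformation} {X Y : SymField} (c : ℝ)
    (h : T.Related X Y) : T.Related (c • X) (c • Y) := by
  refine ⟨fun t ht => ?_, fun x => ?_, fun x t ht => ?_⟩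
  · have e1 := h.1 t ht
    simp only [SymField.tau_smul, smoothFn.smul_apply]
    rw [e1, mul_assoc]
  · simp [h.2.1 x]
  · have e1 := h.2.2 x t ht
    simp only [smoothFn.deriv_eq] at e1 ⊢
    simp only [SymField.tau_smul, SymField.lam_smul, SymField.a_smul, Derivation.map_smul,
      smoothFn.smul_apply]
    rw [e1]
    ring

section Straightening

variable {L : LieSubalgebra ℝ SymField} {x₁ x₂ x₃ : smoothFn} {X₁ X₂ X₃ : SymField}

theorem IsSl2.mul_apply_eq_sq (hs : IsSl2 x₁ x₂ x₃) (t : ℝ) :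
    x₁.1 t * x₃.1 t = x₂.1 t ^ 2 := by
  have := congrArg (fun f : smoothFn => f.1 t) hs.mul_eq_sq
  rw [pow_two] at this ⊢
  exact this

variable (hfr : IsFrame L x₁ x₂ x₃ X₁ X₂ X₃) {J : Set ℝ} {hJ : IsOpen J} {hJc : IsPreconnected J}
  {hpos : ∀ t ∈ J, 0 < x₁.1 t} {P : Site → ℝ} {hP : ∀ x, P x ≠ 0}

theorem transf_related_iff {X Y : SymField} : (hfr.transf J hJ hJc hpos P hP).Related X Y ↔
    (∀ t ∈ J, Y.tau.1 (newTime x₁ x₂ t) = X.tau.1 t / x₁.1 t) ∧ (∀ x, Y.a x = X.a x) ∧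
    ∀ x, ∀ t ∈ J, (Y.lam x).1 (newTime x₁ x₂ t) = (√(x₁.1 t))⁻¹ * (P x)⁻¹ *
      (((dt X.tau).1 t / 2 + X.a x) * shiftQ X₁ X₂ x t + (X.lam x).1 t
        - X.tau.1 t * shiftQ1 X₁ X₂ x t) := by
  refine and_congr (forall₂_congr fun t ht => ?_) (and_congr Iff.rfl
    (forall_congr' fun x => forall₂_congr fun t ht => ?_))
  · change t ∈ J at ht
    rw [transf_deriv_θ hfr ht, div_eq_mul_inv]
    rfl
  · change t ∈ J at ht
    rw [transf_deriv_θ hfr ht, transf_deriv_Q hfr x ht, inv_rpow_half]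
    rfl

theorem transf_related₁ : (hfr.transf J hJ hJc hpos P hP).Related X₁ sl2X1 := by
  rw [transf_related_iff]
  refine ⟨fun t ht => ?_, fun x => (hfr.a₁ x).symm, fun x t ht => ?_⟩
  · rw [hfr.tau₁, div_self (hpos t ht).ne']
    rfl
  · rw [hfr.tau₁, hfr.a₁, add_zero, (hfr.shifted_lam x (hpos t ht).ne').1, mul_zero]
    rfl

theorem transf_related₂ : (hfr.transf J hJ hJc hpos P hP).Related X₂ sl2X2 := by
  rw [transf_related_iff]
  refine ⟨fun t ht => ?_, fun x => (hfr.a₂ x).symm, fun x t ht => ?_⟩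
  · rw [hfr.tau₂]
    rfl
  · rw [hfr.tau₂, hfr.a₂, add_zero, (hfr.shifted_lam x (hpos t ht).ne').2.1, mul_zero]
    rfl

theorem transf_related₃ : (hfr.transf J hJ hJc hpos P hP).Related X₃ sl2X3 := by
  rw [transf_related_iff]
  refine ⟨fun t ht => ?_, fun x => (hfr.a₃ x).symm, fun x t ht => ?_⟩
  · rw [hfr.tau₃]
    change (timeFn ^ 2).1 _ = _
    have := (hpos t ht).ne'
    have e := hfr.isSl2.mul_apply_eq_sq t
    rw [smoothFn.timeFn_sq_apply, newTime]
    field_simp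
    linear_combination -e
  · rw [hfr.tau₃, hfr.a₃, add_zero, (hfr.shifted_lam x (hpos t ht).ne').2.2, mul_zero]
    rfl

/-- A combination of `sl(2, ℝ)` functions that vanishes near a time vanishes. -/
theorem IsSl2.eq_zero_of_eventuallyEq_zero (hs : IsSl2 x₁ x₂ x₃) {t₀ : ℝ} (h1 : x₁.1 t₀ ≠ 0)
    {f : smoothFn} (hf : f ∈ Submodule.span ℝ {x₁, x₂, x₃}) (h0 : f.1 =ᶠ[nhds t₀] 0) : f = 0 := by
  obtain ⟨α, β, γ, rfl⟩ := Submodule.mem_span_triple.1 hf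
  have hx : ∀ᶠ t in nhds t₀, x₁.1 t ≠ 0 := (smoothFn.continuous x₁).continuousAt.eventually_ne h1
  have h0' := smoothFn.eventuallyEq_zero_dt h0
  have s1 : (β • x₁ + (2 * γ) • x₂).1 =ᶠ[nhds t₀] 0 := by
    filter_upwards [h0, h0'] with t e e'
    simp only [map_add, Derivation.map_smul, smoothFn.add_apply, smoothFn.smul_apply,
      Pi.zero_apply] at e e' ⊢
    linear_combination x₁.1 t * e' - (dt x₁).1 t * e - β * hs.rel12 t - γ * hs.rel13 t
  have s1' := smoothFn.eventuallyEq_zero_dt s1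
  have hγ : γ = 0 := by
    have e := s1.self_of_nhds
    have e' := s1'.self_of_nhds
    simp only [map_add, Derivation.map_smul, smoothFn.add_apply, smoothFn.smul_apply,
      Pi.zero_apply] at e e'
    have : 2 * (γ * x₁.1 t₀) = 0 := by
      linear_combination x₁.1 t₀ * e' - (dt x₁).1 t₀ * e - (2 * γ) * hs.rel12 t₀
    simpa [h1] using this
  subst hγ
  have hβ : β = 0 := by
    simpa [h1] using s1.self_of_nhds
  subst hβ
  have hα : α = 0 := by
    simpa [h1] using h0.self_of_nhds
  subst hα
  simp

/-- The straightening transformation carries `L` to its normal form. -/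
theorem transf_carries [FiniteDimensional ℝ L] {t₀ : ℝ} (ht₀ : t₀ ∈ J) {k₁ k₂ Y₁ Y₂ : SymField}
    (hk₁ : k₁ ∈ L) (hk₂ : k₂ ∈ L)
    (hK : ∀ X ∈ L, X.tau = 0 → ∃ α β : ℝ, X = α • k₁ + β • k₂) (hY₁ : Y₁.tau = 0)
    (hY₂ : Y₂.tau = 0) (h₁ : (hfr.transf J hJ hJc hpos P hP).Related k₁ Y₁)
    (h₂ : (hfr.transf J hJ hJc hpos P hP).Related k₂ Y₂) :
    (hfr.transf J hJ hJc hpos P hP).Carries L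
      (Submodule.span ℝ {sl2X1, sl2X2, sl2X3} ⊔ Submodule.span ℝ {Y₁, Y₂})
      (Submodule.span ℝ {Y₁, Y₂}) := by
  have hx0 := (hpos t₀ ht₀).ne'
  have hne : x₁ ≠ 0 := by
    rintro rfl
    exact hx0 rfl
  have r₁ := transf_related₁ hfr (hJ := hJ) (hJc := hJc) (hpos := hpos) (hP := hP)
  have r₂ := transf_related₂ hfr (hJ := hJ) (hJc := hJc) (hpos := hpos) (hP := hP)
  have r₃ := transf_related₃ hfr (hJ := hJ) (hJc := hJc) (hpos := hpos) (hP := hP)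
  have rt : ∀ {X Y : SymField}, (hfr.transf J hJ hJc hpos P hP).Related X Y → Y.tau = 0 →
      X.tau.1 =ᶠ[nhds t₀] 0 := by
    intro X Y hXY hY
    filter_upwards [hJ.mem_nhds ht₀] with t ht
    have e := ((transf_related_iff hfr).1 hXY).1 t ht
    rw [hY, eq_comm, smoothFn.zero_apply, div_eq_zero_iff] at e
    exact e.resolve_right (hpos t ht).ne'
  generalize hfr.transf J hJ hJc hpos P hP = T at *
  have comb : ∀ α β γ δ ε : ℝ, T.Related ((α • X₁ + β • X₂ + γ • X₃) + (δ • k₁ + ε • k₂))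
      ((α • sl2X1 + β • sl2X2 + γ • sl2X3) + (δ • Y₁ + ε • Y₂)) := fun α β γ δ ε =>
    (((r₁.smul α).add (r₂.smul β)).add (r₃.smul γ)).add ((h₁.smul δ).add (h₂.smul ε))
  refine ⟨fun X hX => ?_, fun Y hY => ?_, fun X => ?_⟩
  · obtain ⟨α, β, γ, e⟩ := Submodule.mem_span_triple.1 (hfr.span X hX)
    have hX' : X - (α • X₁ + β • X₂ + γ • X₃) ∈ L :=
      L.sub_mem hX (L.add_mem (L.add_mem (L.smul_mem _ hfr.mem₁) (L.smul_mem _ hfr.mem₂))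
        (L.smul_mem _ hfr.mem₃))
    obtain ⟨δ, ε, e'⟩ := hK _ hX' (by simp [← e, hfr.tau₁, hfr.tau₂, hfr.tau₃])
    rw [sub_eq_iff_eq_add'] at e'
    refine ⟨(α • sl2X1 + β • sl2X2 + γ • sl2X3) + (δ • Y₁ + ε • Y₂),
      Submodule.add_mem_sup (Submodule.mem_span_triple.2 ⟨α, β, γ, rfl⟩)
        (Submodule.mem_span_pair.2 ⟨δ, ε, rfl⟩), ?_⟩
    rw [e']
    exact comb α β γ δ ε
  · obtain ⟨Y', hY', Z, hZ, rfl⟩ := Submodule.mem_sup.1 hY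
    obtain ⟨α, β, γ, rfl⟩ := Submodule.mem_span_triple.1 hY'
    obtain ⟨δ, ε, rfl⟩ := Submodule.mem_span_pair.1 hZ
    refine ⟨(α • X₁ + β • X₂ + γ • X₃) + (δ • k₁ + ε • k₂), ?_, comb α β γ δ ε⟩
    exact L.add_mem (L.add_mem (L.add_mem (L.smul_mem _ hfr.mem₁) (L.smul_mem _ hfr.mem₂))
        (L.smul_mem _ hfr.mem₃)) (L.add_mem (L.smul_mem _ hk₁) (L.smul_mem _ hk₂))
  · rw [mem_radical_iff L hfr.isSl2 hne ⟨X₁, hfr.mem₁, hfr.tau₁⟩ ⟨X₂, hfr.mem₂, hfr.tau₂⟩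
      ⟨X₃, hfr.mem₃, hfr.tau₃⟩ hfr.span]
    constructor
    · intro h
      obtain ⟨δ, ε, e⟩ := hK _ X.2 h
      exact ⟨δ • Y₁ + ε • Y₂, Submodule.mem_span_pair.2 ⟨δ, ε, rfl⟩,
        e ▸ (h₁.smul δ).add (h₂.smul ε)⟩
    · rintro ⟨Y, hY, hXY⟩
      obtain ⟨δ, ε, rfl⟩ := Submodule.mem_span_pair.1 hY
      -- The transformation sees times in `J` only, so `τ` is known to vanish near `t₀`; membership
      -- in the span of `sl(2, ℝ)` functions extends this to all times.
      exact hfr.isSl2.eq_zero_of_eventuallyEq_zero hx0 (hfr.span _ X.2)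
        (rt hXY (by simp [hY₁, hY₂]))

/-! ### Differential equations for the transformed interaction -/

@[simp] theorem site_zero (x : Site) : site x 0 = x := by
  simp [site, offset]

/-- If `k` commutes with the frame, its `λ` is removed by the transformation. -/
theorem IsFrame.lam_of_central (hfr : IsFrame L x₁ x₂ x₃ X₁ X₂ X₃) {k : SymField}
    (hk : k.tau = 0) (h1 : ⁅X₁, k⁆ = 0) (h2 : ⁅X₂, k⁆ = 0) (x : Site) {t : ℝ}
    (ht : x₁.1 t ≠ 0) : (k.lam x).1 t = -k.a x * shiftQ X₁ X₂ x t := by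
  have e1 := congrArg (fun Y : SymField => (Y.lam x).1 t) h1
  have e2 := congrArg (fun Y : SymField => (Y.lam x).1 t) h2
  simp only [SymField.lam_lie, hk, SymField.lam_zero, smoothFn.sub_apply, smoothFn.add_apply,
    smoothFn.mul_apply, SymField.b_apply, map_zero, smoothFn.zero_apply, hfr.tau₁, hfr.tau₂,
    hfr.a₁, hfr.a₂] at e1 e2
  have r := hfr.isSl2.rel12 t
  rw [shiftQ, newTime, hfr.tau₁, hfr.tau₂]
  field_simp
  linear_combination (2 * x₂.1 t) * e1 - (2 * x₁.1 t) * e2 - (k.lam x).1 t * r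

theorem IsFrame.dt_dt_lam_of_central (hfr : IsFrame L x₁ x₂ x₃ X₁ X₂ X₃) {k : SymField}
    (hk : k.tau = 0) (h1 : ⁅X₁, k⁆ = 0) (h2 : ⁅X₂, k⁆ = 0) (x : Site) {t : ℝ}
    (ht : x₁.1 t ≠ 0) : (dt (dt (k.lam x))).1 t = -k.a x * shiftQ2 X₁ X₂ x t := by
  have hev : ∀ s, x₁.1 s ≠ 0 → ∀ᶠ r in nhds s, x₁.1 r ≠ 0 := fun s hs =>
    (smoothFn.continuous x₁).continuousAt.eventually_ne hs
  have d1 : ∀ s, x₁.1 s ≠ 0 → (dt (k.lam x)).1 s = -k.a x * shiftQ1 X₁ X₂ x s := fun s hs =>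
    ((smoothFn.hasDerivAt (k.lam x) s).congr_of_eventuallyEq ((hev s hs).mono fun r hr =>
      (hfr.lam_of_central hk h1 h2 x hr).symm)).unique
        ((hfr.hasDerivAt_shiftQ x hs).const_mul (-k.a x))
  exact ((smoothFn.hasDerivAt (dt (k.lam x)) t).congr_of_eventuallyEq ((hev t ht).mono fun r hr =>
      (d1 r hr).symm)).unique ((hfr.hasDerivAt_shiftQ1 x ht).const_mul (-k.a x))

theorem transf_related_scaleField {k : SymField} (hk : k.tau = 0) (h1 : ⁅X₁, k⁆ = 0)
    (h2 : ⁅X₂, k⁆ = 0) : (hfr.transf J hJ hJc hpos P hP).Related k (scaleField k.a) := by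
  rw [transf_related_iff]
  refine ⟨fun t ht => ?_, fun x => rfl, fun x t ht => ?_⟩
  · simp [hk, scaleField]
  · simp [hk, scaleField, hfr.lam_of_central hk h1 h2 x (hpos t ht).ne']

variable {F : Interaction} {Ω : Domain}

theorem IsNonlinearCoupled.contDiffAt (hF : IsNonlinearCoupled F Ω) {x : Site} {t : ℝ}
    {w : Fin 7 → ℝ} (hw : (t, w) ∈ Ω x) :
    ContDiffAt ℝ ∞ (fun p : ℝ × (Fin 7 → ℝ) => F x p.1 p.2) (t, w) :=
  (hF.smooth x).contDiffAt ((hF.isOpen x).mem_nhds hw)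

theorem IsNonlinearCoupled.contDiffAt_right (hF : IsNonlinearCoupled F Ω) {x : Site} {t : ℝ}
    {w : Fin 7 → ℝ} (hw : (t, w) ∈ Ω x) : ContDiffAt ℝ ∞ (F x t) w :=
  (hF.contDiffAt hw).comp (f := fun v : Fin 7 → ℝ => (t, v)) w (contDiffAt_const.prodMk contDiffAt_id)

theorem transf_old_eq (x : Site) {t : ℝ} (ht : t ∈ J) :
    (hfr.transf J hJ hJc hpos P hP).old x t = fun w i =>
      √(x₁.1 t) * P (site x i) * w i + shiftQ X₁ X₂ (site x i) t :=
  funext fun w => funext fun i => transf_old hfr x ht w i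

theorem transf_contDiffAt_newF (hF : IsNonlinearCoupled F Ω) (x : Site) {t : ℝ} (ht : t ∈ J)
    {w : Fin 7 → ℝ} (hw : (t, (hfr.transf J hJ hJc hpos P hP).old x t w) ∈ Ω x) :
    ContDiffAt ℝ ∞ ((hfr.transf J hJ hJc hpos P hP).newF F x t) w := by
  have e : (hfr.transf J hJ hJc hpos P hP).newF F x t = _ :=
    funext fun w => transf_newF hfr F x ht w
  rw [e]
  have h1 : ContDiffAt ℝ ∞ ((hfr.transf J hJ hJc hpos P hP).old x t) w := by
    rw [transf_old_eq hfr x ht]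
    fun_prop
  have h2 : ContDiffAt ℝ ∞ (fun w => F x t ((hfr.transf J hJ hJc hpos P hP).old x t w)) w :=
    (hF.contDiffAt_right hw).comp w h1
  have h3 : ContDiffAt ℝ ∞ (fun w : Fin 7 → ℝ => w 0) w := contDiffAt_apply ℝ ℝ (0 : Fin 7) w
  exact (contDiffAt_const.mul (h2.sub contDiffAt_const)).add (contDiffAt_const.mul h3)

theorem transf_fderiv_newF (hF : IsNonlinearCoupled F Ω) (x : Site) {t : ℝ} (ht : t ∈ J)
    {w : Fin 7 → ℝ} (hw : (t, (hfr.transf J hJ hJc hpos P hP).old x t w) ∈ Ω x)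
    (v : Fin 7 → ℝ) :
    fderiv ℝ ((hfr.transf J hJ hJc hpos P hP).newF F x t) w v
      = √(x₁.1 t) ^ 3 * (P x)⁻¹ * (∑ i, (√(x₁.1 t) * P (site x i) * v i)
          * partialU (F x t) i ((hfr.transf J hJ hJc hpos P hP).old x t w))
        + schwarzian x₁ t * v 0 := by
  have hFd : DifferentiableAt ℝ (F x t) ((hfr.transf J hJ hJc hpos P hP).old x t w) :=
    (hF.contDiffAt_right hw).differentiableAt (by simp)
  have hGd : DifferentiableAt ℝ ((hfr.transf J hJ hJc hpos P hP).newF F x t) w :=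
    (transf_contDiffAt_newF hfr hF x ht hw).differentiableAt (by simp)
  have hl : HasDerivAt (fun s : ℝ => w + s • v) v 0 := by
    simpa using ((hasDerivAt_id (0 : ℝ)).smul_const v).const_add w
  have h0 : w + (0 : ℝ) • v = w := by simp
  have hG : HasDerivAt (fun s : ℝ => (hfr.transf J hJ hJc hpos P hP).newF F x t (w + s • v))
      (fderiv ℝ ((hfr.transf J hJ hJc hpos P hP).newF F x t) w v) 0 :=
    HasFDerivAt.comp_hasDerivAt (l := (hfr.transf J hJ hJc hpos P hP).newF F x t) (0 : ℝ)
      (by rw [h0]; exact hGd.hasFDerivAt) hl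
  have ho : HasDerivAt (fun s : ℝ => (hfr.transf J hJ hJc hpos P hP).old x t (w + s • v))
      (fun i => √(x₁.1 t) * P (site x i) * v i) 0 := by
    rw [hasDerivAt_pi]
    intro i
    simp only [transf_old hfr x ht]
    exact ((hasDerivAt_pi.1 hl i).const_mul _).add_const _
  have hFo : HasDerivAt (fun s : ℝ => F x t ((hfr.transf J hJ hJc hpos P hP).old x t (w + s • v)))
      (fderiv ℝ (F x t) ((hfr.transf J hJ hJc hpos P hP).old x t w)
        (fun i => √(x₁.1 t) * P (site x i) * v i)) 0 :=
    HasFDerivAt.comp_hasDerivAt (l := F x t) (0 : ℝ) (by rw [h0]; exact hFd.hasFDerivAt) ho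
  refine hG.unique ?_
  simp only [transf_newF hfr F x ht]
  rw [sum_mul_partialU hFd]
  exact ((hFo.sub_const _).const_mul _).add ((hasDerivAt_pi.1 hl 0).const_mul _)

end Straightening

section Straightening

variable {L : LieSubalgebra ℝ SymField} {x₁ x₂ x₃ : smoothFn} {X₁ X₂ X₃ : SymField}
  (hfr : IsFrame L x₁ x₂ x₃ X₁ X₂ X₃) {J : Set ℝ} {hJ : IsOpen J} {hJc : IsPreconnected J}
  {hpos : ∀ t ∈ J, 0 < x₁.1 t} {P : Site → ℝ} {hP : ∀ x, P x ≠ 0}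
  {F : Interaction} {Ω : Domain}

/-- The chain rule for an interaction along a curve. -/
theorem IsNonlinearCoupled.hasDerivAt_comp (hF : IsNonlinearCoupled F Ω) {x : Site} {t : ℝ}
    {W : ℝ → Fin 7 → ℝ} {W' : Fin 7 → ℝ} (hw : (t, W t) ∈ Ω x) (hW : HasDerivAt W W' t) :
    HasDerivAt (fun s => F x s (W s))
      (deriv (fun s => F x s (W t)) t + ∑ i, W' i * partialU (F x t) i (W t)) t := by
  have hd := ((hF.contDiffAt hw).differentiableAt (by simp)).hasFDerivAt
  have hd2 : DifferentiableAt ℝ (F x t) (W t) :=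
    (hF.contDiffAt_right hw).differentiableAt (by simp)
  have c1 : HasDerivAt (fun s : ℝ => (s, W t)) ((1 : ℝ), (0 : Fin 7 → ℝ)) t :=
    (hasDerivAt_id t).prodMk (hasDerivAt_const t (W t))
  have c3 : HasDerivAt (fun s : ℝ => (s, W s)) ((1 : ℝ), W') t := (hasDerivAt_id t).prodMk hW
  have e1 := (HasFDerivAt.comp_hasDerivAt (l := fun p : ℝ × (Fin 7 → ℝ) => F x p.1 p.2)
    t hd c1).deriv
  have c2 : HasFDerivAt (fun v : Fin 7 → ℝ => (t, v))
      (ContinuousLinearMap.inr ℝ ℝ (Fin 7 → ℝ)) (W t) := hasFDerivAt_prodMk_right t (W t)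
  have e2 : HasFDerivAt (F x t) _ (W t) :=
    HasFDerivAt.comp (g := fun p : ℝ × (Fin 7 → ℝ) => F x p.1 p.2) (W t) hd c2
  refine (HasFDerivAt.comp_hasDerivAt (l := fun p : ℝ × (Fin 7 → ℝ) => F x p.1 p.2)
    t hd c3).congr_deriv ?_
  rw [sum_mul_partialU hd2, e2.fderiv]
  change _ = deriv ((fun p : ℝ × (Fin 7 → ℝ) => F x p.1 p.2) ∘ fun s => (s, W t)) t + _
  rw [e1, ContinuousLinearMap.comp_apply, ContinuousLinearMap.inr_apply, ← map_add]
  simp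

/-- The transformed interaction does not depend on time. -/
theorem transf_hasDerivAt_newF (hF : IsNonlinearCoupled F Ω) (hX : X₁.IsSymmetry F Ω) (x : Site)
    {t : ℝ} (ht : t ∈ J) {w : Fin 7 → ℝ}
    (hw : (t, (hfr.transf J hJ hJc hpos P hP).old x t w) ∈ Ω x) :
    HasDerivAt (fun s => (hfr.transf J hJ hJc hpos P hP).newF F x s w) 0 t := by
  have hev : ∀ᶠ s in nhds t, s ∈ J := hJ.mem_nhds ht
  have hx := hpos t ht
  have hold := fun s (hs : s ∈ J) i => transf_old hfr (hJ := hJ) (hJc := hJc) (hpos := hpos)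
    (hP := hP) x hs w i
  have hnew := fun s (hs : s ∈ J) => transf_newF hfr (hJ := hJ) (hJc := hJc) (hpos := hpos)
    (hP := hP) F x hs w
  generalize hfr.transf J hJ hJc hpos P hP = T at *
  have hr : HasDerivAt (fun s => √(x₁.1 s)) ((dt x₁).1 t / (2 * √(x₁.1 t))) t :=
    (smoothFn.hasDerivAt x₁ t).sqrt hx.ne'
  -- For fixed new values the old values follow the flow of `X₁ / x₁`. The determining equation of
  -- `X₁` then controls the change of `F` along this curve.
  have hW : HasDerivAt (fun s => T.old x s w) (fun i =>
      ((dt x₁).1 t / 2 * T.old x t w i + (X₁.lam (site x i)).1 t) / x₁.1 t) t := by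
    rw [hasDerivAt_pi]
    intro i
    have h1 := ((hr.mul_const (P (site x i))).mul_const (w i)).add
      (hfr.hasDerivAt_shiftQ (site x i) hx.ne')
    refine (h1.congr_of_eventuallyEq (hev.mono fun s hs => hold s hs i)).congr_deriv ?_
    rw [hold t ht i, shiftQ1, hfr.tau₁]
    have hs : √(x₁.1 t) ≠ 0 := (Real.sqrt_pos.2 hx).ne'
    have hs2 := Real.sq_sqrt hx.le
    field_simp
    linear_combination (-(dt x₁).1 t * P (site x i) * w i) * hs2
  have hFW := hF.hasDerivAt_comp (x := x) (W := fun s => T.old x s w) hw hW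
  have hdet := (SymField.isSymmetry_iff X₁ F Ω).1 hX x _ hw
  simp only [SymField.DetEq, hfr.tau₁, hfr.a₁, add_zero, zero_sub] at hdet
  have hsum : ∑ i, ((dt x₁).1 t / 2 * T.old x t w i + (X₁.lam (site x i)).1 t) / x₁.1 t *
        partialU (F x t) i (T.old x t w) = (∑ i, ((dt x₁).1 t / 2 * T.old x t w i
          + (X₁.lam (site x i)).1 t) * partialU (F x t) i (T.old x t w)) / x₁.1 t := by
    rw [Finset.sum_div]
    exact Finset.sum_congr rfl fun i _ => by ring
  have hS : HasDerivAt (schwarzian x₁) (-(1 / 2) * (x₁.1 t * (dt (dt (dt x₁))).1 t)) t := by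
    refine ((((smoothFn.hasDerivAt (dt x₁) t).pow 2).const_mul (1 / 4)).sub
      (((smoothFn.hasDerivAt x₁ t).mul (smoothFn.hasDerivAt (dt (dt x₁)) t)).const_mul
        (1 / 2))).congr_deriv ?_
    norm_num
    ring
  have hG := ((((hr.pow 3).mul_const (P x)⁻¹).mul
    (hFW.sub (hfr.hasDerivAt_shiftQ2 x hx.ne'))).add (hS.mul_const (w 0)))
  refine (hG.congr_of_eventuallyEq (hev.mono fun s hs => hnew s hs)).congr_deriv ?_
  simp only [Pi.pow_apply, Pi.sub_apply]
  rw [hsum, shiftQ3, hfr.tau₁]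
  have h0 := hold t ht 0
  rw [site_zero] at h0
  generalize (∑ i, ((dt x₁).1 t / 2 * T.old x t w i
          + (X₁.lam (site x i)).1 t) * partialU (F x t) i (T.old x t w)) = S at *
  rw [h0] at hdet
  have hs : √(x₁.1 t) ≠ 0 := (Real.sqrt_pos.2 hx).ne'
  have hs2 := Real.sq_sqrt hx.le
  have hPx := hP x
  have hS' : S = (dt (dt (dt x₁))).1 t / 2 * (√(x₁.1 t) * P x * w 0 + shiftQ X₁ X₂ x t)
      + (dt (dt (X₁.lam x))).1 t + -(3 / 2 * (dt x₁).1 t) * F x t (T.old x t w)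
      - x₁.1 t * deriv (fun s => F x s (T.old x t w)) t := by linear_combination -hdet
  rw [hS']
  generalize √(x₁.1 t) = r at *
  generalize F x t (T.old x t w) = Φ at *
  generalize deriv (fun s => F x s (T.old x t w)) t = Ft at *
  rw [← hs2]
  field_simp
  ring

/-- The transformed interaction is homogeneous of degree `-3`. -/
theorem transf_fderiv_newF_self (hF : IsNonlinearCoupled F Ω) (hX₁ : X₁.IsSymmetry F Ω)
    (hX₂ : X₂.IsSymmetry F Ω) (x : Site) {t : ℝ} (ht : t ∈ J) {w : Fin 7 → ℝ}
    (hw : (t, (hfr.transf J hJ hJc hpos P hP).old x t w) ∈ Ω x) :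
    fderiv ℝ ((hfr.transf J hJ hJc hpos P hP).newF F x t) w w
      = -3 * (hfr.transf J hJ hJc hpos P hP).newF F x t w := by
  rw [transf_fderiv_newF hfr hF x ht hw, transf_newF hfr F x ht w]
  have hold := fun i => transf_old hfr (hJ := hJ) (hJc := hJc) (hpos := hpos)
    (hP := hP) x ht w i
  generalize hfr.transf J hJ hJc hpos P hP = T at *
  have hx := hpos t ht
  have d1 := (SymField.isSymmetry_iff X₁ F Ω).1 hX₁ x _ hw
  have d2 := (SymField.isSymmetry_iff X₂ F Ω).1 hX₂ x _ hw
  simp only [SymField.DetEq, hfr.tau₁, hfr.tau₂, hfr.a₁, hfr.a₂, add_zero, zero_sub] at d1 d2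
  -- The combination `x₁ X₂ - x₂ X₁`, with coefficients taken at time `t`, has no `∂_t` component
  -- there; in the new variables it is `x₁ / 2` times the scaling field.
  have hsum : x₁.1 t * ∑ i, √(x₁.1 t) * P (site x i) * w i * partialU (F x t) i (T.old x t w)
      = 2 * (x₁.1 t * (∑ i, ((dt x₂).1 t / 2 * T.old x t w i
          + (X₂.lam (site x i)).1 t) * partialU (F x t) i (T.old x t w))
        - x₂.1 t * (∑ i, ((dt x₁).1 t / 2 * T.old x t w i
          + (X₁.lam (site x i)).1 t) * partialU (F x t) i (T.old x t w))) := by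
    rw [Finset.mul_sum, Finset.mul_sum, Finset.mul_sum, ← Finset.sum_sub_distrib, Finset.mul_sum]
    refine Finset.sum_congr rfl fun i _ => ?_
    have e : x₁.1 t * (√(x₁.1 t) * P (site x i) * w i) = x₁.1 t * T.old x t w i
        - 2 * (x₂.1 t * (X₁.lam (site x i)).1 t - x₁.1 t * (X₂.lam (site x i)).1 t) := by
      rw [hold i, shiftQ, newTime, hfr.tau₁, hfr.tau₂]
      field_simp
      ring
    have r := hfr.isSl2.rel12 t
    linear_combination partialU (F x t) i (T.old x t w) * e
      - partialU (F x t) i (T.old x t w) * T.old x t w i * r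
  have h0 := hold 0
  rw [site_zero] at h0
  generalize (∑ i, ((dt x₁).1 t / 2 * T.old x t w i
          + (X₁.lam (site x i)).1 t) * partialU (F x t) i (T.old x t w)) = S₁ at *
  generalize (∑ i, ((dt x₂).1 t / 2 * T.old x t w i
          + (X₂.lam (site x i)).1 t) * partialU (F x t) i (T.old x t w)) = S₂ at *
  generalize (∑ i, √(x₁.1 t) * P (site x i) * w i * partialU (F x t) i (T.old x t w)) = S at *
  have r := hfr.isSl2.rel12 t
  have r' := hfr.isSl2.rel12' t
  have r'' := hfr.isSl2.rel12'' t
  have l := hfr.lam_rel12 x t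
  have l' := hfr.lam_rel12' x t
  have hs : √(x₁.1 t) ≠ 0 := (Real.sqrt_pos.2 hx).ne'
  have hs2 := Real.sq_sqrt hx.le
  have hPx := hP x
  have hS : S = 2 * (x₁.1 t * ((dt (dt (dt x₂))).1 t / 2 * T.old x t w 0
      + (dt (dt (X₂.lam x))).1 t + -(3 / 2 * (dt x₂).1 t) * F x t (T.old x t w))
      - x₂.1 t * ((dt (dt (dt x₁))).1 t / 2 * T.old x t w 0
      + (dt (dt (X₁.lam x))).1 t + -(3 / 2 * (dt x₁).1 t) * F x t (T.old x t w))) / x₁.1 t := by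
    rw [eq_div_iff hx.ne']
    linear_combination hsum + (-2 * x₁.1 t) * d2 + 2 * x₂.1 t * d1
  have hx2 : (dt x₂).1 t = 1 + x₂.1 t * (dt x₁).1 t / x₁.1 t := by
    field_simp
    linear_combination r
  have hx22 : (dt (dt x₂)).1 t = ((dt x₁).1 t + x₂.1 t * (dt (dt x₁)).1 t) / x₁.1 t := by
    field_simp
    linear_combination r'
  have hx222 : (dt (dt (dt x₂))).1 t = ((dt (dt x₁)).1 t - (dt x₁).1 t * (dt (dt x₂)).1 t
      + (dt x₂).1 t * (dt (dt x₁)).1 t + x₂.1 t * (dt (dt (dt x₁))).1 t) / x₁.1 t := by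
    field_simp
    linear_combination r''
  have hl2 : (dt (X₂.lam x)).1 t = ((X₁.lam x).1 t - (X₁.lam x).1 t * ((dt x₂).1 t / 2)
      + x₂.1 t * (dt (X₁.lam x)).1 t + (X₂.lam x).1 t * ((dt x₁).1 t / 2)) / x₁.1 t := by
    field_simp
    linear_combination 2 * l
  have hl22 : (dt (dt (X₂.lam x))).1 t = ((dt (X₁.lam x)).1 t
      - (dt x₁).1 t * (dt (X₂.lam x)).1 t - (dt (X₁.lam x)).1 t * ((dt x₂).1 t / 2)
      - (X₁.lam x).1 t * ((dt (dt x₂)).1 t / 2) + (dt x₂).1 t * (dt (X₁.lam x)).1 t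
      + x₂.1 t * (dt (dt (X₁.lam x))).1 t + (dt (X₂.lam x)).1 t * ((dt x₁).1 t / 2)
      + (X₂.lam x).1 t * ((dt (dt x₁)).1 t / 2)) / x₁.1 t := by
    field_simp
    linear_combination 2 * l'
  rw [hS, h0, hl22, hx222, hl2, hx22, hx2, schwarzian, shiftQ2, shiftQ1, shiftQ, newTime,
    hfr.tau₁, hfr.tau₂]
  clear d1 d2 hS hsum h0 hold r r' r'' l l' hx2 hx22 hx222 hl2 hl22
  generalize √(x₁.1 t) = ρ at *
  generalize F x t (T.old x t w) = Φ at *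
  rw [← hs2]
  field_simp
  ring

/-- The transformed interaction under a scaling. -/
theorem transf_fderiv_newF_scale (hF : IsNonlinearCoupled F Ω) {k : SymField}
    (hk : k.tau = 0) (h1 : ⁅X₁, k⁆ = 0) (h2 : ⁅X₂, k⁆ = 0) (hks : k.IsSymmetry F Ω)
    (x : Site) {t : ℝ} (ht : t ∈ J) {w : Fin 7 → ℝ}
    (hw : (t, (hfr.transf J hJ hJc hpos P hP).old x t w) ∈ Ω x) :
    fderiv ℝ ((hfr.transf J hJ hJc hpos P hP).newF F x t) w (fun i => k.a (site x i) * w i)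
      = k.a x * (hfr.transf J hJ hJc hpos P hP).newF F x t w := by
  rw [transf_fderiv_newF hfr hF x ht hw, transf_newF hfr F x ht w]
  have hold := fun i => transf_old hfr (hJ := hJ) (hJc := hJc) (hpos := hpos)
    (hP := hP) x ht w i
  generalize hfr.transf J hJ hJc hpos P hP = T at *
  have hx := (hpos t ht).ne'
  have d := (SymField.isSymmetry_iff k F Ω).1 hks x _ hw
  simp only [SymField.DetEq, hk, map_zero, smoothFn.zero_apply, zero_div, zero_add, zero_mul,
    mul_zero, sub_zero, hfr.dt_dt_lam_of_central hk h1 h2 x hx] at d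
  have hsum : ∑ i, √(x₁.1 t) * P (site x i) * (k.a (site x i) * w i)
      * partialU (F x t) i (T.old x t w) = ∑ i, (k.a (site x i) * T.old x t w i
        + (k.lam (site x i)).1 t) * partialU (F x t) i (T.old x t w) := by
    refine Finset.sum_congr rfl fun i _ => ?_
    rw [hold i, hfr.lam_of_central hk h1 h2 _ hx]
    ring
  rw [hsum, site_zero]
  linear_combination -(√(x₁.1 t) ^ 3 * (P x)⁻¹) * d

/-- The transformed interaction under a translation. -/
theorem transf_fderiv_newF_shift (hF : IsNonlinearCoupled F Ω) {v : SymField}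
    (hv : v.tau = 0) (hva : ∀ x, v.a x = 0) (h1 : ⁅X₁, v⁆ = 0)
    (hP' : ∀ x, ∀ t ∈ J, (v.lam x).1 t = P x * √(x₁.1 t)) (hvs : v.IsSymmetry F Ω)
    (x : Site) {t : ℝ} (ht : t ∈ J) {w : Fin 7 → ℝ}
    (hw : (t, (hfr.transf J hJ hJc hpos P hP).old x t w) ∈ Ω x) :
    fderiv ℝ ((hfr.transf J hJ hJc hpos P hP).newF F x t) w (fun _ => 1) = 0 := by
  rw [transf_fderiv_newF hfr hF x ht hw]
  generalize hfr.transf J hJ hJc hpos P hP = T at *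
  have hx := hpos t ht
  have d := (SymField.isSymmetry_iff v F Ω).1 hvs x _ hw
  have e0 : x₁ * dt (v.lam x) - (1 / 2 : ℝ) • (dt x₁ * v.lam x) = 0 := by
    rw [← hfr.tau₁, ← lam_lie_of_translation hfr.a₁ ⟨hv, hva⟩, h1]
    rfl
  have e1 := congrArg (fun f : smoothFn => f.1 t) e0
  have e2 := congrArg (fun f : smoothFn => (dt f).1 t) e0
  simp only [map_sub, Derivation.leibniz, Derivation.map_smul, smul_eq_mul, map_zero,
    smoothFn.sub_apply, smoothFn.add_apply, smoothFn.mul_apply, smoothFn.smul_apply,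
    smoothFn.zero_apply, hP' x t ht] at e1 e2
  simp only [SymField.DetEq, hv, hva, map_zero, smoothFn.zero_apply, zero_div, zero_add, zero_mul,
    mul_zero, sub_zero, add_zero] at d
  have hsum : ∑ i, √(x₁.1 t) * P (site x i) * 1 * partialU (F x t) i (T.old x t w)
      = ∑ i, (v.lam (site x i)).1 t * partialU (F x t) i (T.old x t w) := by
    refine Finset.sum_congr rfl fun i _ => ?_
    rw [hP' _ t ht]
    ring
  rw [hsum]
  have hs : √(x₁.1 t) ≠ 0 := (Real.sqrt_pos.2 hx).ne'
  have hs2 := Real.sq_sqrt hx.le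
  have hPx := hP x
  have d' : (dt (v.lam x)).1 t = (dt x₁).1 t * (P x * √(x₁.1 t)) / (2 * x₁.1 t) := by
    field_simp
    linear_combination 2 * e1
  have d'' : (dt (dt (v.lam x))).1 t = ((dt (dt x₁)).1 t * (P x * √(x₁.1 t)) / 2
      - (dt x₁).1 t / 2 * (dt (v.lam x)).1 t) / x₁.1 t := by
    field_simp
    linear_combination 2 * e2
  rw [← sub_eq_zero.1 d, d'', d', schwarzian]
  generalize √(x₁.1 t) = ρ at *
  rw [← hs2]
  field_simp
  ring

end Straightening

/-! ### Functions of the invariants -/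

/-- A function that is constant on the fibres of a map with smooth local sections is a smooth
function of the values of this map. -/
theorem exists_contDiffOn_factor {m : ℕ} {S : Set (Fin 7 → ℝ)} {xi : (Fin 7 → ℝ) → Fin m → ℝ}
    {h : (Fin 7 → ℝ) → ℝ} (hS : IsOpen S) (hh : ContDiffOn ℝ ∞ h S)
    (hfib : ∀ w ∈ S, ∀ w' ∈ S, xi w = xi w' → h w = h w')
    (hsec : ∀ w ∈ S, ∃ σ : (Fin m → ℝ) → Fin 7 → ℝ, ContDiffAt ℝ ∞ σ (xi w) ∧ σ (xi w) = w ∧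
      ∀ᶠ ξ in nhds (xi w), xi (σ ξ) = ξ) :
    ∃ f : (Fin m → ℝ) → ℝ, ContDiffOn ℝ ∞ f (xi '' S) ∧ ∀ w ∈ S, h w = f (xi w) := by
  classical
  have hf : ∀ w ∈ S, h w = h (Function.invFunOn xi S (xi w)) := fun w hw =>
    hfib w hw _ (Function.invFunOn_mem ⟨w, hw, rfl⟩) (Function.invFunOn_eq ⟨w, hw, rfl⟩).symm
  -- An arbitrary section defines `f`. Near a value it agrees with `h` along a smooth local section,
  -- because `h` is constant on fibres; this gives smoothness.
  refine ⟨fun ξ => h (Function.invFunOn xi S ξ), ?_, hf⟩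
  rintro _ ⟨w, hw, rfl⟩
  obtain ⟨σ, hσ, hσw, hσξ⟩ := hsec w hw
  have hmem : ∀ᶠ ξ in nhds (xi w), σ ξ ∈ S :=
    hσ.continuousAt.eventually_mem (by rw [hσw]; exact hS.mem_nhds hw)
  have hcomp : ContDiffAt ℝ ∞ (fun ξ => h (σ ξ)) (xi w) := by
    refine ContDiffAt.comp (g := h) (xi w) ?_ hσ
    rw [hσw]
    exact hh.contDiffAt (hS.mem_nhds hw)
  refine (hcomp.congr_of_eventuallyEq ?_).contDiffWithinAt
  filter_upwards [hmem, hσξ] with ξ h1 h2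
  have := hf (σ ξ) h1
  rw [h2] at this
  exact this.symm

theorem isOpen_box {B : Fin 7 → Set ℝ} (hB : ∀ i, IsOpen (B i)) : IsOpen (box B) := by
  have : box B = Set.univ.pi B := by
    ext w
    simp [box]
  rw [this]
  exact isOpen_set_pi Set.finite_univ fun i _ => hB i

/-- A function on an interval with vanishing derivative takes the same values at the ends. -/
theorem eq_of_hasDerivAt_zero {f : ℝ → ℝ} (hf : ∀ s ∈ Set.Icc (0 : ℝ) 1, HasDerivAt f 0 s) :
    f 1 = f 0 :=
  constant_of_has_deriv_right_zero (fun s hs => (hf s hs).continuousAt.continuousWithinAt)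
    (fun s hs => (hf s ⟨hs.1, hs.2.le⟩).hasDerivWithinAt) 1 ⟨zero_le_one, le_rfl⟩

/-- The product of `g` with `(w 0 - w 1) ^ 3` is annihilated by the scaling and the translation
field. Points with equal invariants are related by an affine map applied to all coordinates. The
segment between them stays in the convex box, and its tangent is a combination of the two fields, so
the product is constant along it. -/
theorem exists_intNS52 {B : Fin 7 → Set ℝ} (hBo : ∀ i, IsOpen (B i))
    (hBc : ∀ i, IsPreconnected (B i)) (hdisj : Disjoint (B 0) (B 1)) {g : (Fin 7 → ℝ) → ℝ}
    (hg : ContDiffOn ℝ ∞ g (box B)) (h3 : ∀ w ∈ box B, fderiv ℝ g w w = -3 * g w)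
    (h1 : ∀ w ∈ box B, fderiv ℝ g w (fun _ => 1) = 0) :
    ∃ f : (Fin 5 → ℝ) → ℝ, ContDiffOn ℝ ∞ f (xiNS52 '' box B) ∧
      ∀ w ∈ box B, g w = intNS52 f w := by
  have hne : ∀ w ∈ box B, w 0 - w 1 ≠ 0 := fun w hw =>
    sub_ne_zero.2 fun e => Set.disjoint_left.1 hdisj (hw 0) (e ▸ hw 1)
  suffices hs : ∃ f : (Fin 5 → ℝ) → ℝ, ContDiffOn ℝ ∞ f (xiNS52 '' box B) ∧
      ∀ w ∈ box B, (w 0 - w 1) ^ 3 * g w = f (xiNS52 w) by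
    obtain ⟨f, hf, hfw⟩ := hs
    refine ⟨f, hf, fun w hw => ?_⟩
    rw [intNS52, ← hfw w hw, inv_mul_cancel_left₀ (pow_ne_zero 3 (hne w hw))]
  refine exists_contDiffOn_factor (isOpen_box hBo) ?_ ?_ ?_
  · refine ContDiffOn.mul ?_ hg
    fun_prop
  · intro w hw w' hw' hξ
    obtain ⟨α, β, hw'e⟩ : ∃ α β : ℝ, ∀ i, w' i = α * w i + β := by
      refine ⟨(w' 0 - w' 1) / (w 0 - w 1), w' 0 - (w' 0 - w' 1) / (w 0 - w 1) * w 0, ?_⟩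
      have h0 := hne w hw
      have h0' := hne w' hw'
      intro i
      have hj : ∀ j : Fin 5, w' (Fin.natAdd 2 j)
          = (w' 0 - w' 1) / (w 0 - w 1) * w (Fin.natAdd 2 j)
            + (w' 0 - (w' 0 - w' 1) / (w 0 - w 1) * w 0) := by
        intro j
        have := congrFun hξ j
        simp only [xiNS52] at this
        field_simp at this ⊢
        linear_combination this
      fin_cases i
      · simp
      · change w' 1 = (w' 0 - w' 1) / (w 0 - w 1) * w 1 + _
        field_simp
        ring
      · exact hj 0
      · exact hj 1
      · exact hj 2
      · exact hj 3
      · exact hj 4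
    have hmem : ∀ s ∈ Set.Icc (0 : ℝ) 1, (fun i => w i + s * (w' i - w i)) ∈ box B := by
      intro s hs i
      have := (hBc i).ordConnected.convex.add_smul_sub_mem (hw i) (hw' i) hs
      simpa using this
    have key := eq_of_hasDerivAt_zero
      (f := fun s => ((w 0 + s * (w' 0 - w 0)) - (w 1 + s * (w' 1 - w 1))) ^ 3
        * g (fun i => w i + s * (w' i - w i))) ?_
    · simpa using key.symm
    intro s hs
    have hγ := hmem s hs
    have h0 := hne w hw
    have h0γ : (w 0 + s * (w' 0 - w 0)) - (w 1 + s * (w' 1 - w 1)) ≠ 0 := hne _ hγ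
    -- At parameter `s` the difference of the first two coordinates is `(1 - s + s α)(w 0 - w 1)`,
    -- and it cannot vanish because `B 0` and `B 1` are disjoint.
    have hden : 1 - s + s * α ≠ 0 := by
      intro e
      apply h0γ
      rw [hw'e 0, hw'e 1]
      linear_combination (w 0 - w 1) * e
    have hl : ∀ i, HasDerivAt (fun s : ℝ => w i + s * (w' i - w i)) (w' i - w i) s := fun i => by
      simpa using ((hasDerivAt_id s).mul_const (w' i - w i)).const_add (w i)
    have hlin : (fun i => w' i - w i) = ((α - 1) / (1 - s + s * α)) •
        (fun i => w i + s * (w' i - w i)) + (β / (1 - s + s * α)) • fun _ => (1 : ℝ) := by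
      ext i
      simp only [Pi.add_apply, Pi.smul_apply, smul_eq_mul, hw'e i]
      rw [div_mul_eq_mul_div, div_mul_eq_mul_div, ← add_div, eq_div_iff hden]
      ring
    have hgd : DifferentiableAt ℝ g (fun i => w i + s * (w' i - w i)) :=
      (hg.contDiffAt ((isOpen_box hBo).mem_nhds hγ)).differentiableAt (by simp)
    have hgs := HasFDerivAt.comp_hasDerivAt (l := g) s hgd.hasFDerivAt (hasDerivAt_pi.2 hl)
    rw [hlin, map_add, map_smul, map_smul, h3 _ hγ, h1 _ hγ] at hgs
    refine ((((hl 0).sub (hl 1)).pow 3).mul hgs).congr_deriv ?_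
    simp only [Pi.sub_apply, Pi.pow_apply, Function.comp_def, smul_eq_mul, mul_zero, add_zero]
    have e0 := congrFun hlin 0
    have e1 := congrFun hlin 1
    simp only [Pi.add_apply, Pi.smul_apply, smul_eq_mul] at e0 e1
    simp only [Nat.cast_ofNat, Nat.reduceSub]
    linear_combination (3 * ((w 0 + s * (w' 0 - w 0)) - (w 1 + s * (w' 1 - w 1))) ^ 2
      * g (fun i => w i + s * (w' i - w i))) * (e0 - e1)
  · intro w hw
    have h0 := hne w hw
    -- The section keeps the first two coordinates and solves the definition of the invariants for
    -- the remaining five.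
    refine ⟨fun ξ => ![w 0, w 1, w 0 - (w 0 - w 1) * ξ 0, w 0 - (w 0 - w 1) * ξ 1,
      w 0 - (w 0 - w 1) * ξ 2, w 0 - (w 0 - w 1) * ξ 3, w 0 - (w 0 - w 1) * ξ 4], ?_, ?_, ?_⟩
    · rw [contDiffAt_pi]
      have hc : ∀ j, ContDiffAt ℝ ∞ (fun ξ : Fin 5 → ℝ => w 0 - (w 0 - w 1) * ξ j) (xiNS52 w) :=
        fun j => contDiffAt_const.sub (contDiffAt_const.mul (contDiffAt_apply ℝ ℝ j _))
      intro i
      fin_cases i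
      exacts [contDiffAt_const, contDiffAt_const, hc 0, hc 1, hc 2, hc 3, hc 4]
    · have hc : ∀ y, w 0 - (w 0 - w 1) * ((w 0 - y) / (w 0 - w 1)) = y := fun y => by
        field_simp
        ring
      ext i
      fin_cases i
      exacts [rfl, rfl, hc _, hc _, hc _, hc _, hc _]
    · refine Filter.Eventually.of_forall fun ξ => ?_
      have hc : ∀ y, (w 0 - (w 0 - (w 0 - w 1) * y)) / (w 0 - w 1) = y := fun y => by
        field_simp
        ring
      ext j
      fin_cases j <;> exact hc _

/-! ### The invariants of the scalings -/

theorem det2_eq (f g : Site → ℝ) (p q : Site) : det2 f g p q = f p * g q - f q * g p := by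
  simp [det2, detD, Matrix.det_fin_two]

theorem det3_eq (f g : Site → ℝ) (p q r : Site) : det3 f g p q r =
    f p * (g q - g r) - f q * (g p - g r) + f r * (g p - g q) := by
  simp [det3, detD, Matrix.det_fin_three]
  ring

/-- The factor in front of `f` in the interaction of `NS_{5,1}`. -/
noncomputable def factorNS51 (a₁ a₂ : Site → ℝ) (x : Site) (w : Fin 7 → ℝ) : ℝ :=
  w 0 * (|w 0| ^ (-det2 a₁ a₂ (site x 1) (site x 2))
      * |w 1| ^ det2 a₁ a₂ (site x 0) (site x 2)
      * |w 2| ^ (-det2 a₁ a₂ (site x 0) (site x 1)))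
        ^ (4 / det3 a₁ a₂ (site x 0) (site x 1) (site x 2))

theorem intNS51_eq (a₁ a₂ : Site → ℝ) (x : Site) (f : (Fin 4 → ℝ) → ℝ) (w : Fin 7 → ℝ) :
    intNS51 a₁ a₂ x f w = factorNS51 a₁ a₂ x w * f (xiNS51 a₁ a₂ x w) := rfl

section Invariants

variable {a₁ a₂ : Site → ℝ} {x : Site}

theorem abs_mul_exp_rpow (u y c : ℝ) :
    |u * Real.exp y| ^ c = |u| ^ c * Real.exp (c * y) := by
  rw [abs_mul, Real.abs_exp, Real.mul_rpow (abs_nonneg u) (Real.exp_pos y).le, ← Real.exp_mul,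
    mul_comm y c]

theorem factorNS51_ne_zero {w : Fin 7 → ℝ} (hw : ∀ i, w i ≠ 0) : factorNS51 a₁ a₂ x w ≠ 0 := by
  have h := fun i => abs_pos.2 (hw i)
  have h0 := h 0
  have h1 := h 1
  have h2 := h 2
  exact mul_ne_zero (hw 0) (by positivity)

/-- The factor under a rescaling of the variables. -/
theorem factorNS51_exp {w : Fin 7 → ℝ} (hw : ∀ i, w i ≠ 0) (y : Fin 7 → ℝ) :
    factorNS51 a₁ a₂ x (fun i => w i * Real.exp (y i)) = Real.exp (y 0
      + (-det2 a₁ a₂ (site x 1) (site x 2) * y 0 + det2 a₁ a₂ (site x 0) (site x 2) * y 1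
        + -det2 a₁ a₂ (site x 0) (site x 1) * y 2)
        * (4 / det3 a₁ a₂ (site x 0) (site x 1) (site x 2))) * factorNS51 a₁ a₂ x w := by
  have h := fun i => abs_pos.2 (hw i)
  have h0 := h 0
  have h1 := h 1
  have h2 := h 2
  simp only [factorNS51, abs_mul_exp_rpow]
  generalize hA : |w 0| ^ (-det2 a₁ a₂ (site x 1) (site x 2)) = A
  generalize hB : |w 1| ^ (det2 a₁ a₂ (site x 0) (site x 2)) = B
  generalize hC : |w 2| ^ (-det2 a₁ a₂ (site x 0) (site x 1)) = C
  have hA' : 0 < A := hA ▸ by positivity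
  have hB' : 0 < B := hB ▸ by positivity
  have hC' : 0 < C := hC ▸ by positivity
  have e : ∀ y₀ y₁ y₂ : ℝ, A * Real.exp y₀ * (B * Real.exp y₁) * (C * Real.exp y₂)
      = A * B * C * Real.exp (y₀ + y₁ + y₂) := fun y₀ y₁ y₂ => by
    rw [Real.exp_add, Real.exp_add]
    ring
  rw [e, Real.mul_rpow (by positivity) (Real.exp_pos _).le, ← Real.exp_mul, Real.exp_add (y 0)]
  ring

/-- The factor under scalings. -/
theorem factorNS51_scale (hD : det3 a₁ a₂ (site x 0) (site x 1) (site x 2) ≠ 0) {w : Fin 7 → ℝ}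
    (hw : ∀ i, w i ≠ 0) (α β γ : ℝ) :
    factorNS51 a₁ a₂ x (fun i => w i * Real.exp (α * a₁ (site x i) + β * a₂ (site x i) + γ))
      = Real.exp (α * a₁ x + β * a₂ x - 3 * γ) * factorNS51 a₁ a₂ x w := by
  rw [factorNS51_exp hw]
  congr 2
  rw [det3_eq] at hD ⊢
  simp only [det2_eq, site_zero] at hD ⊢
  field_simp
  ring

/-- The invariants under scalings. -/
theorem xiNS51_scale (w y : Fin 7 → ℝ) (j : Fin 4) :
    xiNS51 a₁ a₂ x (fun i => w i * Real.exp (y i)) j = xiNS51 a₁ a₂ x w j * Real.exp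
      (det3 a₁ a₂ (site x 1) (site x 2) (site x (Fin.natAdd 3 j)) * y 0
        - det3 a₁ a₂ (site x 0) (site x 2) (site x (Fin.natAdd 3 j)) * y 1
        + det3 a₁ a₂ (site x 0) (site x 1) (site x (Fin.natAdd 3 j)) * y 2
        - det3 a₁ a₂ (site x 0) (site x 1) (site x 2) * y (Fin.natAdd 3 j)) := by
  simp only [xiNS51, abs_mul_exp_rpow]
  rw [sub_eq_add_neg, sub_eq_add_neg, Real.exp_add, Real.exp_add, Real.exp_add, ← neg_mul,
    ← neg_mul]
  ring

theorem xiNS51_pos {w : Fin 7 → ℝ} (hw : ∀ i, w i ≠ 0) (j : Fin 4) : 0 < xiNS51 a₁ a₂ x w j := by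
  have h := fun i => abs_pos.2 (hw i)
  have h0 := h 0
  have h1 := h 1
  have h2 := h 2
  have h3 := h (Fin.natAdd 3 j)
  simp only [xiNS51]
  positivity

/-- The identities between determinants behind the invariance of `ξ`. -/
theorem det3_relation (a₁ a₂ : Site → ℝ) (x : Site) (α β γ : ℝ) (k : Site) :
    det3 a₁ a₂ (site x 1) (site x 2) k * (α * a₁ (site x 0) + β * a₂ (site x 0) + γ)
      - det3 a₁ a₂ (site x 0) (site x 2) k * (α * a₁ (site x 1) + β * a₂ (site x 1) + γ)
      + det3 a₁ a₂ (site x 0) (site x 1) k * (α * a₁ (site x 2) + β * a₂ (site x 2) + γ)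
      = det3 a₁ a₂ (site x 0) (site x 1) (site x 2) * (α * a₁ k + β * a₂ k + γ) := by
  simp only [det3_eq]
  ring

/-- A vector annihilated by the logarithms of the invariants is a combination of `a₁`, `a₂`, `1`. -/
theorem exists_combination (hD : det3 a₁ a₂ (site x 0) (site x 1) (site x 2) ≠ 0) (y : Fin 7 → ℝ)
    (hy : ∀ j : Fin 4, det3 a₁ a₂ (site x 1) (site x 2) (site x (Fin.natAdd 3 j)) * y 0
        - det3 a₁ a₂ (site x 0) (site x 2) (site x (Fin.natAdd 3 j)) * y 1
        + det3 a₁ a₂ (site x 0) (site x 1) (site x (Fin.natAdd 3 j)) * y 2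
        - det3 a₁ a₂ (site x 0) (site x 1) (site x 2) * y (Fin.natAdd 3 j) = 0) :
    ∃ α β γ : ℝ, ∀ i, y i = α * a₁ (site x i) + β * a₂ (site x i) + γ := by
  obtain ⟨α, β, γ, e0, e1, e2⟩ : ∃ α β γ : ℝ, y 0 = α * a₁ (site x 0) + β * a₂ (site x 0) + γ ∧
      y 1 = α * a₁ (site x 1) + β * a₂ (site x 1) + γ ∧
      y 2 = α * a₁ (site x 2) + β * a₂ (site x 2) + γ := by
    have hD' := hD
    rw [det3_eq] at hD'
    generalize a₁ (site x 0) = p0 at *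
    generalize a₁ (site x 1) = p1 at *
    generalize a₁ (site x 2) = p2 at *
    generalize a₂ (site x 0) = q0 at *
    generalize a₂ (site x 1) = q1 at *
    generalize a₂ (site x 2) = q2 at *
    -- Cramer's rule for the values at the first three nodes; the other four nodes follow from
    -- `det3_relation`.
    refine ⟨(y 0 * (q1 - q2) - y 1 * (q0 - q2) + y 2 * (q0 - q1))
        / (p0 * (q1 - q2) - p1 * (q0 - q2) + p2 * (q0 - q1)),
      (p0 * (y 1 - y 2) - p1 * (y 0 - y 2) + p2 * (y 0 - y 1))
        / (p0 * (q1 - q2) - p1 * (q0 - q2) + p2 * (q0 - q1)),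
      (y 0 * (p1 * q2 - p2 * q1) - y 1 * (p0 * q2 - p2 * q0) + y 2 * (p0 * q1 - p1 * q0))
        / (p0 * (q1 - q2) - p1 * (q0 - q2) + p2 * (q0 - q1)), ?_, ?_, ?_⟩ <;>
    · rw [div_mul_eq_mul_div, div_mul_eq_mul_div, ← add_div, ← add_div, eq_div_iff hD']
      ring
  refine ⟨α, β, γ, fun i => ?_⟩
  have hk : ∀ j : Fin 4, y (Fin.natAdd 3 j)
      = α * a₁ (site x (Fin.natAdd 3 j)) + β * a₂ (site x (Fin.natAdd 3 j)) + γ := by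
    intro j
    have h1 := hy j
    rw [e0, e1, e2, det3_relation] at h1
    exact (mul_left_cancel₀ hD (sub_eq_zero.1 h1)).symm
  fin_cases i
  exacts [e0, e1, e2, hk 0, hk 1, hk 2, hk 3]

end Invariants

/-! ### Integration of the scaling equations over a box -/

section Invariants

variable {a₁ a₂ : Site → ℝ} {x : Site}

theorem contDiffAt_factorNS51 {w : Fin 7 → ℝ} (hw : ∀ i, w i ≠ 0) :
    ContDiffAt ℝ ∞ (factorNS51 a₁ a₂ x) w := by
  have habs : ∀ i, ContDiffAt ℝ ∞ (fun v : Fin 7 → ℝ => |v i|) w := fun i =>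
    ContDiffAt.comp w (contDiffAt_abs (hw i)) (contDiffAt_apply ℝ ℝ i w)
  have hpow : ∀ i (c : ℝ), ContDiffAt ℝ ∞ (fun v : Fin 7 → ℝ => |v i| ^ c) w := fun i c =>
    (habs i).rpow_const_of_ne (abs_ne_zero.2 (hw i))
  refine (contDiffAt_apply ℝ ℝ (0 : Fin 7) w).mul
    ((((hpow 0 _).mul (hpow 1 _)).mul (hpow 2 _)).rpow_const_of_ne ?_)
  have h := fun i => abs_pos.2 (hw i)
  have h0 := h 0
  have h1 := h 1
  have h2 := h 2
  positivity

/-- Two points of an interval that does not contain zero have a positive quotient. -/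
theorem div_pos_of_isPreconnected {B : Set ℝ} (hB : IsPreconnected B) (h0 : (0 : ℝ) ∉ B) {u v : ℝ}
    (hu : u ∈ B) (hv : v ∈ B) : 0 < v / u := by
  have hord := hB.ordConnected
  rcases lt_trichotomy u 0 with h | h | h
  · have : v < 0 := by
      by_contra! hv0
      exact h0 (hord.out hu hv ⟨h.le, hv0⟩)
    exact div_pos_of_neg_of_neg this h
  · exact absurd (h ▸ hu) h0
  · have : 0 < v := by
      by_contra! hv0
      exact h0 (hord.out hv hu ⟨hv0, h.le⟩)
    exact div_pos this h

/-- The path `u * exp (s * y)` is monotone in `s`, so it stays between its endpoints. It replaces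
the straight segment when scalings are integrated. -/
theorem mul_exp_mem {B : Set ℝ} (hB : IsPreconnected B) {u y : ℝ} (hu : u ∈ B)
    (hv : u * Real.exp y ∈ B) {s : ℝ} (hs : s ∈ Set.Icc (0 : ℝ) 1) : u * Real.exp (s * y) ∈ B := by
  obtain ⟨h0, h1⟩ := hs
  have hy : Real.exp (s * y) ∈ Set.uIcc 1 (Real.exp y) := by
    rw [Set.mem_uIcc]
    rcases le_total 0 y with h | h
    · exact Or.inl ⟨Real.one_le_exp (by positivity), Real.exp_le_exp.2 (by nlinarith)⟩
    · exact Or.inr ⟨Real.exp_le_exp.2 (by nlinarith), Real.exp_le_one_iff.2 (by nlinarith)⟩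
  refine hB.ordConnected.uIcc_subset hu hv ?_
  rw [Set.mem_uIcc] at hy ⊢
  rcases le_total 0 u with h | h
  · rcases hy with hy | hy
    · exact Or.inl ⟨by nlinarith, by nlinarith⟩
    · exact Or.inr ⟨by nlinarith, by nlinarith⟩
  · rcases hy with hy | hy
    · exact Or.inr ⟨by nlinarith, by nlinarith⟩
    · exact Or.inl ⟨by nlinarith, by nlinarith⟩

/-- Boxes avoiding zero fix the signs, so a second point has the form `w i * exp (y i)`. Equal
invariants make `y` a combination of `a₁`, `a₂`, `1`, whence `g` satisfies a linear equation along
`w i * exp (s * y i)` and changes by the same exponential as the factor. The quotient is thus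
constant on fibres. -/
theorem exists_intNS51 (hD : det3 a₁ a₂ (site x 0) (site x 1) (site x 2) ≠ 0)
    {B : Fin 7 → Set ℝ} (hBo : ∀ i, IsOpen (B i))
    (hBc : ∀ i, IsPreconnected (B i)) (h0 : ∀ i, (0 : ℝ) ∉ B i) {g : (Fin 7 → ℝ) → ℝ}
    (hg : ContDiffOn ℝ ∞ g (box B)) (h3 : ∀ w ∈ box B, fderiv ℝ g w w = -3 * g w)
    (h1 : ∀ w ∈ box B, fderiv ℝ g w (fun i => a₁ (site x i) * w i) = a₁ x * g w)
    (h2 : ∀ w ∈ box B, fderiv ℝ g w (fun i => a₂ (site x i) * w i) = a₂ x * g w) :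
    ∃ f : (Fin 4 → ℝ) → ℝ, ContDiffOn ℝ ∞ f (xiNS51 a₁ a₂ x '' box B) ∧
      ∀ w ∈ box B, g w = intNS51 a₁ a₂ x f w := by
  have hne : ∀ w ∈ box B, ∀ i, w i ≠ 0 := fun w hw i e => h0 i (e ▸ hw i)
  suffices hs : ∃ f : (Fin 4 → ℝ) → ℝ, ContDiffOn ℝ ∞ f (xiNS51 a₁ a₂ x '' box B) ∧
      ∀ w ∈ box B, g w / factorNS51 a₁ a₂ x w = f (xiNS51 a₁ a₂ x w) by
    obtain ⟨f, hf, hfw⟩ := hs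
    refine ⟨f, hf, fun w hw => ?_⟩
    rw [intNS51_eq, ← hfw w hw, mul_div_cancel₀ _ (factorNS51_ne_zero (hne w hw))]
  refine exists_contDiffOn_factor (isOpen_box hBo) ?_ ?_ ?_
  · exact hg.div (fun w hw => (contDiffAt_factorNS51 (hne w hw)).contDiffWithinAt)
      fun w hw => factorNS51_ne_zero (hne w hw)
  · intro w hw w' hw' hξ
    have hq : ∀ i, 0 < w' i / w i := fun i => div_pos_of_isPreconnected (hBc i) (h0 i) (hw i) (hw' i)
    obtain ⟨y, rfl⟩ : ∃ y : Fin 7 → ℝ, w' = fun i => w i * Real.exp (y i) := by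
      refine ⟨fun i => Real.log (w' i / w i), funext fun i => ?_⟩
      rw [Real.exp_log (hq i), mul_div_cancel₀ _ (hne w hw i)]
    obtain ⟨α, β, γ, hy⟩ := exists_combination (a₁ := a₁) (a₂ := a₂) (x := x) hD y fun j => by
      have := congrFun hξ j
      rw [xiNS51_scale] at this
      have hpos := xiNS51_pos (a₁ := a₁) (a₂ := a₂) (x := x) (hne w hw) j
      rw [eq_comm, mul_eq_left₀ hpos.ne', Real.exp_eq_one_iff] at this
      exact this
    have hfac := factorNS51_scale (a₁ := a₁) (a₂ := a₂) (x := x) hD (hne w hw) α β γ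
    have hyx : y 0 = α * a₁ x + β * a₂ x + γ := by rw [hy 0, site_zero]
    simp only [← hy] at hfac
    set c := α * a₁ x + β * a₂ x - 3 * γ with hc
    have hmem : ∀ s ∈ Set.Icc (0 : ℝ) 1, (fun i => w i * Real.exp (s * y i)) ∈ box B :=
      fun s hs i => mul_exp_mem (hBc i) (hw i) (hw' i) hs
    have key := eq_of_hasDerivAt_zero
      (f := fun s => Real.exp (-(s * c)) * g (fun i => w i * Real.exp (s * y i))) ?_
    · simp only [one_mul, zero_mul, neg_zero, Real.exp_zero, mul_one] at key
      rw [hfac, ← key, Real.exp_neg]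
      have := Real.exp_pos c
      have := factorNS51_ne_zero (a₁ := a₁) (a₂ := a₂) (x := x) (hne w hw)
      field_simp
    intro s hs
    have hγ := hmem s hs
    have hl : ∀ i, HasDerivAt (fun s : ℝ => w i * Real.exp (s * y i))
        (y i * (w i * Real.exp (s * y i))) s := fun i => by
      refine ((((hasDerivAt_id s).mul_const (y i)).exp).const_mul (w i)).congr_deriv ?_
      simp
      ring
    have hgd : DifferentiableAt ℝ g (fun i => w i * Real.exp (s * y i)) :=
      (hg.contDiffAt ((isOpen_box hBo).mem_nhds hγ)).differentiableAt (by simp)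
    have hlin : (fun i => y i * (w i * Real.exp (s * y i)))
        = α • (fun i => a₁ (site x i) * (w i * Real.exp (s * y i)))
          + β • (fun i => a₂ (site x i) * (w i * Real.exp (s * y i)))
          + γ • fun i => w i * Real.exp (s * y i) := by
      ext i
      simp only [Pi.add_apply, Pi.smul_apply, smul_eq_mul]
      rw [show y i * (w i * Real.exp (s * y i)) = (α * a₁ (site x i) + β * a₂ (site x i) + γ)
        * (w i * Real.exp (s * y i)) by rw [← hy i]]
      ring
    have hgs := HasFDerivAt.comp_hasDerivAt (l := g) s hgd.hasFDerivAt (hasDerivAt_pi.2 hl)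
    rw [hlin, map_add, map_add, map_smul, map_smul, map_smul, h3 _ hγ, h1 _ hγ, h2 _ hγ] at hgs
    have he : HasDerivAt (fun s => Real.exp (-(s * c))) (-c * Real.exp (-(s * c))) s := by
      refine (((hasDerivAt_id s).mul_const c).neg.exp).congr_deriv ?_
      simp
      ring
    refine (he.mul hgs).congr_deriv ?_
    simp only [Function.comp_def, smul_eq_mul, hc]
    ring
  · intro w hw
    have hnw := hne w hw
    have hpos := fun j => xiNS51_pos (a₁ := a₁) (a₂ := a₂) (x := x) hnw j
    let D := det3 a₁ a₂ (site x 0) (site x 1) (site x 2)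
    -- The section fixes the first three coordinates. The coordinate in slot `3 + j` occurs only in
    -- the invariant number `j`, with exponent `-D`, so a logarithm solves for it.
    let Y : (Fin 4 → ℝ) → Fin 4 → ℝ := fun ξ j =>
      -(Real.log (ξ j) - Real.log (xiNS51 a₁ a₂ x w j)) / D
    have hY : ∀ j, ContDiffAt ℝ ∞ (fun ξ => w (Fin.natAdd 3 j) * Real.exp (Y ξ j))
        (xiNS51 a₁ a₂ x w) := fun j =>
      contDiffAt_const.mul ((((((contDiffAt_apply ℝ ℝ j (xiNS51 a₁ a₂ x w)).log
        (hpos j).ne').sub contDiffAt_const).neg).div_const D).exp)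
    refine ⟨fun ξ i => w i * Real.exp ((![0, 0, 0, Y ξ 0, Y ξ 1, Y ξ 2, Y ξ 3] : Fin 7 → ℝ) i),
      ?_, ?_, ?_⟩
    · rw [contDiffAt_pi]
      have hc : ∀ i, ContDiffAt ℝ ∞ (fun _ : Fin 4 → ℝ => w i * Real.exp 0) (xiNS51 a₁ a₂ x w) :=
        fun i => contDiffAt_const
      intro i
      fin_cases i
      exacts [hc 0, hc 1, hc 2, hY 0, hY 1, hY 2, hY 3]
    · have hY0 : Y (xiNS51 a₁ a₂ x w) = 0 := by
        ext j
        simp [Y]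
      beta_reduce
      rw [hY0]
      ext i
      fin_cases i <;> simp
    · have hev : ∀ᶠ ξ in nhds (xiNS51 a₁ a₂ x w), ∀ j, 0 < ξ j :=
        Filter.eventually_all.2 fun j =>
          (continuous_apply j).continuousAt.eventually (lt_mem_nhds (hpos j))
      filter_upwards [hev] with ξ hξ
      ext j
      rw [xiNS51_scale]
      have e : (![0, 0, 0, Y ξ 0, Y ξ 1, Y ξ 2, Y ξ 3] : Fin 7 → ℝ) (Fin.natAdd 3 j) = Y ξ j := by
        fin_cases j <;> rfl
      rw [e]
      have e2 : - (D * Y ξ j) = Real.log (ξ j / xiNS51 a₁ a₂ x w j) := by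
        rw [Real.log_div (hξ j).ne' (hpos j).ne']
        simp only [Y]
        rw [mul_div_cancel₀ _ hD]
        ring
      simp only [Matrix.cons_val_zero, Matrix.cons_val_one, Matrix.cons_val, mul_zero, sub_zero,
        add_zero, zero_sub]
      change _ * Real.exp (-(D * Y ξ j)) = _
      rw [e2, Real.exp_log (div_pos (hξ j) (hpos j)), mul_div_cancel₀ _ (hpos j).ne']

end Invariants

/-! ### The two classes -/

theorem IsPreconnected.eq_of_hasDerivAt_zero {I : Set ℝ} (hI : IsPreconnected I) {f : ℝ → ℝ}
    (hf : ∀ t ∈ I, HasDerivAt f 0 t) {t t' : ℝ} (ht : t ∈ I) (ht' : t' ∈ I) : f t' = f t := by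
  have key := _root_.eq_of_hasDerivAt_zero (f := fun s => f (t + s * (t' - t))) fun s hs => by
    have hm : t + s * (t' - t) ∈ I := by
      simpa using hI.ordConnected.convex.add_smul_sub_mem ht ht' hs
    have hl : HasDerivAt (fun s : ℝ => t + s * (t' - t)) (t' - t) s := by
      simpa using ((hasDerivAt_id s).mul_const (t' - t)).const_add t
    exact ((hf _ hm).comp s hl).congr_deriv (by simp)
  simpa using key

theorem smoothFn.exists_interval (f : smoothFn) {t₀ : ℝ} (h : 0 < f.1 t₀) :
    ∃ J : Set ℝ, IsOpen J ∧ IsPreconnected J ∧ t₀ ∈ J ∧ ∀ t ∈ J, 0 < f.1 t := by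
  obtain ⟨ε, hε, hb⟩ := Metric.eventually_nhds_iff_ball.1
    ((smoothFn.continuous f).continuousAt.eventually (lt_mem_nhds h))
  exact ⟨Metric.ball t₀ ε, Metric.isOpen_ball, (convex_ball t₀ ε).isPreconnected,
    Metric.mem_ball_self hε, hb⟩

/-! ### The two cases of the classification and their exclusion -/

section

variable {L : LieSubalgebra ℝ SymField} {F : Interaction} {Ω : Domain}

/-- If a combination of the multipliers were constant, the interactions would be uncoupled. -/
theorem multipliers_independent (hF : IsNonlinearCoupled F Ω) (hsym : ∀ X ∈ L, X.IsSymmetry F Ω)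
    (hdim : Module.finrank ℝ L = 5) (hns : ¬ LieAlgebra.IsSolvable L)
    (hK : translationFields L = ⊥) {k : SymField} (hk : k ∈ L) (hkt : k.tau = 0)
    (hk1 : ∀ x, k.a x = 1) : False := by
  obtain ⟨p, hp, -⟩ := hF.nonlinear 0
  obtain ⟨⟨t, W⟩, hpΩ, hp1⟩ := closure_nonempty_iff.1 ⟨p, hF.coupled 0 1 hp⟩
  obtain ⟨x₁, x₂, x₃, X₁, X₂, X₃, hfr, hx₁⟩ := exists_frame_of_no_translations hdim hns hK t
  obtain ⟨J, hJ, hJc, htJ, hpos⟩ := smoothFn.exists_interval x₁ hx₁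
  let T := hfr.transf J hJ hJc hpos (fun _ => 1) fun _ => one_ne_zero
  have hs : √(x₁.1 t) ≠ 0 := (Real.sqrt_pos.2 hx₁).ne'
  have hold : T.old 0 t (fun i => (W i - shiftQ X₁ X₂ (site 0 i) t) / √(x₁.1 t)) = W := by
    ext i
    rw [transf_old hfr 0 htJ]
    field_simp
    ring
  set w : Fin 7 → ℝ := fun i => (W i - shiftQ X₁ X₂ (site 0 i) t) / √(x₁.1 t) with hw
  have hwΩ : (t, T.old 0 t w) ∈ Ω 0 := by rwa [hold]
  have hcont : ContinuousAt (fun v => (t, T.old 0 t v)) w := by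
    have : Continuous (T.old 0 t) := by
      rw [transf_old_eq hfr 0 htJ]
      fun_prop
    exact (continuous_const.prodMk this).continuousAt
  have hev : ∀ᶠ v in nhds w, (t, T.old 0 t v) ∈ Ω 0 :=
    hcont.eventually_mem ((hF.isOpen 0).mem_nhds hwΩ)
  -- A multiplier equal to `1` gives homogeneity of degree `1`, the frame gives degree `-3`.
  have hzero : T.newF F 0 t =ᶠ[nhds w] 0 := by
    filter_upwards [hev] with v hv
    have e1 := transf_fderiv_newF_self hfr hF (hsym _ hfr.mem₁) (hsym _ hfr.mem₂) 0 htJ hv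
    have e2 := transf_fderiv_newF_scale hfr hF hkt (lie_eq_zero_of_no_translations hK hfr.mem₁ hk
      hkt) (lie_eq_zero_of_no_translations hK hfr.mem₂ hk hkt) (hsym _ hk) 0 htJ hv
    simp only [hk1, one_mul] at e2
    rw [e1] at e2
    change T.newF F 0 t v = 0
    linarith
  -- The extra linear term of the new interaction involves slot `0` only, so the derivative in slot
  -- `1` is a nonzero multiple of `∂F/∂u_{n+1m}`, which is nonzero at the chosen point.
  have hd := transf_fderiv_newF hfr hF 0 htJ hwΩ (Pi.single 1 1)
  have hd0 : fderiv ℝ (T.newF F 0 t) w = 0 := by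
    rw [hzero.fderiv_eq]
    exact fderiv_const_apply (0 : ℝ)
  change fderiv ℝ (T.newF F 0 t) w _ = _ at hd
  rw [hd0, Finset.sum_eq_single (1 : Fin 7)] at hd
  · change partialU (F 0 t) 1 W ≠ 0 at hp1
    change _ = _ * (_ * partialU (F 0 t) 1 (T.old 0 t w)) + _ at hd
    rw [hold] at hd
    simp [hs, hp1] at hd
  · intro i _ hi
    simp [hi]
  · simp

/-- In general position independent multipliers are nondegenerate. -/
theorem nonDegenerate_of_generalPosition {a₁ a₂ : Site → ℝ} (hgp : GeneralPosition
    (Submodule.span ℝ (Set.range ![a₁, a₂, fun _ => 1])))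
    (hli : LinearIndependent ℝ ![a₁, a₂, fun _ => 1]) : NonDegenerate a₁ a₂ := by
  intro x hD
  have hrank : Module.finrank ℝ (Submodule.span ℝ (Set.range ![a₁, a₂, fun _ => (1 : ℝ)])) = 3 := by
    rw [finrank_span_eq_card hli]
    rfl
  rw [det3, detD, ← Matrix.exists_vecMul_eq_zero_iff] at hD
  obtain ⟨v, hv, hv0⟩ := hD
  apply hv
  -- A vector in the left kernel of the matrix is a combination of `a₁`, `a₂`, `1` that vanishes at
  -- the first three nodes, so general position makes it zero.
  have hg := hgp x (∑ i, v i • ![a₁, a₂, fun _ => (1 : ℝ)] i)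
    (Submodule.sum_mem _ fun i _ => Submodule.smul_mem _ _ (Submodule.subset_span ⟨i, rfl⟩))
    fun i hi => by
      rw [hrank] at hi
      obtain ⟨j, rfl⟩ : ∃ j : Fin 3, i = Fin.castLE (by norm_num) j := ⟨⟨i, hi⟩, rfl⟩
      have e := congrFun hv0 j
      rw [Matrix.vecMul, dotProduct] at e
      have hp : ![site x 0, site x 1, site x 2] j = site x (Fin.castLE (by norm_num) j) := by
        fin_cases j <;> rfl
      simp only [Matrix.of_apply, hp] at e
      simpa [Finset.sum_apply] using e
  funext i
  exact Fintype.linearIndependent_iff.1 hli v hg i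

theorem multipliers_eq {x₁ x₂ x₃ : smoothFn} {X₁ X₂ X₃ k₁ k₂ : SymField}
    (hfr : IsFrame L x₁ x₂ x₃ X₁ X₂ X₃) (hk₁ : k₁ ∈ L) (hk₂ : k₂ ∈ L)
    (hk : ∀ X ∈ L, X.tau = 0 → ∃ α β : ℝ, X = α • k₁ + β • k₂) :
    multipliers L = Submodule.span ℝ (Set.range ![k₁.a, k₂.a, fun _ => 1]) := by
  have hmem := fun i => Submodule.subset_span (R := ℝ) (s := Set.range ![k₁.a, k₂.a, fun _ => 1])
    ⟨i, rfl⟩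
  apply le_antisymm
  · refine Submodule.span_le.2 ?_
    rintro g (rfl | ⟨X, hX, rfl⟩)
    · exact hmem 2
    · obtain ⟨α, β, γ, e⟩ := Submodule.mem_span_triple.1 (hfr.span X hX)
      have hX' : X - (α • X₁ + β • X₂ + γ • X₃) ∈ L :=
        L.sub_mem hX (L.add_mem (L.add_mem (L.smul_mem _ hfr.mem₁) (L.smul_mem _ hfr.mem₂))
          (L.smul_mem _ hfr.mem₃))
      obtain ⟨δ, ε, e'⟩ := hk _ hX' (by simp [← e, hfr.tau₁, hfr.tau₂, hfr.tau₃])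
      rw [sub_eq_iff_eq_add'] at e'
      have : X.a = δ • k₁.a + ε • k₂.a := by
        ext x
        rw [e']
        simp [hfr.a₁, hfr.a₂, hfr.a₃]
      rw [SetLike.mem_coe, this]
      exact Submodule.add_mem _ (Submodule.smul_mem _ _ (hmem 0)) (Submodule.smul_mem _ _ (hmem 1))
  · refine Submodule.span_le.2 ?_
    rintro _ ⟨i, rfl⟩
    refine Submodule.subset_span ?_
    fin_cases i
    · exact Or.inr ⟨k₁, hk₁, rfl⟩
    · exact Or.inr ⟨k₂, hk₂, rfl⟩
    · exact Or.inl rfl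

/-- The kernel is central, so the shift that straightens the frame also removes the `λ` of `k₁` and
`k₂`, which become pure scalings. No rescaling of `u` is needed, hence `P = 1`. -/
theorem equivNS51At_of_no_translations (hF : IsNonlinearCoupled F Ω)
    (hsym : ∀ X ∈ L, X.IsSymmetry F Ω) (hdim : Module.finrank ℝ L = 5)
    (hns : ¬ LieAlgebra.IsSolvable L) (hiso : IsIsotropic L) (hK : translationFields L = ⊥)
    (t₀ : ℝ) : EquivNS51At F Ω L t₀ := by
  have hfin := finiteDimensional_of_finrank_eq_five hdim
  obtain ⟨k₁, hk₁, k₂, hk₂, t1, t2, hind, hspan⟩ := exists_scalings hdim hns hK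
  obtain ⟨x₁, x₂, x₃, X₁, X₂, X₃, hfr, hx₁⟩ := exists_frame_of_no_translations hdim hns hK t₀
  obtain ⟨J, hJ, hJc, htJ, hpos⟩ := smoothFn.exists_interval x₁ hx₁
  have hli : LinearIndependent ℝ ![k₁.a, k₂.a, fun _ => (1 : ℝ)] := by
    rw [Fintype.linearIndependent_iff]
    intro g hg
    have hg' : ∀ x, g 0 * k₁.a x + g 1 * k₂.a x + g 2 = 0 := fun x => by
      simpa [Fin.sum_univ_three] using congrFun hg x
    have h2 : g 2 = 0 := by
      -- A nonzero coefficient of `1` makes a combination of `k₁`, `k₂` have constant multiplier,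
      -- which is normalised to `1`.
      by_contra h2
      refine multipliers_independent hF hsym hdim hns hK
        (k := (-(g 2)⁻¹) • (g 0 • k₁ + g 1 • k₂))
        (L.smul_mem _ (L.add_mem (L.smul_mem _ hk₁) (L.smul_mem _ hk₂))) (by simp [t1, t2])
        fun x => ?_
      simp only [SymField.a_smul, SymField.a_add]
      rw [show g 0 * k₁.a x + g 1 * k₂.a x = -g 2 by linarith [hg' x]]
      field_simp
    obtain ⟨h0, h1⟩ := hind (g 0) (g 1) fun x => by linarith [hg' x]
    intro i
    fin_cases i
    exacts [h0, h1, h2]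
  have hgp := hiso.1
  rw [multipliers_eq hfr hk₁ hk₂ hspan] at hgp
  have hND := nonDegenerate_of_generalPosition hgp hli
  have c11 := lie_eq_zero_of_no_translations hK hfr.mem₁ hk₁ t1
  have c21 := lie_eq_zero_of_no_translations hK hfr.mem₂ hk₁ t1
  have c12 := lie_eq_zero_of_no_translations hK hfr.mem₁ hk₂ t2
  have c22 := lie_eq_zero_of_no_translations hK hfr.mem₂ hk₂ t2
  have hP : ∀ x : Site, (fun _ => (1 : ℝ)) x ≠ 0 := fun _ => one_ne_zero
  refine ⟨hfr.transf J hJ hJc hpos (fun _ => 1) hP, k₁.a, k₂.a, htJ, hND,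
    transf_carries hfr htJ hk₁ hk₂ hspan rfl rfl (transf_related_scaleField hfr t1 c11 c21)
      (transf_related_scaleField hfr t2 c12 c22), ?_⟩
  intro x I B hI hIc hIJ hBo hBc hB0 hΩ
  rcases I.eq_empty_or_nonempty with rfl | ⟨t, ht⟩
  · exact ⟨0, contDiffOn_const, by simp⟩
  obtain ⟨f, hf, hfw⟩ := exists_intNS51 (hND x) hBo hBc hB0
    (fun w hw => (transf_contDiffAt_newF hfr hF x (hIJ ht) (hΩ t ht w hw)).contDiffWithinAt)
    (fun w hw => transf_fderiv_newF_self hfr hF (hsym _ hfr.mem₁) (hsym _ hfr.mem₂) x (hIJ ht)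
      (hΩ t ht w hw))
    (fun w hw => transf_fderiv_newF_scale hfr hF t1 c11 c21 (hsym _ hk₁) x (hIJ ht) (hΩ t ht w hw))
    (fun w hw => transf_fderiv_newF_scale hfr hF t2 c12 c22 (hsym _ hk₂) x (hIJ ht) (hΩ t ht w hw))
  -- The function `f` was found at the single time `t`; independence of time carries it to the whole
  -- interval.
  refine ⟨f, hf, fun s hs w hw => ?_⟩
  rw [← hfw w hw]
  exact hIc.eq_of_hasDerivAt_zero (fun r hr => transf_hasDerivAt_newF hfr hF (hsym _ hfr.mem₁) x
    (hIJ hr) (hΩ r hr w hw)) ht hs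

/-- A translation that commutes with the first field of a frame is a multiple of `√x₁`. -/
theorem IsFrame.lam_eq_mul_sqrt {x₁ x₂ x₃ : smoothFn} {X₁ X₂ X₃ v : SymField}
    (hfr : IsFrame L x₁ x₂ x₃ X₁ X₂ X₃) {J : Set ℝ} (hJc : IsPreconnected J)
    (hpos : ∀ t ∈ J, 0 < x₁.1 t) (hv : v ∈ translationFields L) (h1 : ⁅X₁, v⁆ = 0) {t₀ t : ℝ}
    (ht₀ : t₀ ∈ J) (ht : t ∈ J) (x : Site) :
    (v.lam x).1 t = (v.lam x).1 t₀ / √(x₁.1 t₀) * √(x₁.1 t) := by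
  have hv' := mem_translationFields.1 hv
  have e0 : x₁ * dt (v.lam x) - (1 / 2 : ℝ) • (dt x₁ * v.lam x) = 0 := by
    rw [← hfr.tau₁, ← lam_lie_of_translation hfr.a₁ hv'.2, h1]
    rfl
  have key := hJc.eq_of_hasDerivAt_zero (f := fun s => (v.lam x).1 s / √(x₁.1 s))
    (fun s hs => ?_) ht₀ ht
  · rw [← key, div_mul_cancel₀ _ (Real.sqrt_pos.2 (hpos t ht)).ne']
  · have hx := hpos s hs
    have hr := (Real.sqrt_pos.2 hx).ne'
    have e1 := congrArg (fun f : smoothFn => f.1 s) e0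
    simp only [smoothFn.sub_apply, smoothFn.mul_apply, smoothFn.smul_apply,
      smoothFn.zero_apply] at e1
    refine ((smoothFn.hasDerivAt (v.lam x) s).div ((smoothFn.hasDerivAt x₁ s).sqrt hx.ne')
      hr).congr_deriv ?_
    have hs2 := Real.sq_sqrt hx.le
    rw [div_eq_zero_iff]
    left
    field_simp
    rw [hs2]
    linear_combination 2 * e1

/-- The coefficients of `v` are constants times `√x₁`, and taking these constants as `P` turns `v`
into `∂_u`. Since `⁅X₃, v⁆` is `-(x₂ / x₁) v`, its negative becomes `t ∂_u`. -/
theorem equivNS52At_of_translations (hF : IsNonlinearCoupled F Ω)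
    (hsym : ∀ X ∈ L, X.IsSymmetry F Ω) (hdim : Module.finrank ℝ L = 5)
    (hns : ¬ LieAlgebra.IsSolvable L) (hiso : IsIsotropic L) (hK : translationFields L ≠ ⊥)
    (t₀ : ℝ) : EquivNS52At F Ω L t₀ := by
  have hfin := finiteDimensional_of_finrank_eq_five hdim
  obtain ⟨x₁, x₂, x₃, X₁, X₂, X₃, v, hfr, hx₁, hv, hv0, h1v, hspan⟩ :=
    exists_frame_of_translations hdim hns hK t₀
  obtain ⟨J, hJ, hJc, htJ, hpos⟩ := smoothFn.exists_interval x₁ hx₁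
  have hv' := mem_translationFields.1 hv
  have hlam := fun x t (ht : t ∈ J) => hfr.lam_eq_mul_sqrt hJc hpos hv h1v htJ ht x
  have hw := lie_mem_translationFields hfr.mem₃ hv
  have hw' := mem_translationFields.1 hw
  have hwlam : ∀ x, ∀ t ∈ J, (⁅X₃, v⁆.lam x).1 t = -newTime x₁ x₂ t * (v.lam x).1 t := by
    intro x t ht
    have e0 : x₁ * dt (v.lam x) - (1 / 2 : ℝ) • (dt x₁ * v.lam x) = 0 := by
      rw [← hfr.tau₁, ← lam_lie_of_translation hfr.a₁ hv'.2, h1v]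
      rfl
    have e1 := congrArg (fun f : smoothFn => f.1 t) e0
    have r := hfr.isSl2.rel13 t
    have hx := (hpos t ht).ne'
    rw [lam_lie_of_translation hfr.a₃ hv'.2, hfr.tau₃, newTime]
    simp only [smoothFn.sub_apply, smoothFn.mul_apply, smoothFn.smul_apply,
      smoothFn.zero_apply] at e1 ⊢
    field_simp
    linear_combination 2 * x₃.1 t * e1 - (v.lam x).1 t * r
  -- The two translations are proportional at each single time, so the space at `t₀` is a line.
  -- General position then says that `v` vanishes at no node, which makes `P` admissible.
  have htr : translations L t₀ = Submodule.span ℝ {fun x => (v.lam x).1 t₀} := by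
    apply le_antisymm
    · refine Submodule.span_le.2 ?_
      rintro g ⟨X, hX, hXt, -, hg⟩
      obtain ⟨α, β, rfl⟩ := hspan X hX hXt
      refine Submodule.mem_span_singleton.2 ⟨α - β * newTime x₁ x₂ t₀, ?_⟩
      ext x
      rw [hg x]
      simp only [Pi.smul_apply, smul_eq_mul, SymField.lam_add, SymField.lam_smul,
        smoothFn.add_apply, smoothFn.smul_apply, hwlam x t₀ htJ]
      ring
    · exact Submodule.span_mono (Set.singleton_subset_iff.2
        ⟨v, hv'.1, hv'.2.1, funext hv'.2.2, fun x => rfl⟩)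
  have hne : (fun x => (v.lam x).1 t₀) ≠ 0 := by
    intro h0
    refine hv0 (eq_zero_of_eventuallyEq_zero hns (t₀ := t₀) hv fun x => ?_)
    filter_upwards [hJ.mem_nhds htJ] with t ht
    have e : (v.lam x).1 t₀ = 0 := congrFun h0 x
    rw [hlam x t ht, e]
    simp
  have hne' : ∀ x, (v.lam x).1 t₀ ≠ 0 := by
    intro x hx
    have hgp := hiso.2 t₀
    rw [htr] at hgp
    refine hne (hgp x _ (Submodule.mem_span_singleton_self _) fun i hi => ?_)
    rw [finrank_span_singleton hne] at hi
    obtain rfl : i = 0 := Fin.ext (by simpa using hi)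
    rwa [site_zero]
  have hr₀ := (Real.sqrt_pos.2 hx₁).ne'
  have hP : ∀ x, (v.lam x).1 t₀ / √(x₁.1 t₀) ≠ 0 := fun x => div_ne_zero (hne' x) hr₀
  have hspan' : ∀ X ∈ L, X.tau = 0 → ∃ α β : ℝ, X = α • v + β • (-1 : ℝ) • ⁅X₃, v⁆ := by
    intro X hX hXt
    obtain ⟨α, β, rfl⟩ := hspan X hX hXt
    exact ⟨α, -β, by rw [smul_smul, neg_mul_neg, mul_one]⟩
  have rel1 : (hfr.transf J hJ hJc hpos _ hP).Related v (shiftField 1) := by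
    rw [transf_related_iff]
    refine ⟨fun t ht => ?_, fun x => (hv'.2.2 x).symm, fun x t ht => ?_⟩
    · simp [hv'.2.1, shiftField]
    · have := (Real.sqrt_pos.2 (hpos t ht)).ne'
      have := hne' x
      simp only [hv'.2.1, hv'.2.2, shiftField, SymField.lam_mk, smoothFn.one_apply, map_zero,
        smoothFn.zero_apply, hlam x t ht]
      field_simp
      simp
  have rel2 : (hfr.transf J hJ hJc hpos _ hP).Related ((-1 : ℝ) • ⁅X₃, v⁆) (shiftField timeFn) := by
    rw [transf_related_iff]
    refine ⟨fun t ht => ?_, fun x => ?_, fun x t ht => ?_⟩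
    · rw [SymField.tau_smul, hw'.2.1]
      simp [shiftField]
    · simp [shiftField]
    · have := (Real.sqrt_pos.2 (hpos t ht)).ne'
      have := hne' x
      simp only [hw'.2.1, hw'.2.2, shiftField, SymField.lam_mk, smoothFn.timeFn_apply, map_zero,
        SymField.tau_smul, SymField.a_smul, SymField.lam_smul, smul_zero, smoothFn.smul_apply,
        smoothFn.zero_apply, hwlam x t ht, hlam x t ht]
      field_simp
      simp
  refine ⟨hfr.transf J hJ hJc hpos _ hP, htJ, transf_carries hfr htJ hv'.1
    (L.smul_mem _ hw'.1) hspan' rfl rfl rel1 rel2, ?_⟩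
  intro x I B hI hIc hIJ hBo hBc hdisj hΩ
  rcases I.eq_empty_or_nonempty with rfl | ⟨t, ht⟩
  · exact ⟨0, contDiffOn_const, by simp⟩
  obtain ⟨f, hf, hfw⟩ := exists_intNS52 hBo hBc hdisj
    (fun w hw => (transf_contDiffAt_newF hfr hF x (hIJ ht) (hΩ t ht w hw)).contDiffWithinAt)
    (fun w hw => transf_fderiv_newF_self hfr hF (hsym _ hfr.mem₁) (hsym _ hfr.mem₂) x (hIJ ht)
      (hΩ t ht w hw))
    (fun w hw => transf_fderiv_newF_shift hfr hF hv'.2.1 hv'.2.2 h1v hlam (hsym _ hv'.1) x (hIJ ht)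
      (hΩ t ht w hw))
  refine ⟨f, hf, fun s hs w hw => ?_⟩
  rw [← hfw w hw]
  exact hIc.eq_of_hasDerivAt_zero (fun r hr => transf_hasDerivAt_newF hfr hF (hsym _ hfr.mem₁) x
    (hIJ hr) (hΩ r hr w hw)) ht hs

/-- The normal form `NS_{5,2}` has no scalings in its radical. -/
theorem not_equivNS51At_and_equivNS52At {t₀ t₁ : ℝ} (h1 : EquivNS51At F Ω L t₀)
    (h2 : EquivNS52At F Ω L t₁) : False := by
  obtain ⟨T, a₁, a₂, -, hND, ⟨-, hc, hr⟩, -⟩ := h1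
  obtain ⟨T', -, ⟨-, -, hr'⟩, -⟩ := h2
  have hmem : scaleField a₁ ∈ radNS51 a₁ a₂ := Submodule.subset_span (Or.inl rfl)
  obtain ⟨X, hX, hXY⟩ := hc (scaleField a₁) (Submodule.mem_sup_right hmem)
  obtain ⟨Y, hY, hXY'⟩ := (hr' ⟨X, hX⟩).1 ((hr ⟨X, hX⟩).2 ⟨_, hmem, hXY⟩)
  obtain ⟨α, β, rfl⟩ := Submodule.mem_span_pair.1 hY
  have h0 : ∀ x, a₁ x = 0 := fun x => by
    have e1 := hXY.2.1 x
    have e2 := hXY'.2.1 x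
    rw [← e2] at e1
    simpa [scaleField, shiftField] using e1
  apply hND 0
  rw [det3_eq]
  simp [h0]

/-- The case distinction is made on `translationFields L`, which does not involve `t₀`; hence one
class serves all times. -/
theorem classification (hF : IsNonlinearCoupled F Ω)
    (hsym : ∀ X ∈ L, X.IsSymmetry F Ω) (hdim : Module.finrank ℝ L = 5)
    (hns : ¬ LieAlgebra.IsSolvable L) (hiso : IsIsotropic L) :
    (∀ t₀, EquivNS51At F Ω L t₀ ∧ ¬ EquivNS52At F Ω L t₀) ∨
      (∀ t₀, EquivNS52At F Ω L t₀ ∧ ¬ EquivNS51At F Ω L t₀) := by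
  by_cases hK : translationFields L = ⊥
  · have h := equivNS51At_of_no_translations hF hsym hdim hns hiso hK
    exact Or.inl fun t₀ => ⟨h t₀, fun h2 => not_equivNS51At_and_equivNS52At (h t₀) h2⟩
  · have h := equivNS52At_of_translations hF hsym hdim hns hiso hK
    exact Or.inr fun t₀ => ⟨h t₀, fun h1 => not_equivNS51At_and_equivNS52At h1 (h t₀)⟩

end

/-! ### The normal forms have the stated symmetries -/

theorem SymField.isSymmetry_add {X Y : SymField} {F : Interaction} {Ω : Domain}
    (hX : X.IsSymmetry F Ω) (hY : Y.IsSymmetry F Ω) : (X + Y).IsSymmetry F Ω := by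
  rw [SymField.isSymmetry_iff] at hX hY ⊢
  intro x p hp
  have h1 := hX x p hp
  have h2 := hY x p hp
  have e : ∀ i, (((dt X.tau).1 p.1 + (dt Y.tau).1 p.1) / 2 + (X.a (site x i) + Y.a (site x i)))
      * p.2 i + ((X.lam (site x i)).1 p.1 + (Y.lam (site x i)).1 p.1)
      = (((dt X.tau).1 p.1 / 2 + X.a (site x i)) * p.2 i + (X.lam (site x i)).1 p.1)
        + (((dt Y.tau).1 p.1 / 2 + Y.a (site x i)) * p.2 i + (Y.lam (site x i)).1 p.1) :=
    fun i => by ring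
  simp only [SymField.DetEq, SymField.tau_add, SymField.a_add, SymField.lam_add, map_add,
    smoothFn.add_apply, e, add_mul _ _ (partialU _ _ _), Finset.sum_add_distrib]
  simp only [SymField.DetEq, add_mul _ _ (partialU _ _ _), Finset.sum_add_distrib] at h1 h2
  linear_combination h1 + h2

theorem SymField.isSymmetry_smul {X : SymField} {F : Interaction} {Ω : Domain} (c : ℝ)
    (hX : X.IsSymmetry F Ω) : (c • X).IsSymmetry F Ω := by
  rw [SymField.isSymmetry_iff] at hX ⊢
  intro x p hp
  have h1 := hX x p hp
  have e : ∀ i, ((c * (dt X.tau).1 p.1 / 2 + c * X.a (site x i)) * p.2 i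
      + c * (X.lam (site x i)).1 p.1) * partialU (F x p.1) i p.2
      = c * ((((dt X.tau).1 p.1 / 2 + X.a (site x i)) * p.2 i
      + (X.lam (site x i)).1 p.1) * partialU (F x p.1) i p.2) := fun i => by ring
  simp only [SymField.DetEq, SymField.tau_smul, SymField.a_smul, SymField.lam_smul,
    Derivation.map_smul, smoothFn.smul_apply, e, ← Finset.mul_sum] at h1 ⊢
  linear_combination c * h1

/-- The symmetries of a system form a linear space. -/
def symmetries (F : Interaction) (Ω : Domain) : Submodule ℝ SymField where
  carrier := {X | X.IsSymmetry F Ω}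
  add_mem' := SymField.isSymmetry_add
  zero_mem' := by
    change (0 : SymField).IsSymmetry F Ω
    rw [SymField.isSymmetry_iff]
    intro x p _
    simp [SymField.DetEq]
  smul_mem' c _ hX := SymField.isSymmetry_smul c hX

@[simp] theorem smoothFn.two_apply (t : ℝ) : (2 : smoothFn).1 t = 2 := rfl

theorem isSl2_standard : IsSl2 1 timeFn (timeFn ^ 2) := by
  constructor <;> ext t <;> (simp; try ring)

theorem one_ne_zero_smoothFn : (1 : smoothFn) ≠ 0 := fun h =>
  one_ne_zero (α := ℝ) (congrArg (fun f : smoothFn => f.1 0) h)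

section

variable {Y₁ Y₂ : SymField}

theorem mem_sl2_sup {X : SymField} : X ∈ Submodule.span ℝ {sl2X1, sl2X2, sl2X3}
      ⊔ Submodule.span ℝ {Y₁, Y₂} ↔ ∃ α β γ δ ε : ℝ,
    X = (α • sl2X1 + β • sl2X2 + γ • sl2X3) + (δ • Y₁ + ε • Y₂) := by
  constructor
  · intro h
    obtain ⟨Y, hY, Z, hZ, rfl⟩ := Submodule.mem_sup.1 h
    obtain ⟨α, β, γ, rfl⟩ := Submodule.mem_span_triple.1 hY
    obtain ⟨δ, ε, rfl⟩ := Submodule.mem_span_pair.1 hZ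
    exact ⟨α, β, γ, δ, ε, rfl⟩
  · rintro ⟨α, β, γ, δ, ε, rfl⟩
    exact Submodule.add_mem_sup (Submodule.mem_span_triple.2 ⟨α, β, γ, rfl⟩)
      (Submodule.mem_span_pair.2 ⟨δ, ε, rfl⟩)

theorem eq_zero_of_tau_eq_zero {α β γ : ℝ}
    (h : α • (1 : smoothFn) + β • timeFn + γ • timeFn ^ 2 = 0) : α = 0 ∧ β = 0 ∧ γ = 0 := by
  have h' := Fintype.linearIndependent_iff.1
    (isSl2_standard.linearIndependent one_ne_zero_smoothFn) ![α, β, γ]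
    (by simpa [Fin.sum_univ_three] using h)
  exact ⟨h' 0, h' 1, h' 2⟩

theorem finrank_sl2_sup (t1 : Y₁.tau = 0) (t2 : Y₂.tau = 0)
    (hind : ∀ δ ε : ℝ, δ • Y₁ + ε • Y₂ = 0 → δ = 0 ∧ ε = 0) :
    Module.finrank ℝ ↥(Submodule.span ℝ {sl2X1, sl2X2, sl2X3} ⊔ Submodule.span ℝ {Y₁, Y₂}) = 5 := by
  have hset : Submodule.span ℝ {sl2X1, sl2X2, sl2X3} ⊔ Submodule.span ℝ {Y₁, Y₂}
      = Submodule.span ℝ (Set.range ![sl2X1, sl2X2, sl2X3, Y₁, Y₂]) := by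
    rw [← Submodule.span_union]
    congr 1
    ext y
    simp [eq_comm]
    tauto
  rw [hset, finrank_span_eq_card]
  · rfl
  rw [Fintype.linearIndependent_iff]
  intro g hg
  have e : (g 0 • sl2X1 + g 1 • sl2X2 + g 2 • sl2X3) + (g 3 • Y₁ + g 4 • Y₂) = 0 := by
    rw [← hg, Fin.sum_univ_five]
    simp [add_assoc]
  have et := congrArg SymField.tau e
  simp only [SymField.tau_add, SymField.tau_smul, t1, t2, smul_zero, add_zero,
    SymField.tau_zero] at et
  obtain ⟨h0, h1, h2⟩ := eq_zero_of_tau_eq_zero et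
  rw [h0, h1, h2] at e
  obtain ⟨h3, h4⟩ := hind (g 3) (g 4) (by simpa using e)
  intro i
  fin_cases i
  exacts [h0, h1, h2, h3, h4]

theorem isSymmetryAlgebra5_of {F : Interaction} {Ω : Domain} (t1 : Y₁.tau = 0) (t2 : Y₂.tau = 0)
    (hind : ∀ δ ε : ℝ, δ • Y₁ + ε • Y₂ = 0 → δ = 0 ∧ ε = 0)
    (hlie : ∀ X ∈ Submodule.span ℝ {sl2X1, sl2X2, sl2X3} ⊔ Submodule.span ℝ {Y₁, Y₂},
      ∀ Y ∈ Submodule.span ℝ {sl2X1, sl2X2, sl2X3} ⊔ Submodule.span ℝ {Y₁, Y₂},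
        ⁅X, Y⁆ ∈ Submodule.span ℝ {sl2X1, sl2X2, sl2X3} ⊔ Submodule.span ℝ {Y₁, Y₂})
    (h1 : sl2X1.IsSymmetry F Ω) (h2 : sl2X2.IsSymmetry F Ω) (h3 : sl2X3.IsSymmetry F Ω)
    (h4 : Y₁.IsSymmetry F Ω) (h5 : Y₂.IsSymmetry F Ω) :
    IsSymmetryAlgebra5 (Submodule.span ℝ {sl2X1, sl2X2, sl2X3} ⊔ Submodule.span ℝ {Y₁, Y₂})
      (Submodule.span ℝ {Y₁, Y₂}) F Ω := by
  let L : LieSubalgebra ℝ SymField :=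
    { Submodule.span ℝ {sl2X1, sl2X2, sl2X3} ⊔ Submodule.span ℝ {Y₁, Y₂} with
      lie_mem' := fun {X Y} hX hY => hlie X hX Y hY }
  have hmem : ∀ X, X ∈ L ↔ ∃ α β γ δ ε : ℝ,
      X = (α • sl2X1 + β • sl2X2 + γ • sl2X3) + (δ • Y₁ + ε • Y₂) := fun X => mem_sl2_sup
  have htau : ∀ α β γ δ ε : ℝ, ((α • sl2X1 + β • sl2X2 + γ • sl2X3) + (δ • Y₁ + ε • Y₂)).tau
      = α • 1 + β • timeFn + γ • timeFn ^ 2 := by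
    intro α β γ δ ε
    simp [t1, t2, sl2X1, sl2X2, sl2X3]
  have hdim : Module.finrank ℝ L = 5 := finrank_sl2_sup t1 t2 hind
  have hfin := finiteDimensional_of_finrank_eq_five hdim
  have hm1 : sl2X1 ∈ L := (hmem _).2 ⟨1, 0, 0, 0, 0, by simp⟩
  have hm2 : sl2X2 ∈ L := (hmem _).2 ⟨0, 1, 0, 0, 0, by simp⟩
  have hm3 : sl2X3 ∈ L := (hmem _).2 ⟨0, 0, 1, 0, 0, by simp⟩
  have hrad := mem_radical_iff L isSl2_standard one_ne_zero_smoothFn ⟨_, hm1, rfl⟩ ⟨_, hm2, rfl⟩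
    ⟨_, hm3, rfl⟩ fun X hX => by
      obtain ⟨α, β, γ, δ, ε, rfl⟩ := (hmem X).1 hX
      rw [htau]
      exact Submodule.mem_span_triple.2 ⟨α, β, γ, rfl⟩
  refine ⟨L, rfl, hdim, fun hsolv => ?_, fun X => ?_, fun X hX => ?_⟩
  · have h := (hrad ⟨sl2X1, hm1⟩).1 (by
      rw [LieAlgebra.radical_eq_top_of_isSolvable]
      exact LieSubmodule.mem_top _)
    exact one_ne_zero_smoothFn h
  · rw [hrad]
    constructor
    · intro h
      obtain ⟨α, β, γ, δ, ε, e⟩ := (hmem X).1 X.2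
      rw [e, htau] at h
      obtain ⟨rfl, rfl, rfl⟩ := eq_zero_of_tau_eq_zero h
      exact Submodule.mem_span_pair.2 ⟨δ, ε, by rw [e]; simp⟩
    · intro h
      obtain ⟨δ, ε, e⟩ := Submodule.mem_span_pair.1 h
      rw [← e]
      simp [t1, t2]
  · obtain ⟨α, β, γ, δ, ε, rfl⟩ := (hmem X).1 hX
    have hs : ∀ {Z : SymField} (c : ℝ), Z.IsSymmetry F Ω → c • Z ∈ symmetries F Ω := fun c hZ =>
      (symmetries F Ω).smul_mem c hZ
    exact add_mem (add_mem (add_mem (hs α h1) (hs β h2)) (hs γ h3)) (add_mem (hs δ h4) (hs ε h5))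

end

/-! #### Brackets in the normal forms -/

theorem lie_mem_algNS51 {a₁ a₂ : Site → ℝ} {X Y : SymField} (hX : X ∈ algNS51 a₁ a₂)
    (hY : Y ∈ algNS51 a₁ a₂) : ⁅X, Y⁆ ∈ algNS51 a₁ a₂ := by
  obtain ⟨α, β, γ, δ, ε, rfl⟩ := mem_sl2_sup.1 hX
  obtain ⟨α', β', γ', δ', ε', rfl⟩ := mem_sl2_sup.1 hY
  refine mem_sl2_sup.2 ⟨α * β' - β * α', 2 * (α * γ' - γ * α'), β * γ' - γ * β', 0, 0, ?_⟩
  ext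
  · simp [sl2X1, sl2X2, sl2X3, scaleField]
    ring
  · simp [sl2X1, sl2X2, sl2X3]
  · simp [sl2X1, sl2X2, sl2X3, scaleField]

theorem lie_mem_algNS52 {X Y : SymField} (hX : X ∈ algNS52) (hY : Y ∈ algNS52) :
    ⁅X, Y⁆ ∈ algNS52 := by
  obtain ⟨α, β, γ, δ, ε, rfl⟩ := mem_sl2_sup.1 hX
  obtain ⟨α', β', γ', δ', ε', rfl⟩ := mem_sl2_sup.1 hY
  refine mem_sl2_sup.2 ⟨α * β' - β * α', 2 * (α * γ' - γ * α'), β * γ' - γ * β',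
    α * ε' + δ * β' / 2 - (α' * ε + δ' * β / 2),
    β * ε' + δ * γ' + ε * β' / 2 - (β' * ε + δ' * γ + ε' * β / 2), ?_⟩
  ext
  · simp [sl2X1, sl2X2, sl2X3, shiftField]
    ring
  · simp [sl2X1, sl2X2, sl2X3, shiftField]
  · simp [sl2X1, sl2X2, sl2X3, shiftField]
    ring

/-! #### Symmetries of interactions that do not depend on time -/

theorem fderiv_of_scaling {g : (Fin 7 → ℝ) → ℝ} {w y : Fin 7 → ℝ} {c : ℝ}
    (hg : DifferentiableAt ℝ g w)
    (h : ∀ s : ℝ, g (fun i => w i * Real.exp (s * y i)) = Real.exp (s * c) * g w) :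
    fderiv ℝ g w (fun i => y i * w i) = c * g w := by
  have hl : HasDerivAt (fun (s : ℝ) i => w i * Real.exp (s * y i)) (fun i => y i * w i) 0 := by
    rw [hasDerivAt_pi]
    intro i
    refine ((((hasDerivAt_id (0 : ℝ)).mul_const (y i)).exp).const_mul (w i)).congr_deriv ?_
    simp
    ring
  have h1 := HasFDerivAt.comp_hasDerivAt (l := g) (0 : ℝ) (by simpa using hg.hasFDerivAt) hl
  have h2 : HasDerivAt (fun s : ℝ => Real.exp (s * c) * g w) (c * g w) 0 := by
    refine ((((hasDerivAt_id (0 : ℝ)).mul_const c).exp).mul_const (g w)).congr_deriv ?_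
    simp
  have e : (g ∘ fun (s : ℝ) i => w i * Real.exp (s * y i)) = fun s => Real.exp (s * c) * g w :=
    funext h
  rw [e] at h1
  exact h1.unique h2

section

variable {G : Site → (Fin 7 → ℝ) → ℝ} {Ω : Domain}

theorem detEq_autonomous_iff (X : SymField) {x : Site} {t : ℝ} {w : Fin 7 → ℝ}
    (hG : DifferentiableAt ℝ (G x) w) : X.DetEq (fun x _ w => G x w) x t w ↔
      (dt (dt (dt X.tau))).1 t / 2 * w 0 + (dt (dt (X.lam x))).1 t
      + (X.a x - 3 / 2 * (dt X.tau).1 t) * G x w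
      = (dt X.tau).1 t / 2 * fderiv ℝ (G x) w w + fderiv ℝ (G x) w (fun i => X.a (site x i) * w i)
        + fderiv ℝ (G x) w (fun i => (X.lam (site x i)).1 t) := by
  have e : (fun i => ((dt X.tau).1 t / 2 + X.a (site x i)) * w i + (X.lam (site x i)).1 t)
      = ((dt X.tau).1 t / 2) • w + (fun i => X.a (site x i) * w i)
        + (fun i => (X.lam (site x i)).1 t) := by
    ext i
    simp
    ring
  rw [SymField.DetEq, sum_mul_partialU hG, e, map_add, map_add, map_smul, deriv_const, mul_zero,
    sub_zero, sub_eq_zero, smul_eq_mul]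

/-- Degree `-3` is the degree for which `(τ̇ / 2)` times the scaling of `G` equals `-(3/2) τ̇ G`;
what remains is the term with the third derivative of `τ`. -/
theorem sl2_isSymmetry (hG : ∀ x, ∀ p ∈ Ω x, DifferentiableAt ℝ (G x) p.2)
    (h3 : ∀ x, ∀ p ∈ Ω x, fderiv ℝ (G x) p.2 p.2 = -3 * G x p.2) {f : smoothFn}
    (hf : dt (dt (dt f)) = 0) :
    (SymField.mk f 0 0).IsSymmetry (fun x _ w => G x w) Ω := by
  rw [SymField.isSymmetry_iff]
  intro x p hp
  rw [detEq_autonomous_iff _ (hG x p hp), h3 x p hp]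
  have h0 : (fun i : Fin 7 => (0 : ℝ)) = 0 := rfl
  simp [hf, h0]
  ring

theorem scaleField_isSymmetry (hG : ∀ x, ∀ p ∈ Ω x, DifferentiableAt ℝ (G x) p.2)
    {a : Site → ℝ} (h : ∀ x, ∀ p ∈ Ω x,
    fderiv ℝ (G x) p.2 (fun i => a (site x i) * p.2 i) = a x * G x p.2) :
    (scaleField a).IsSymmetry (fun x _ w => G x w) Ω := by
  rw [SymField.isSymmetry_iff]
  intro x p hp
  rw [detEq_autonomous_iff _ (hG x p hp)]
  have h0 : (fun i : Fin 7 => (0 : ℝ)) = 0 := rfl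
  simp [scaleField, h x p hp, h0]

theorem shiftField_isSymmetry (hG : ∀ x, ∀ p ∈ Ω x, DifferentiableAt ℝ (G x) p.2)
    {μ : smoothFn} (hμ : dt (dt μ) = 0) (h : ∀ x, ∀ p ∈ Ω x,
    fderiv ℝ (G x) p.2 (fun _ => 1) = 0) :
    (shiftField μ).IsSymmetry (fun x _ w => G x w) Ω := by
  rw [SymField.isSymmetry_iff]
  intro x p hp
  rw [detEq_autonomous_iff _ (hG x p hp)]
  have h0 : (fun i : Fin 7 => (0 : ℝ)) = 0 := rfl
  have h1 : (fun i : Fin 7 => μ.1 p.1) = μ.1 p.1 • fun _ => (1 : ℝ) := by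
    ext
    simp
  simp [shiftField, hμ, h0, h1, h x p hp]

end

/-! ### The converse -/

section

variable {a₁ a₂ : Site → ℝ} {x : Site}

theorem contDiffAt_xiNS51 {w : Fin 7 → ℝ} (hw : ∀ i, w i ≠ 0) :
    ContDiffAt ℝ ∞ (xiNS51 a₁ a₂ x) w := by
  have hpow : ∀ i (c : ℝ), ContDiffAt ℝ ∞ (fun v : Fin 7 → ℝ => |v i| ^ c) w := fun i c =>
    ContDiffAt.rpow_const_of_ne (ContDiffAt.comp w (contDiffAt_abs (hw i))
      (contDiffAt_apply ℝ ℝ i w)) (abs_ne_zero.2 (hw i))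
  rw [contDiffAt_pi]
  intro j
  exact (((hpow 0 _).mul (hpow 1 _)).mul (hpow 2 _)).mul (hpow _ _)

theorem contDiffAt_intNS51 {V : Set (Fin 4 → ℝ)} {f : (Fin 4 → ℝ) → ℝ} (hV : IsOpen V)
    (hf : ContDiffOn ℝ ∞ f V) {w : Fin 7 → ℝ} (hw : ∀ i, w i ≠ 0) (hwV : xiNS51 a₁ a₂ x w ∈ V) :
    ContDiffAt ℝ ∞ (intNS51 a₁ a₂ x f) w :=
  (contDiffAt_factorNS51 hw).mul
    (ContDiffAt.comp w (hf.contDiffAt (hV.mem_nhds hwV)) (contDiffAt_xiNS51 hw))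

/-- By `det3_relation` the invariants do not change, so only the factor contributes a weight. -/
theorem intNS51_scale (hD : det3 a₁ a₂ (site x 0) (site x 1) (site x 2) ≠ 0) {w : Fin 7 → ℝ}
    (hw : ∀ i, w i ≠ 0) (f : (Fin 4 → ℝ) → ℝ) (α β γ : ℝ) :
    intNS51 a₁ a₂ x f (fun i => w i * Real.exp (α * a₁ (site x i) + β * a₂ (site x i) + γ))
      = Real.exp (α * a₁ x + β * a₂ x - 3 * γ) * intNS51 a₁ a₂ x f w := by
  rw [intNS51_eq, factorNS51_scale hD hw, intNS51_eq, mul_assoc]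
  congr 3
  ext j
  rw [xiNS51_scale, det3_relation, sub_self, Real.exp_zero, mul_one]

theorem fderiv_intNS51 (hD : det3 a₁ a₂ (site x 0) (site x 1) (site x 2) ≠ 0) {w : Fin 7 → ℝ}
    (hw : ∀ i, w i ≠ 0) {f : (Fin 4 → ℝ) → ℝ}
    (hf : DifferentiableAt ℝ (intNS51 a₁ a₂ x f) w) (α β γ : ℝ) :
    fderiv ℝ (intNS51 a₁ a₂ x f) w (fun i => (α * a₁ (site x i) + β * a₂ (site x i) + γ) * w i)
      = (α * a₁ x + β * a₂ x - 3 * γ) * intNS51 a₁ a₂ x f w := by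
  refine fderiv_of_scaling hf fun s => ?_
  have := intNS51_scale hD hw f (s * α) (s * β) (s * γ)
  convert this using 4
  · ring_nf
  · ring

end

theorem NonDegenerate.eq_zero {a₁ a₂ : Site → ℝ} (hND : NonDegenerate a₁ a₂) {α β : ℝ} (x : Site)
    (h : ∀ i, α * a₁ (site x i) + β * a₂ (site x i) = 0) : α = 0 ∧ β = 0 := by
  have hD := hND x
  rw [det3_eq] at hD
  have h0 := h 0
  have h1 := h 1
  have h2 := h 2
  constructor
  · refine (mul_eq_zero.1 ?_).resolve_left hD
    linear_combination (a₂ (site x 1) - a₂ (site x 2)) * h0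
      - (a₂ (site x 0) - a₂ (site x 2)) * h1 + (a₂ (site x 0) - a₂ (site x 1)) * h2
  · refine (mul_eq_zero.1 ?_).resolve_left hD
    linear_combination -(a₁ (site x 1) - a₁ (site x 2)) * h0
      + (a₁ (site x 0) - a₁ (site x 2)) * h1 - (a₁ (site x 0) - a₁ (site x 1)) * h2

theorem dt_dt_dt_timeFn_sq : dt (dt (dt (timeFn ^ 2))) = 0 := by
  rw [smoothFn.dt_timeFn_sq, Derivation.map_smul, smoothFn.dt_timeFn, Derivation.map_smul,
    smoothFn.dt_one, smul_zero]

theorem isSymmetryAlgebra5_NS51 (a₁ a₂ : Site → ℝ) (V : Site → Set (Fin 4 → ℝ))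
    (f : Site → (Fin 4 → ℝ) → ℝ) (hND : NonDegenerate a₁ a₂) (hV : ∀ x, IsOpen (V x))
    (hf : ∀ x, ContDiffOn ℝ ∞ (f x) (V x)) :
    IsSymmetryAlgebra5 (algNS51 a₁ a₂) (radNS51 a₁ a₂)
      (fun x _ w => intNS51 a₁ a₂ x (f x) w) (domNS51 a₁ a₂ V) := by
  have hd : ∀ x, ∀ p ∈ domNS51 a₁ a₂ V x, DifferentiableAt ℝ (intNS51 a₁ a₂ x (f x)) p.2 :=
    fun x p hp => (contDiffAt_intNS51 (hV x) (hf x) hp.1 hp.2).differentiableAt (by simp)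
  have h3 : ∀ x, ∀ p ∈ domNS51 a₁ a₂ V x, fderiv ℝ (intNS51 a₁ a₂ x (f x)) p.2 p.2
      = -3 * intNS51 a₁ a₂ x (f x) p.2 := fun x p hp => by
    simpa using fderiv_intNS51 (hND x) hp.1 (hd x p hp) 0 0 1
  refine isSymmetryAlgebra5_of rfl rfl (fun δ ε h => hND.eq_zero 0 fun i => ?_)
    (fun X hX Y hY => lie_mem_algNS51 hX hY) ?_ ?_ ?_ ?_ ?_
  · have := congrArg (fun X : SymField => X.a (site 0 i)) h
    simpa [scaleField] using this
  · exact sl2_isSymmetry hd h3 (by simp)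
  · exact sl2_isSymmetry hd h3 (by simp)
  · exact sl2_isSymmetry hd h3 dt_dt_dt_timeFn_sq
  · exact scaleField_isSymmetry hd fun x p hp => by
      simpa using fderiv_intNS51 (hND x) hp.1 (hd x p hp) 1 0 0
  · exact scaleField_isSymmetry hd fun x p hp => by
      simpa using fderiv_intNS51 (hND x) hp.1 (hd x p hp) 0 1 0

theorem contDiffAt_xiNS52 {w : Fin 7 → ℝ} (hw : w 0 ≠ w 1) : ContDiffAt ℝ ∞ xiNS52 w := by
  have hc : ∀ i : Fin 7, ContDiffAt ℝ ∞ (fun v : Fin 7 → ℝ => v i) w := fun i =>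
    contDiffAt_apply ℝ ℝ i w
  rw [contDiffAt_pi]
  exact fun j => ((hc 0).sub (hc _)).div ((hc 0).sub (hc 1)) (sub_ne_zero.2 hw)

theorem contDiffAt_intNS52 {V : Set (Fin 5 → ℝ)} {f : (Fin 5 → ℝ) → ℝ} (hV : IsOpen V)
    (hf : ContDiffOn ℝ ∞ f V) {w : Fin 7 → ℝ} (hw : w 0 ≠ w 1) (hwV : xiNS52 w ∈ V) :
    ContDiffAt ℝ ∞ (intNS52 f) w := by
  have hc : ∀ i : Fin 7, ContDiffAt ℝ ∞ (fun v : Fin 7 → ℝ => v i) w := fun i =>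
    contDiffAt_apply ℝ ℝ i w
  exact ((((hc 0).sub (hc 1)).pow 3).inv (pow_ne_zero 3 (sub_ne_zero.2 hw))).mul
    (ContDiffAt.comp w (hf.contDiffAt (hV.mem_nhds hwV)) (contDiffAt_xiNS52 hw))

theorem fderiv_intNS52_self {f : (Fin 5 → ℝ) → ℝ} {w : Fin 7 → ℝ}
    (hf : DifferentiableAt ℝ (intNS52 f) w) :
    fderiv ℝ (intNS52 f) w w = -3 * intNS52 f w := by
  have := fderiv_of_scaling (y := fun _ => 1) (c := -3) hf fun s => ?_
  · simpa using this
  · have hx : xiNS52 (fun i => w i * Real.exp (s * 1)) = xiNS52 w := by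
      ext j
      simp only [xiNS52]
      rw [← sub_mul, ← sub_mul, mul_div_mul_right _ _ (Real.exp_pos _).ne']
    rw [intNS52, intNS52, hx, ← sub_mul, mul_pow, mul_inv, ← Real.exp_nat_mul, ← Real.exp_neg,
      mul_one, show -((3 : ℕ) * s : ℝ) = s * -3 by push_cast; ring]
    ring

theorem fderiv_intNS52_one {f : (Fin 5 → ℝ) → ℝ} {w : Fin 7 → ℝ}
    (hf : DifferentiableAt ℝ (intNS52 f) w) :
    fderiv ℝ (intNS52 f) w (fun _ => 1) = 0 := by
  have hl : HasDerivAt (fun (s : ℝ) i => w i + s) (fun _ : Fin 7 => 1) 0 := by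
    rw [hasDerivAt_pi]
    exact fun i => (hasDerivAt_id (0 : ℝ)).const_add (w i)
  have h1 := HasFDerivAt.comp_hasDerivAt (l := intNS52 f) (0 : ℝ) (by simpa using hf.hasFDerivAt) hl
  have e : (intNS52 f ∘ fun (s : ℝ) i => w i + s) = fun _ => intNS52 f w := by
    ext s
    simp only [Function.comp_apply, intNS52]
    have hx : xiNS52 (fun i => w i + s) = xiNS52 w := by
      ext j
      simp [xiNS52]
    rw [hx, add_sub_add_right_eq_sub]
  rw [e] at h1
  exact h1.unique (hasDerivAt_const _ _)

theorem isSymmetryAlgebra5_NS52 (V : Site → Set (Fin 5 → ℝ)) (f : Site → (Fin 5 → ℝ) → ℝ)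
    (hV : ∀ x, IsOpen (V x)) (hf : ∀ x, ContDiffOn ℝ ∞ (f x) (V x)) :
    IsSymmetryAlgebra5 algNS52 radNS52 (fun x _ w => intNS52 (f x) w) (domNS52 V) := by
  have hd : ∀ x, ∀ p ∈ domNS52 V x, DifferentiableAt ℝ (intNS52 (f x)) p.2 :=
    fun x p hp => (contDiffAt_intNS52 (hV x) (hf x) hp.1 hp.2).differentiableAt (by simp)
  have h3 : ∀ x, ∀ p ∈ domNS52 V x, fderiv ℝ (intNS52 (f x)) p.2 p.2
      = -3 * intNS52 (f x) p.2 := fun x p hp => fderiv_intNS52_self (hd x p hp)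
  have h1 : ∀ x, ∀ p ∈ domNS52 V x, fderiv ℝ (intNS52 (f x)) p.2 (fun _ => 1) = 0 :=
    fun x p hp => fderiv_intNS52_one (hd x p hp)
  refine isSymmetryAlgebra5_of rfl rfl (fun δ ε h => ?_)
    (fun X hX Y hY => lie_mem_algNS52 hX hY) ?_ ?_ ?_ ?_ ?_
  · have e := fun t => congrArg (fun X : SymField => (X.lam 0).1 t) h
    have e0 := e 0
    have e1 := e 1
    simp [shiftField] at e0 e1
    rw [e0, zero_add] at e1
    exact ⟨e0, e1⟩
  · exact sl2_isSymmetry hd h3 (by simp)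
  · exact sl2_isSymmetry hd h3 (by simp)
  · exact sl2_isSymmetry hd h3 dt_dt_dt_timeFn_sq
  · exact shiftField_isSymmetry hd (by simp) h1
  · exact shiftField_isSymmetry hd (by simp) h1

/-! ### Maximality -/

theorem smoothFn.exists_const {f : smoothFn} (h : dt f = 0) : ∃ c : ℝ, f = c • 1 := by
  refine ⟨f.1 0, ?_⟩
  ext t
  have := is_const_of_deriv_eq_zero (fun s => (smoothFn.hasDerivAt f s).differentiableAt)
    (fun s => congrArg (fun g : smoothFn => g.1 s) h) t 0
  simpa using this

theorem smoothFn.exists_affine {f : smoothFn} (h : dt (dt f) = 0) :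
    ∃ c d : ℝ, f = c • 1 + d • timeFn := by
  obtain ⟨d, hd⟩ := smoothFn.exists_const h
  obtain ⟨c, hc⟩ := smoothFn.exists_const (f := f - d • timeFn) (by
    rw [map_sub, hd, Derivation.map_smul, smoothFn.dt_timeFn, sub_self])
  exact ⟨c, d, by rw [← hc, sub_add_cancel]⟩

theorem smoothFn.exists_quadratic {f : smoothFn} (h : dt (dt (dt f)) = 0) :
    ∃ c d e : ℝ, f = c • 1 + d • timeFn + e • timeFn ^ 2 := by
  obtain ⟨d, e, hd⟩ := smoothFn.exists_affine h
  obtain ⟨c, hc⟩ := smoothFn.exists_const (f := f - (d • timeFn + (e / 2) • timeFn ^ 2)) (by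
    rw [map_sub, hd, map_add, Derivation.map_smul, Derivation.map_smul, smoothFn.dt_timeFn,
      smoothFn.dt_timeFn_sq]
    module)
  refine ⟨c, d, e / 2, ?_⟩
  rw [← hc]
  abel

/-- A function on the lattice that is invariant under two independent steps is constant. -/
theorem eq_of_steps {α : Type*} {g : Site → α} (h1 : ∀ x, g (site x 1) = g x)
    (h2 : ∀ x, g (site x 2) = g x) (x : Site) : g x = g 0 := by
  have e1 : ∀ n m : ℤ, g (n + 1, m) = g (n, m) := fun n m => by
    simpa [site, offset] using h1 (n, m)
  have e2 : ∀ n m : ℤ, g (n, m + 1) = g (n, m) := fun n m => by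
    simpa [site, offset] using h2 (n, m)
  have c1 : ∀ n m : ℤ, g (n, m) = g (0, m) := fun n m => by
    induction n with
    | zero => rfl
    | succ k ih => rw [e1, ih]
    | pred k ih =>
      rw [← ih, ← e1, sub_add_cancel]
  have c2 : ∀ m : ℤ, g (0, m) = g (0, 0) := fun m => by
    induction m with
    | zero => rfl
    | succ k ih => rw [e2, ih]
    | pred k ih =>
      rw [← ih, ← e2, sub_add_cancel]
  rw [show x = (x.1, x.2) from rfl, c1, c2]
  rfl

/-- The terms of the determining equation separate under scaling. -/
theorem eq_zero_of_scaling {A B C D : ℝ}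
    (h : ∀ s : ℝ, 0 < s → A * s ^ 5 + B * s ^ 4 + C * s + D = 0) :
    A = 0 ∧ B = 0 ∧ C = 0 ∧ D = 0 := by
  have h1 := h 1 (by norm_num)
  have h2 := h 2 (by norm_num)
  have h3 := h 3 (by norm_num)
  have h4 := h 4 (by norm_num)
  refine ⟨?_, ?_, ?_, ?_⟩ <;> linarith

theorem partialU_partialU_self (g : (Fin 7 → ℝ) → ℝ) (i : Fin 7) (w : Fin 7 → ℝ) :
    partialU (partialU g i) i w = deriv (deriv fun r => g (Function.update w i r)) (w i) := by
  simp only [partialU, Function.update_idem, Function.update_self]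

/-- A point is a limit of points where a function does not vanish if the function does not vanish
identically along a curve through it. -/
theorem mem_closure_of_curve {S : Set (ℝ × (Fin 7 → ℝ))} {D : ℝ × (Fin 7 → ℝ) → ℝ}
    {p : ℝ × (Fin 7 → ℝ)} (hS : IsOpen S) (hp : p ∈ S) {γ : ℝ → Fin 7 → ℝ} (hγ : ContinuousAt γ 0)
    (hγ0 : γ 0 = p.2) (h : ¬ ∀ᶠ s in nhds 0, D (p.1, γ s) = 0) :
    p ∈ closure {q ∈ S | D q ≠ 0} := by
  by_contra hcl
  apply h
  have hc : ContinuousAt (fun s => (p.1, γ s)) 0 := continuousAt_const.prodMk hγ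
  have e0 : (p.1, γ 0) = p := by rw [hγ0]
  have h1 := hc.eventually_mem (by rw [e0]; exact hS.mem_nhds hp)
  have h2 := hc.eventually_mem (by
    rw [e0]
    exact isClosed_closure.isOpen_compl.mem_nhds hcl)
  filter_upwards [h1, h2] with s hs1 hs2
  by_contra h0
  exact hs2 (subset_closure ⟨hs1, h0⟩)

/-! #### An interaction of `NS_{5,2}` with no further symmetries -/

/-- The function `1 + ∑ ξ²`. -/
def quadF (ξ : Fin 5 → ℝ) : ℝ := 1 + ∑ j, ξ j ^ 2

theorem contDiff_quadF : ContDiff ℝ ∞ quadF := by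
  unfold quadF
  fun_prop

theorem isOpen_domNS52 (x : Site) : IsOpen (domNS52 (fun _ => Set.univ) x) := by
  have : domNS52 (fun _ => Set.univ) x = {p : ℝ × (Fin 7 → ℝ) | p.2 0 ≠ p.2 1} := by
    ext p
    simp [domNS52]
  rw [this]
  exact isOpen_ne_fun (by fun_prop) (by fun_prop)

theorem mem_domNS52_univ {x : Site} {p : ℝ × (Fin 7 → ℝ)} :
    p ∈ domNS52 (fun _ => Set.univ) x ↔ p.2 0 ≠ p.2 1 := by
  simp [domNS52]

theorem differentiableAt_quadF {w : Fin 7 → ℝ} (hw : w 0 ≠ w 1) :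
    DifferentiableAt ℝ (intNS52 quadF) w :=
  (contDiffAt_intNS52 isOpen_univ contDiff_quadF.contDiffOn hw trivial).differentiableAt (by simp)

theorem intNS52_quadF (w : Fin 7 → ℝ) : intNS52 quadF w = ((w 0 - w 1) ^ 3)⁻¹ * (1 +
    (((w 0 - w 2) / (w 0 - w 1)) ^ 2 + ((w 0 - w 3) / (w 0 - w 1)) ^ 2
    + ((w 0 - w 4) / (w 0 - w 1)) ^ 2 + ((w 0 - w 5) / (w 0 - w 1)) ^ 2
    + ((w 0 - w 6) / (w 0 - w 1)) ^ 2)) := by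
  rw [intNS52, quadF, Fin.sum_univ_five]
  rfl

/-- The derivative of the interaction, multiplied by `(u_{nm} - u_{n+1m})^6`. -/
theorem fderiv_quadF {w : Fin 7 → ℝ} (hw : w 0 ≠ w 1) (v : Fin 7 → ℝ) :
    (w 0 - w 1) ^ 6 * fderiv ℝ (intNS52 quadF) w v
      = -(3 * (w 0 - w 1) ^ 2 + 5 * ((w 0 - w 2) ^ 2 + (w 0 - w 3) ^ 2 + (w 0 - w 4) ^ 2
          + (w 0 - w 5) ^ 2 + (w 0 - w 6) ^ 2)) * (v 0 - v 1)
        + 2 * (w 0 - w 1) * ((w 0 - w 2) * (v 0 - v 2) + (w 0 - w 3) * (v 0 - v 3)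
          + (w 0 - w 4) * (v 0 - v 4) + (w 0 - w 5) * (v 0 - v 5) + (w 0 - w 6) * (v 0 - v 6)) := by
  have hρ := sub_ne_zero.2 hw
  have hl : HasDerivAt (fun s : ℝ => w + s • v) v 0 := by
    simpa using ((hasDerivAt_id (0 : ℝ)).smul_const v).const_add w
  have hd : ∀ i : Fin 7, HasDerivAt (fun s : ℝ => (w 0 + s * v 0) - (w i + s * v i)) (v 0 - v i) 0 :=
    fun i => by
      refine ((((hasDerivAt_id (0 : ℝ)).mul_const (v 0)).const_add (w 0)).sub
        (((hasDerivAt_id (0 : ℝ)).mul_const (v i)).const_add (w i))).congr_deriv ?_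
      simp
  have h1 := HasFDerivAt.comp_hasDerivAt (l := intNS52 quadF) (0 : ℝ)
    (by simpa using (differentiableAt_quadF hw).hasFDerivAt) hl
  have hρ0 : (w 0 + (0 : ℝ) * v 0) - (w 1 + (0 : ℝ) * v 1) ≠ 0 := by simpa using hρ
  have hq := fun i => ((hd i).div (hd 1) hρ0).pow 2
  have h2 := (((hd 1).pow 3).inv (pow_ne_zero 3 hρ0)).mul
    (((((hq 2).add (hq 3)).add (hq 4)).add (hq 5)).add (hq 6) |>.const_add 1)
  have e : intNS52 quadF ∘ (fun s : ℝ => w + s • v) = _ := funext fun s => intNS52_quadF (w + s • v)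
  rw [e] at h1
  have h3 := h1.unique h2
  rw [h3]
  simp only [Pi.pow_apply, Pi.add_apply, Pi.div_apply, zero_mul, add_zero]
  norm_num
  field_simp
  ring

/-- Three test points are enough to detect a nonzero quadratic polynomial by its second difference.
-/
theorem exists_pos_of_eventually {P : ℝ → Prop} (h : ∀ᶠ s in nhds (0 : ℝ), P s) :
    ∃ ε > 0, P 0 ∧ P ε ∧ P (-ε) := by
  obtain ⟨δ, hδ, hb⟩ := Metric.eventually_nhds_iff.1 h
  refine ⟨δ / 2, by positivity, h.self_of_nhds, hb ?_, hb ?_⟩ <;>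
  · simp [abs_of_pos hδ]
    linarith

theorem partialU_quadF {w : Fin 7 → ℝ} (hw : w 0 ≠ w 1) (i : Fin 7) :
    (w 0 - w 1) ^ 6 * partialU (intNS52 quadF) i w
      = -(3 * (w 0 - w 1) ^ 2 + 5 * ((w 0 - w 2) ^ 2 + (w 0 - w 3) ^ 2 + (w 0 - w 4) ^ 2
          + (w 0 - w 5) ^ 2 + (w 0 - w 6) ^ 2))
          * ((Pi.single i 1 : Fin 7 → ℝ) 0 - (Pi.single i 1 : Fin 7 → ℝ) 1)
        + 2 * (w 0 - w 1) * ((w 0 - w 2)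
            * ((Pi.single i 1 : Fin 7 → ℝ) 0 - (Pi.single i 1 : Fin 7 → ℝ) 2)
          + (w 0 - w 3) * ((Pi.single i 1 : Fin 7 → ℝ) 0 - (Pi.single i 1 : Fin 7 → ℝ) 3)
          + (w 0 - w 4) * ((Pi.single i 1 : Fin 7 → ℝ) 0 - (Pi.single i 1 : Fin 7 → ℝ) 4)
          + (w 0 - w 5) * ((Pi.single i 1 : Fin 7 → ℝ) 0 - (Pi.single i 1 : Fin 7 → ℝ) 5)
          + (w 0 - w 6) * ((Pi.single i 1 : Fin 7 → ℝ) 0 - (Pi.single i 1 : Fin 7 → ℝ) 6)) := by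
  rw [partialU_eq_fderiv (differentiableAt_quadF hw), fderiv_quadF hw]

/-- After multiplication by `(w 0 - w 1) ^ 6` the derivatives are polynomials. In a slot `k ≥ 2` it
is a nonconstant affine function of `w k`; in slot `0` it is quadratic in `w 2` with leading
coefficient `-5`; in slot `1` it is positive. -/
theorem coupled_quadF (i : Fin 7) {w : Fin 7 → ℝ} (hw : w 0 ≠ w 1) :
    ∃ γ : ℝ → Fin 7 → ℝ, ContinuousAt γ 0 ∧ γ 0 = w ∧
      ¬ ∀ᶠ s in nhds 0, partialU (intNS52 quadF) i (γ s) = 0 := by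
  have hρ := sub_ne_zero.2 hw
  have hcont : ∀ k : Fin 7, ContinuousAt (fun s : ℝ => Function.update w k (w k + s)) 0 := fun k =>
    (continuous_const.update k (by fun_prop)).continuousAt
  have h0 : ∀ k : Fin 7, Function.update w k (w k + 0) = w := fun k => by simp
  have key : ∀ k : Fin 7, 2 ≤ k → ∀ s : ℝ, Function.update w k (w k + s) 0
      ≠ Function.update w k (w k + s) 1 := fun k hk s => by
    rwa [Function.update_of_ne (by rintro rfl; omega), Function.update_of_ne (by rintro rfl; omega)]
  have step : ∀ k : Fin 7, 2 ≤ k → ¬ ∀ᶠ s in nhds (0 : ℝ),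
      partialU (intNS52 quadF) k (Function.update w k (w k + s)) = 0 := by
    intro k hk h
    obtain ⟨ε, hε, z0, z1, -⟩ := exists_pos_of_eventually h
    have e0 := partialU_quadF (key k hk 0) k
    have e1 := partialU_quadF (key k hk ε) k
    rw [z0, mul_zero] at e0
    rw [z1, mul_zero] at e1
    have : (w 0 - w 1) * ε = 0 := by
      fin_cases k
      · exact absurd hk (by decide)
      · exact absurd hk (by decide)
      all_goals
        simp [Function.update] at e0 e1
        grind
    exact (mul_ne_zero hρ hε.ne') this
  fin_cases i
  · refine ⟨_, hcont 2, h0 2, fun h => ?_⟩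
    obtain ⟨ε, hε, z0, z1, z2⟩ := exists_pos_of_eventually h
    have e0 := partialU_quadF (key 2 le_rfl 0) 0
    have e1 := partialU_quadF (key 2 le_rfl ε) 0
    have e2 := partialU_quadF (key 2 le_rfl (-ε)) 0
    simp only [Fin.zero_eta] at z0 z1 z2
    rw [z0, mul_zero] at e0
    rw [z1, mul_zero] at e1
    rw [z2, mul_zero] at e2
    simp [Function.update] at e0 e1 e2
    have : ε ^ 2 = 0 := by linear_combination (e1 + e2 - 2 * e0) / 10
    exact hε.ne' (pow_eq_zero_iff two_ne_zero |>.1 this)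
  · refine ⟨_, hcont 2, h0 2, fun h => ?_⟩
    have z := h.self_of_nhds
    simp only [Fin.mk_one] at z
    rw [h0] at z
    have e := partialU_quadF hw 1
    rw [z] at e
    simp at e
    have := pow_pos (abs_pos.2 hρ) 2
    rw [sq_abs] at this
    nlinarith [sq_nonneg (w 0 - w 2), sq_nonneg (w 0 - w 3), sq_nonneg (w 0 - w 4),
      sq_nonneg (w 0 - w 5), sq_nonneg (w 0 - w 6)]
  · exact ⟨_, hcont 2, h0 2, step 2 (by decide)⟩
  · exact ⟨_, hcont 3, h0 3, step 3 (by decide)⟩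
  · exact ⟨_, hcont 4, h0 4, step 4 (by decide)⟩
  · exact ⟨_, hcont 5, h0 5, step 5 (by decide)⟩
  · exact ⟨_, hcont 6, h0 6, step 6 (by decide)⟩

theorem isNonlinearCoupled_quadF :
    IsNonlinearCoupled (fun _ _ w => intNS52 quadF w) (domNS52 fun _ => Set.univ) where
  isOpen := isOpen_domNS52
  smooth x p hp := (ContDiffAt.comp (g := intNS52 quadF) p (contDiffAt_intNS52 isOpen_univ
    contDiff_quadF.contDiffOn hp.1 trivial) contDiffAt_snd).contDiffWithinAt
  nonlinear x := by
    refine ⟨(0, ![1, 0, 0, 0, 0, 0, 0]), mem_domNS52_univ.2 (by simp), 2, 2, ?_⟩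
    change partialU (partialU (intNS52 quadF) 2) 2 ![1, 0, 0, 0, 0, 0, 0] ≠ 0
    rw [partialU_partialU_self]
    have e : (fun r => intNS52 quadF (Function.update ![1, 0, 0, 0, 0, 0, 0] 2 r))
        = fun r => 5 + (1 - r) ^ 2 := by
      ext r
      rw [intNS52_quadF]
      simp [Function.update]
      ring
    have d1 : ∀ r : ℝ, HasDerivAt (fun r : ℝ => 5 + (1 - r) ^ 2) (-2 * (1 - r)) r := fun r => by
      refine ((((hasDerivAt_id r).const_sub 1).pow 2).const_add 5).congr_deriv ?_
      simp
    have d2 : ∀ r : ℝ, HasDerivAt (fun r : ℝ => -2 * (1 - r)) 2 r := fun r => by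
      refine (((hasDerivAt_id r).const_sub 1).const_mul (-2)).congr_deriv ?_
      norm_num
    rw [e, funext fun r => (d1 r).deriv, (d2 _).deriv]
    norm_num
  coupled x i p hp := by
    obtain ⟨γ, hγ, hγ0, h⟩ := coupled_quadF i (w := p.2) hp.1
    exact mem_closure_of_curve (D := fun q => partialU (intNS52 quadF) i q.2) (isOpen_domNS52 x) hp
      hγ hγ0 h

/-- The determining equations for the symmetries of an autonomous system that is homogeneous of
degree `-3` separate. -/
theorem detEq_separate {X : SymField} {G : Site → (Fin 7 → ℝ) → ℝ} {x : Site} {t : ℝ}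
    {w : Fin 7 → ℝ} (hG : ∀ s : ℝ, 0 < s → DifferentiableAt ℝ (G x) (s • w))
    (hX : ∀ s : ℝ, 0 < s → X.DetEq (fun x _ w => G x w) x t (s • w))
    (hs : ∀ s : ℝ, 0 < s → G x (s • w) = (s ^ 3)⁻¹ * G x w)
    (hd : ∀ s : ℝ, 0 < s → ∀ v, fderiv ℝ (G x) (s • w) v = (s ^ 4)⁻¹ * fderiv ℝ (G x) w v)
    (h3 : fderiv ℝ (G x) w w = -3 * G x w) :
    (dt (dt (dt X.tau))).1 t * w 0 = 0 ∧ (dt (dt (X.lam x))).1 t = 0 ∧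
    X.a x * G x w = fderiv ℝ (G x) w (fun i => X.a (site x i) * w i) ∧
    fderiv ℝ (G x) w (fun i => (X.lam (site x i)).1 t) = 0 := by
  -- At `s • w`, after multiplication by `s⁴`, the third derivative of `τ` enters with `s⁵`, the
  -- second derivative of `λ` with `s⁴`, the multipliers with `s` and the derivative along `λ` with
  -- `s⁰`. The terms in `τ̇` cancel by homogeneity.
  have key := eq_zero_of_scaling (A := (dt (dt (dt X.tau))).1 t / 2 * w 0)
    (B := (dt (dt (X.lam x))).1 t)
    (C := X.a x * G x w - fderiv ℝ (G x) w (fun i => X.a (site x i) * w i))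
    (D := -fderiv ℝ (G x) w (fun i => (X.lam (site x i)).1 t)) ?_
  · refine ⟨?_, key.2.1, sub_eq_zero.1 key.2.2.1, neg_eq_zero.1 key.2.2.2⟩
    linear_combination 2 * key.1
  intro s hs0
  have e := (detEq_autonomous_iff X (hG s hs0)).1 (hX s hs0)
  have ea : (fun i => X.a (site x i) * (s • w) i) = s • fun i => X.a (site x i) * w i := by
    ext i
    simp
    ring
  rw [ea, hd s hs0, hd s hs0, hd s hs0, map_smul, map_smul, h3, hs s hs0] at e
  simp only [Pi.smul_apply, smul_eq_mul] at e
  have hs' := hs0.ne'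
  field_simp at e
  linear_combination (1 / 2) * e

theorem intNS52_smul (f : (Fin 5 → ℝ) → ℝ) {s : ℝ} (hs : 0 < s) (w : Fin 7 → ℝ) :
    intNS52 f (s • w) = (s ^ 3)⁻¹ * intNS52 f w := by
  have hx : xiNS52 (s • w) = xiNS52 w := by
    ext j
    simp only [xiNS52, Pi.smul_apply, smul_eq_mul]
    rw [← mul_sub, ← mul_sub, mul_div_mul_left _ _ hs.ne']
  rw [intNS52, intNS52, hx, Pi.smul_apply, Pi.smul_apply, smul_eq_mul, smul_eq_mul, ← mul_sub,
    mul_pow, mul_inv, mul_assoc]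

theorem fderiv_quadF_smul {s : ℝ} (hs : 0 < s) {w : Fin 7 → ℝ} (hw : w 0 ≠ w 1) (v : Fin 7 → ℝ) :
    fderiv ℝ (intNS52 quadF) (s • w) v = (s ^ 4)⁻¹ * fderiv ℝ (intNS52 quadF) w v := by
  have hρ := sub_ne_zero.2 hw
  have hs' := hs.ne'
  have h1 := fderiv_quadF hw v
  have h2 := fderiv_quadF (w := s • w) (by simpa [hs'] using hw) v
  simp only [Pi.smul_apply, smul_eq_mul] at h2
  apply mul_left_cancel₀ (pow_ne_zero 6 (mul_ne_zero hs' hρ))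
  have e : (s * (w 0 - w 1)) ^ 6 * ((s ^ 4)⁻¹ * fderiv ℝ (intNS52 quadF) w v)
      = s ^ 2 * ((w 0 - w 1) ^ 6 * fderiv ℝ (intNS52 quadF) w v) := by
    field_simp
  rw [e, h1, mul_sub, h2]
  ring

theorem fderiv_quadF_add_one {w : Fin 7 → ℝ} (hw : w 0 ≠ w 1) (v : Fin 7 → ℝ) :
    fderiv ℝ (intNS52 quadF) (fun i => w i + 1) v = fderiv ℝ (intNS52 quadF) w v := by
  have h1 := fderiv_quadF hw v
  have h2 := fderiv_quadF (w := fun i => w i + 1) (by simpa using hw) v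
  simp only [add_sub_add_right_eq_sub] at h2
  exact mul_left_cancel₀ (pow_ne_zero 6 (sub_ne_zero.2 hw)) (h2.trans h1.symm)

/-- At test points where the values in slots `2` to `6` equal `w 0`, with at most one exception, a
single difference `c 0 - c i` is isolated. -/
theorem eq_of_fderiv_quadF {c : Fin 7 → ℝ}
    (h : ∀ w : Fin 7 → ℝ, w 0 ≠ w 1 → fderiv ℝ (intNS52 quadF) w c = 0) (i : Fin 7) :
    c i = c 0 := by
  have key : ∀ w : Fin 7 → ℝ, w 0 ≠ w 1 →
      -(3 * (w 0 - w 1) ^ 2 + 5 * ((w 0 - w 2) ^ 2 + (w 0 - w 3) ^ 2 + (w 0 - w 4) ^ 2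
          + (w 0 - w 5) ^ 2 + (w 0 - w 6) ^ 2)) * (c 0 - c 1)
        + 2 * (w 0 - w 1) * ((w 0 - w 2) * (c 0 - c 2) + (w 0 - w 3) * (c 0 - c 3)
          + (w 0 - w 4) * (c 0 - c 4) + (w 0 - w 5) * (c 0 - c 5)
          + (w 0 - w 6) * (c 0 - c 6)) = 0 := fun w hw => by
    rw [← fderiv_quadF hw, h w hw, mul_zero]
  have h1 : c 0 - c 1 = 0 := by
    simpa using key ![1, 0, 1, 1, 1, 1, 1] (by simp)
  rw [h1] at key
  fin_cases i
  · rfl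
  · exact (sub_eq_zero.1 h1).symm
  · exact (sub_eq_zero.1 (by simpa using key ![1, 0, 0, 1, 1, 1, 1] (by simp))).symm
  · exact (sub_eq_zero.1 (by simpa using key ![1, 0, 1, 0, 1, 1, 1] (by simp))).symm
  · exact (sub_eq_zero.1 (by simpa using key ![1, 0, 1, 1, 0, 1, 1] (by simp))).symm
  · exact (sub_eq_zero.1 (by simpa using key ![1, 0, 1, 1, 1, 0, 1] (by simp))).symm
  · exact (sub_eq_zero.1 (by simpa using key ![1, 0, 1, 1, 1, 1, 0] (by simp))).symm

theorem mem_algNS52_of_isSymmetry {X : SymField}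
    (hX : X.IsSymmetry (fun _ _ w => intNS52 quadF w) (domNS52 fun _ => Set.univ)) :
    X ∈ algNS52 := by
  rw [SymField.isSymmetry_iff] at hX
  have sep := fun (x : Site) (t : ℝ) (w : Fin 7 → ℝ) (hw : w 0 ≠ w 1) =>
    have hsw : ∀ s : ℝ, 0 < s → (s • w) 0 ≠ (s • w) 1 := fun s hs => by simpa [hs.ne'] using hw
    detEq_separate (X := X) (G := fun _ => intNS52 quadF) (x := x) (t := t) (w := w)
      (fun s hs => differentiableAt_quadF (hsw s hs))
      (fun s hs => hX x (t, s • w) (mem_domNS52_univ.2 (hsw s hs)))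
      (fun s hs => intNS52_smul quadF hs w) (fun s hs v => fderiv_quadF_smul hs hw v)
      (fderiv_intNS52_self (differentiableAt_quadF hw))
  have hw₀ : (![1, 0, 1, 1, 1, 1, 1] : Fin 7 → ℝ) 0 ≠ (![1, 0, 1, 1, 1, 1, 1] : Fin 7 → ℝ) 1 := by
    simp
  have htau : dt (dt (dt X.tau)) = 0 := by
    ext t
    simpa using (sep 0 t _ hw₀).1
  have hlam2 : ∀ x, dt (dt (X.lam x)) = 0 := fun x => by
    ext t
    exact (sep x t _ hw₀).2.1
  have hlam : ∀ x i, X.lam (site x i) = X.lam x := fun x i => by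
    ext t
    have := eq_of_fderiv_quadF (fun w hw => (sep x t w hw).2.2.2) i
    rwa [site_zero] at this
  have ha : ∀ x, X.a x = 0 := by
    intro x
    -- Comparing the scaling equation at `w` and at `w + 1`, between which the interaction does not
    -- change, shows that the derivative along the vector of multipliers vanishes.
    have hc := eq_of_fderiv_quadF (c := fun i => X.a (site x i)) fun w hw => by
      have e1 := (sep x 0 w hw).2.2.1
      have e2 := (sep x 0 (fun i => w i + 1) (by simpa using hw)).2.2.1
      have eG : intNS52 quadF (fun i => w i + 1) = intNS52 quadF w := by
        rw [intNS52_quadF, intNS52_quadF]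
        simp only [add_sub_add_right_eq_sub]
      have ev : (fun i => X.a (site x i) * (w i + 1))
          = (fun i => X.a (site x i) * w i) + fun i => X.a (site x i) := by
        ext i
        simp
        ring
      rw [eG, fderiv_quadF_add_one hw, ev, map_add, ← e1] at e2
      linarith
    -- Once the multipliers on `Γ` all equal `X.a x`, homogeneity gives `a G = -3 a G`, hence `a =
    -- 0`.
    have e := (sep x 0 _ hw₀).2.2.1
    have ev : (fun i => X.a (site x i) * (![1, 0, 1, 1, 1, 1, 1] : Fin 7 → ℝ) i)
        = X.a x • ![1, 0, 1, 1, 1, 1, 1] := by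
      ext i
      rw [hc i, site_zero]
      rfl
    rw [ev, map_smul, fderiv_intNS52_self (differentiableAt_quadF hw₀), intNS52_quadF] at e
    simp at e
    linarith
  obtain ⟨α, β, γ, hτ⟩ := smoothFn.exists_quadratic htau
  obtain ⟨δ, ε, hl⟩ := smoothFn.exists_affine (hlam2 0)
  refine mem_sl2_sup.2 ⟨α, β, γ, δ, ε, ?_⟩
  refine SymField.ext' ?_ (fun x => ?_) fun x => ?_
  · rw [hτ]
    simp [sl2X1, sl2X2, sl2X3, shiftField]
  · rw [ha x]
    simp [sl2X1, sl2X2, sl2X3, shiftField]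
  · rw [eq_of_steps (fun y => hlam y 1) (fun y => hlam y 2) x, hl]
    simp [sl2X1, sl2X2, sl2X3, shiftField]

theorem maximality_NS52 : ∃ f : Site → (Fin 5 → ℝ) → ℝ,
    (∀ x, ContDiff ℝ ∞ (f x)) ∧
    IsNonlinearCoupled (fun x _ w => intNS52 (f x) w) (domNS52 fun _ => Set.univ) ∧
    ∀ X : SymField, X.IsSymmetry (fun x _ w => intNS52 (f x) w)
      (domNS52 fun _ => Set.univ) ↔ X ∈ algNS52 := by
  refine ⟨fun _ => quadF, fun _ => contDiff_quadF, isNonlinearCoupled_quadF, fun X =>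
    ⟨mem_algNS52_of_isSymmetry, fun hX => ?_⟩⟩
  obtain ⟨L, hL, -, -, -, hsym⟩ := isSymmetryAlgebra5_NS52 (fun _ => Set.univ) (fun _ => quadF)
    (fun _ => isOpen_univ) fun _ => contDiff_quadF.contDiffOn
  refine hsym X ?_
  rw [← LieSubalgebra.mem_toSubmodule, hL]
  exact hX

/-! #### An interaction of `NS_{5,1}` with no further symmetries -/

/-- The function `1 + ∑ ξ`. -/
def linF (ξ : Fin 4 → ℝ) : ℝ := 1 + ∑ j, ξ j

theorem contDiff_linF : ContDiff ℝ ∞ linF := by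
  unfold linF
  fun_prop

/-- The coordinates of a node. -/
def coord₁ (x : Site) : ℝ := x.1

def coord₂ (x : Site) : ℝ := x.2

theorem coord₁_site (x : Site) (i : Fin 7) :
    coord₁ (site x i) = x.1 + (![0, 1, 0, -1, -1, 0, 1] : Fin 7 → ℝ) i := by
  fin_cases i <;> simp [coord₁, site, offset]

theorem coord₂_site (x : Site) (i : Fin 7) :
    coord₂ (site x i) = x.2 + (![0, 0, 1, 1, 0, -1, -1] : Fin 7 → ℝ) i := by
  fin_cases i <;> simp [coord₂, site, offset]

theorem det3_coord (x : Site) : det3 coord₁ coord₂ (site x 0) (site x 1) (site x 2) = 1 := by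
  simp only [det3_eq, coord₁_site, coord₂_site]
  simp

theorem nonDegenerate_coord : NonDegenerate coord₁ coord₂ := fun x => by
  rw [det3_coord]
  exact one_ne_zero

/-- The interaction. -/
noncomputable def linG (x : Site) : (Fin 7 → ℝ) → ℝ := intNS51 coord₁ coord₂ x linF

/-- The exponent of the factor. -/
def expL (x : Site) (y : Fin 7 → ℝ) : ℝ :=
  y 0 + 4 * (-(x.1 + x.2 + 1) * y 0 + x.1 * y 1 + x.2 * y 2)

/-- The exponents of the invariants. -/
def expM (y : Fin 7 → ℝ) : Fin 4 → ℝ :=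
  ![y 0 - y 1 + y 2 - y 3, 2 * y 0 - y 1 - y 4, 2 * y 0 - y 2 - y 5, y 0 + y 1 - y 2 - y 6]

theorem factor_coord {x : Site} {w : Fin 7 → ℝ} (hw : ∀ i, w i ≠ 0) (y : Fin 7 → ℝ) :
    factorNS51 coord₁ coord₂ x (fun i => w i * Real.exp (y i))
      = Real.exp (expL x y) * factorNS51 coord₁ coord₂ x w := by
  rw [factorNS51_exp hw, det3_coord]
  simp only [det2_eq, coord₁_site, coord₂_site, expL]
  congr 2
  simp
  ring

theorem xi_coord {x : Site} (w y : Fin 7 → ℝ) (j : Fin 4) :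
    xiNS51 coord₁ coord₂ x (fun i => w i * Real.exp (y i)) j
      = xiNS51 coord₁ coord₂ x w j * Real.exp (expM y j) := by
  rw [xiNS51_scale, det3_coord]
  simp only [det3_eq, coord₁_site, coord₂_site]
  congr 2
  fin_cases j <;> simp [expM, -mul_eq_mul_right_iff] <;> ring

theorem differentiableAt_linG {x : Site} {w : Fin 7 → ℝ} (hw : ∀ i, w i ≠ 0) :
    DifferentiableAt ℝ (linG x) w :=
  (contDiffAt_intNS51 isOpen_univ contDiff_linF.contDiffOn hw trivial).differentiableAt (by simp)

theorem fderiv_linG {x : Site} {w : Fin 7 → ℝ} (hw : ∀ i, w i ≠ 0) (y : Fin 7 → ℝ) :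
    fderiv ℝ (linG x) w (fun i => y i * w i) = factorNS51 coord₁ coord₂ x w *
      (expL x y * (1 + ∑ j, xiNS51 coord₁ coord₂ x w j)
        + ∑ j, expM y j * xiNS51 coord₁ coord₂ x w j) := by
  have hl : HasDerivAt (fun (s : ℝ) i => w i * Real.exp (s * y i)) (fun i => y i * w i) 0 := by
    rw [hasDerivAt_pi]
    intro i
    refine ((((hasDerivAt_id (0 : ℝ)).mul_const (y i)).exp).const_mul (w i)).congr_deriv ?_
    simp
    ring
  have h1 := HasFDerivAt.comp_hasDerivAt (l := linG x) (0 : ℝ)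
    (by simpa using (differentiableAt_linG hw).hasFDerivAt) hl
  have e : (linG x ∘ fun (s : ℝ) i => w i * Real.exp (s * y i)) = fun s =>
      Real.exp (s * expL x y) * factorNS51 coord₁ coord₂ x w
        * (1 + ∑ j, xiNS51 coord₁ coord₂ x w j * Real.exp (s * expM y j)) := by
    ext s
    have hL : expL x (fun i => s * y i) = s * expL x y := by
      simp only [expL]
      ring
    have hM : ∀ j, expM (fun i => s * y i) j = s * expM y j := by
      intro j
      fin_cases j <;> simp [expM] <;> ring
    simp only [Function.comp_apply, linG, intNS51_eq, linF]
    rw [factor_coord hw (fun i => s * y i), hL]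
    simp only [xi_coord w (fun i => s * y i), hM]
  rw [e] at h1
  have he : ∀ c : ℝ, HasDerivAt (fun s : ℝ => Real.exp (s * c)) c 0 := fun c => by
    simpa using ((hasDerivAt_id (0 : ℝ)).mul_const c).exp
  have h2 := ((he (expL x y)).mul_const (factorNS51 coord₁ coord₂ x w)).mul
    ((HasDerivAt.fun_sum (u := Finset.univ) fun j _ =>
      (he (expM y j)).const_mul (xiNS51 coord₁ coord₂ x w j)).const_add 1)
  rw [h1.unique h2]
  simp only [zero_mul, Real.exp_zero, mul_one, one_mul]
  rw [Finset.sum_congr rfl fun j _ => mul_comm (xiNS51 coord₁ coord₂ x w j) (expM y j)]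
  ring

theorem fderiv_linG_div {x : Site} {w : Fin 7 → ℝ} (hw : ∀ i, w i ≠ 0) (v : Fin 7 → ℝ) :
    fderiv ℝ (linG x) w v = factorNS51 coord₁ coord₂ x w *
      (expL x (fun i => v i / w i) * (1 + ∑ j, xiNS51 coord₁ coord₂ x w j)
        + ∑ j, expM (fun i => v i / w i) j * xiNS51 coord₁ coord₂ x w j) := by
  rw [← fderiv_linG hw]
  congr 1
  ext i
  rw [div_mul_cancel₀ _ (hw i)]

theorem partialU_linG_eq_zero_iff {x : Site} {w : Fin 7 → ℝ} (hw : ∀ i, w i ≠ 0) (i : Fin 7) :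
    partialU (linG x) i w = 0 ↔
      expL x (Pi.single i 1) * (1 + ∑ j, xiNS51 coord₁ coord₂ x w j)
        + ∑ j, expM (Pi.single i 1) j * xiNS51 coord₁ coord₂ x w j = 0 := by
  rw [partialU_eq_fderiv (differentiableAt_linG hw)]
  have e : (Pi.single i 1 : Fin 7 → ℝ)
      = (w i)⁻¹ • fun k => (Pi.single i 1 : Fin 7 → ℝ) k * w k := by
    ext k
    by_cases hk : k = i
    · subst hk
      simp [hw k]
    · simp [hk]
  have h2 : fderiv ℝ (linG x) w (Pi.single i 1)
      = (w i)⁻¹ * (factorNS51 coord₁ coord₂ x w *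
      (expL x (Pi.single i 1) * (1 + ∑ j, xiNS51 coord₁ coord₂ x w j)
        + ∑ j, expM (Pi.single i 1) j * xiNS51 coord₁ coord₂ x w j)) := by
    conv_lhs => rw [e]
    rw [map_smul, fderiv_linG hw, smul_eq_mul]
  rw [h2, mul_eq_zero, mul_eq_zero]
  simp only [inv_eq_zero, hw i, factorNS51_ne_zero hw, false_or]

theorem isOpen_domNS51_univ (a₁ a₂ : Site → ℝ) (x : Site) :
    IsOpen (domNS51 a₁ a₂ (fun _ => Set.univ) x) := by
  have : domNS51 a₁ a₂ (fun _ => Set.univ) x = ⋂ i, {p : ℝ × (Fin 7 → ℝ) | p.2 i ≠ 0} := by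
    ext p
    simp [domNS51]
  rw [this]
  exact isOpen_iInter_of_finite fun i => isOpen_ne_fun (by fun_prop) (by fun_prop)

/-- Moving slot `3` alone changes only the first invariant, so vanishing at two points forces `expL
+ expM 0 = 0` for the given direction. In slots `0`, `1`, `2` this contradicts divisibility by `4`,
in slot `3` the sum is `-1`. In slots `4`, `5`, `6` the derivative is a nonzero multiple of one
positive invariant. -/
theorem coupled_linG (x : Site) (i : Fin 7) {w : Fin 7 → ℝ} (hw : ∀ i, w i ≠ 0) :
    ∃ γ : ℝ → Fin 7 → ℝ, ContinuousAt γ 0 ∧ γ 0 = w ∧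
      ¬ ∀ᶠ s in nhds 0, partialU (linG x) i (γ s) = 0 := by
  let γ : ℝ → Fin 7 → ℝ := fun s k => w k * Real.exp (s * (Pi.single 3 1 : Fin 7 → ℝ) k)
  have hγ : ∀ s k, γ s k ≠ 0 := fun s k => mul_ne_zero (hw k) (Real.exp_pos _).ne'
  have hγ0 : γ 0 = w := by
    ext k
    simp [γ]
  refine ⟨γ, by fun_prop, hγ0, fun h => ?_⟩
  obtain ⟨ε, hε, z0, z1, -⟩ := exists_pos_of_eventually h
  have hpos := fun j => xiNS51_pos (a₁ := coord₁) (a₂ := coord₂) (x := x) hw j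
  have e0 := (partialU_linG_eq_zero_iff (hγ 0) i).1 z0
  have e1 := (partialU_linG_eq_zero_iff (hγ ε) i).1 z1
  have hxi : ∀ j, xiNS51 coord₁ coord₂ x (γ ε) j = xiNS51 coord₁ coord₂ x w j
      * (![Real.exp (-ε), 1, 1, 1] : Fin 4 → ℝ) j := by
    intro j
    rw [xi_coord]
    congr 1
    fin_cases j <;> simp [expM]
  rw [hγ0] at e0
  simp only [hxi] at e1
  simp only [Fin.sum_univ_four] at e0 e1
  simp only [Matrix.cons_val_zero, Matrix.cons_val_one, Matrix.cons_val, mul_one] at e1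
  have hp0 := hpos 0
  have hp1 := hpos 1
  have hp2 := hpos 2
  have hp3 := hpos 3
  have hexp : Real.exp (-ε) - 1 ≠ 0 := by
    have := Real.exp_lt_one_iff.2 (neg_lt_zero.2 hε)
    linarith
  have key : (expL x (Pi.single i 1) + expM (Pi.single i 1) 0)
      * (xiNS51 coord₁ coord₂ x w 0 * (Real.exp (-ε) - 1)) = 0 := by
    linear_combination e1 - e0
  rw [mul_eq_zero, or_iff_left (mul_ne_zero hp0.ne' hexp)] at key
  fin_cases i
  · simp [expL, expM] at key
    have : (1 + 4 * (-(x.1 + x.2 + 1)) + 1 : ℤ) = 0 := by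
      have h' : (1 + 4 * (-((x.1 : ℝ) + x.2 + 1)) + 1 : ℝ) = 0 := by linear_combination key
      exact_mod_cast h'
    omega
  · simp [expL, expM] at key
    have : (4 * x.1 - 1 : ℤ) = 0 := by
      have h' : (4 * (x.1 : ℝ) - 1 : ℝ) = 0 := by linear_combination key
      exact_mod_cast h'
    omega
  · simp [expL, expM] at key
    have : (4 * x.2 + 1 : ℤ) = 0 := by
      have h' : (4 * (x.2 : ℝ) + 1 : ℝ) = 0 := by linear_combination key
      exact_mod_cast h'
    omega
  · simp [expL, expM] at key
  · simp [expL, expM] at e0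
    exact hp1.ne' e0
  · simp [expL, expM] at e0
    exact hp2.ne' e0
  · simp [expL, expM] at e0
    exact hp3.ne' e0

theorem xiNS51_of_abs_eq_one {a₁ a₂ : Site → ℝ} {x : Site} {w : Fin 7 → ℝ} (hw : ∀ i, |w i| = 1)
    (j : Fin 4) : xiNS51 a₁ a₂ x w j = 1 := by
  simp [xiNS51, hw]

theorem isNonlinearCoupled_linG :
    IsNonlinearCoupled (fun x _ w => intNS51 coord₁ coord₂ x linF w)
      (domNS51 coord₁ coord₂ fun _ => Set.univ) where
  isOpen := isOpen_domNS51_univ _ _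
  smooth x p hp := (ContDiffAt.comp (g := linG x) p (contDiffAt_intNS51 isOpen_univ
    contDiff_linF.contDiffOn hp.1 trivial) contDiffAt_snd).contDiffWithinAt
  nonlinear x := by
    refine ⟨(0, fun _ => 1), ⟨fun i => one_ne_zero, trivial⟩, 3, 3, ?_⟩
    change partialU (partialU (linG x) 3) 3 (fun _ => 1) ≠ 0
    rw [partialU_partialU_self]
    have e : ∀ r : ℝ, 0 < r → linG x (Function.update (fun _ => 1) 3 r) = 4 + r⁻¹ := by
      intro r hr
      have hD := det3_coord x
      rw [linG, intNS51_eq, linF, Fin.sum_univ_four]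
      simp [factorNS51, xiNS51, Function.update, -site_zero, hD, abs_of_pos hr, Real.rpow_neg_one]
      ring
    have d1 : ∀ᶠ r in nhds (1 : ℝ), HasDerivAt
        (fun r => linG x (Function.update (fun _ => 1) 3 r)) (-(r ^ 2)⁻¹) r := by
      filter_upwards [lt_mem_nhds one_pos] with r hr
      refine ((hasDerivAt_inv hr.ne').const_add 4).congr_of_eventuallyEq ?_
      filter_upwards [lt_mem_nhds hr] with s hs
      exact e s hs
    have d2 : HasDerivAt (fun r : ℝ => -(r ^ 2)⁻¹) 2 1 := by
      refine (((hasDerivAt_id (1 : ℝ)).pow 2).inv (by simp)).neg.congr_deriv ?_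
      norm_num
    have := iteratedDeriv_two_eq d1 d2
    rw [iteratedDeriv_succ, iteratedDeriv_one] at this
    rw [this]
    norm_num
  coupled x i p hp := by
    obtain ⟨γ, hγ, hγ0, h⟩ := coupled_linG x i (w := p.2) hp.1
    exact mem_closure_of_curve (D := fun q => partialU (linG x) i q.2)
      (isOpen_domNS51_univ _ _ x) hp hγ hγ0 h

theorem smul_eq_mul_exp {s : ℝ} (hs : 0 < s) (w : Fin 7 → ℝ) :
    s • w = fun i => w i * Real.exp (Real.log s) := by
  ext i
  rw [Real.exp_log hs, Pi.smul_apply, smul_eq_mul, mul_comm]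

theorem factor_coord_smul {x : Site} {w : Fin 7 → ℝ} (hw : ∀ i, w i ≠ 0) {s : ℝ} (hs : 0 < s) :
    factorNS51 coord₁ coord₂ x (s • w) = (s ^ 3)⁻¹ * factorNS51 coord₁ coord₂ x w := by
  rw [smul_eq_mul_exp hs, factor_coord hw]
  congr 1
  have : expL x (fun _ => Real.log s) = -((3 : ℕ) * Real.log s) := by
    simp only [expL]
    push_cast
    ring
  rw [this, Real.exp_neg, Real.exp_nat_mul, Real.exp_log hs]

theorem xi_coord_smul {x : Site} (w : Fin 7 → ℝ) {s : ℝ} (hs : 0 < s) :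
    xiNS51 coord₁ coord₂ x (s • w) = xiNS51 coord₁ coord₂ x w := by
  ext j
  rw [smul_eq_mul_exp hs, xi_coord]
  have : expM (fun _ => Real.log s) j = 0 := by
    fin_cases j <;> simp [expM] <;> ring
  rw [this, Real.exp_zero, mul_one]

theorem linG_smul {x : Site} {w : Fin 7 → ℝ} (hw : ∀ i, w i ≠ 0) {s : ℝ} (hs : 0 < s) :
    linG x (s • w) = (s ^ 3)⁻¹ * linG x w := by
  rw [linG, intNS51_eq, intNS51_eq, factor_coord_smul hw hs, xi_coord_smul w hs, mul_assoc]

theorem fderiv_linG_self {x : Site} {w : Fin 7 → ℝ} (hw : ∀ i, w i ≠ 0) :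
    fderiv ℝ (linG x) w w = -3 * linG x w := by
  have h := fderiv_intNS51 (nonDegenerate_coord x) hw (differentiableAt_linG hw) 0 0 1
  simp only [zero_mul, zero_add, one_mul, mul_one, zero_sub] at h
  exact h

theorem fderiv_linG_smul {x : Site} {w : Fin 7 → ℝ} (hw : ∀ i, w i ≠ 0) {s : ℝ} (hs : 0 < s)
    (v : Fin 7 → ℝ) : fderiv ℝ (linG x) (s • w) v = (s ^ 4)⁻¹ * fderiv ℝ (linG x) w v := by
  have hsw : ∀ i, (s • w) i ≠ 0 := fun i => by simpa [hs.ne'] using hw i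
  rw [fderiv_linG_div hsw, fderiv_linG_div hw, factor_coord_smul hw hs, xi_coord_smul w hs]
  have e : (fun i => v i / (s • w) i) = fun i => s⁻¹ * (v i / w i) := by
    ext i
    rw [Pi.smul_apply, smul_eq_mul]
    field_simp
  have hL : expL x (fun i => s⁻¹ * (v i / w i)) = s⁻¹ * expL x (fun i => v i / w i) := by
    simp only [expL]
    ring
  have hM : ∀ j, expM (fun i => s⁻¹ * (v i / w i)) j = s⁻¹ * expM (fun i => v i / w i) j := by
    intro j
    fin_cases j <;> simp [expM, -mul_eq_mul_left_iff] <;> ring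
  rw [e, hL]
  simp only [hM, mul_assoc, ← Finset.mul_sum]
  ring

theorem mem_algNS51_of_isSymmetry {X : SymField}
    (hX : X.IsSymmetry (fun x _ w => intNS51 coord₁ coord₂ x linF w)
      (domNS51 coord₁ coord₂ fun _ => Set.univ)) : X ∈ algNS51 coord₁ coord₂ := by
  rw [SymField.isSymmetry_iff] at hX
  have sep := fun (x : Site) (t : ℝ) (w : Fin 7 → ℝ) (hw : ∀ i, w i ≠ 0) =>
    have hsw : ∀ s : ℝ, 0 < s → ∀ i, (s • w) i ≠ 0 := fun s hs i => by
      simpa [hs.ne'] using hw i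
    detEq_separate (X := X) (G := linG) (x := x) (t := t) (w := w)
      (fun s hs => differentiableAt_linG (hsw s hs))
      (fun s hs => hX x (t, s • w) ⟨hsw s hs, trivial⟩)
      (fun s hs => linG_smul hw hs) (fun s hs v => fderiv_linG_smul hw hs v)
      (fderiv_linG_self hw)
  have htau : dt (dt (dt X.tau)) = 0 := by
    ext t
    simpa using (sep 0 t (fun _ => 1) fun _ => one_ne_zero).1
  have hlam : ∀ x, X.lam x = 0 := by
    have h3 : ∀ x, X.lam (site x 3) = 0 := by
      -- Changing the sign of the variable in slot `3` leaves the invariants alone, but reverses the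
      -- contribution of its `λ`, which occurs in `expM 0` only. Every node is the slot `3`
      -- neighbour of some node.
      intro x
      ext t
      have eq : ∀ w : Fin 7 → ℝ, (∀ i, |w i| = 1) →
          expL x (fun i => (X.lam (site x i)).1 t / w i) * 5
            + ∑ j, expM (fun i => (X.lam (site x i)).1 t / w i) j = 0 := by
        intro w hw
        have hw0 : ∀ i, w i ≠ 0 := fun i => abs_pos.1 (by rw [hw i]; exact one_pos)
        have e := (sep x t w hw0).2.2.2
        rw [fderiv_linG_div hw0, mul_eq_zero, or_iff_right (factorNS51_ne_zero hw0)] at e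
        simp only [xiNS51_of_abs_eq_one hw, mul_one] at e
        rw [← e]
        norm_num
      have e1 := eq (fun _ => 1) (by simp)
      have e2 := eq (Function.update (fun _ => 1) 3 (-1)) fun i => by
        by_cases hi : i = 3
        · subst hi
          simp
        · simp [hi]
      simp [expL, expM, Fin.sum_univ_four, Function.update] at e1 e2
      simp only [smoothFn.zero_apply]
      linarith
    intro x
    have : site (x - offset 3) 3 = x := by simp [site]
    rw [← this, h3]
  have ha : ∀ x, X.a x = expL x (fun i => X.a (site x i)) ∧
      ∀ j, expM (fun i => X.a (site x i)) j = 0 := by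
    intro x
    have eq : ∀ w : Fin 7 → ℝ, (∀ i, w i ≠ 0) →
        (X.a x - expL x (fun i => X.a (site x i))) * (1 + ∑ j, xiNS51 coord₁ coord₂ x w j)
          - ∑ j, expM (fun i => X.a (site x i)) j * xiNS51 coord₁ coord₂ x w j = 0 := by
      intro w hw
      have e := (sep x 0 w hw).2.2.1
      rw [fderiv_linG hw, linG, intNS51_eq, linF] at e
      apply mul_left_cancel₀ (factorNS51_ne_zero (a₁ := coord₁) (a₂ := coord₂) (x := x) hw)
      rw [mul_zero]
      linear_combination e
    have e0 := eq (fun _ => 1) fun _ => one_ne_zero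
    simp only [xiNS51_of_abs_eq_one (w := fun _ => 1) (by simp), mul_one] at e0
    -- Halving the variable in slot `3 + j` doubles the invariant number `j` and fixes the others.
    -- Comparison with the equation at `(1, …, 1)` gives these equalities, and that equation then
    -- reads `5A - 4A = 0` for their common value `A`.
    have ej : ∀ j : Fin 4, X.a x - expL x (fun i => X.a (site x i))
        = expM (fun i => X.a (site x i)) j := by
      intro j
      have h2 : (0 : ℝ) < 2 := by norm_num
      have e := eq (fun i => 1 * Real.exp
        ((Pi.single (Fin.natAdd 3 j) (-Real.log 2) : Fin 7 → ℝ) i))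
        fun i => mul_ne_zero one_ne_zero (Real.exp_pos _).ne'
      have hxi : ∀ k, xiNS51 coord₁ coord₂ x (fun i => 1 * Real.exp
          ((Pi.single (Fin.natAdd 3 j) (-Real.log 2) : Fin 7 → ℝ) i)) k
          = 1 + (Pi.single j 1 : Fin 4 → ℝ) k := by
        intro k
        rw [xi_coord (fun _ => 1), xiNS51_of_abs_eq_one (by simp), one_mul]
        fin_cases j <;> fin_cases k <;> simp [expM, Real.exp_log h2] <;> norm_num
      simp only [hxi, mul_add, mul_one, Finset.sum_add_distrib] at e
      simp only [Fin.sum_univ_four] at e e0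
      fin_cases j <;> simp at e ⊢ <;> linarith
    simp only [← ej] at e0
    simp at e0
    have hA : X.a x - expL x (fun i => X.a (site x i)) = 0 := by linarith
    exact ⟨sub_eq_zero.1 hA, fun j => by rw [← ej j, hA]⟩
  -- The vanishing exponents are second-difference relations for `a`; applied at neighbouring nodes
  -- they make both lattice steps of `a` constant, so `a` is affine in the coordinates.
  have hM : ∀ x, X.a (site x 3) = X.a x - X.a (site x 1) + X.a (site x 2) ∧
      X.a (site x 4) = 2 * X.a x - X.a (site x 1) ∧ X.a (site x 5) = 2 * X.a x - X.a (site x 2) ∧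
      X.a (site x 6) = X.a x + X.a (site x 1) - X.a (site x 2) := by
    intro x
    have h := (ha x).2
    have h0 := h 0
    have h1 := h 1
    have h2 := h 2
    have h3 := h 3
    simp [expM] at h0 h1 h2 h3
    exact ⟨by linarith, by linarith, by linarith, by linarith⟩
  have s14 : ∀ x, site (site x 1) 4 = x := fun x => by ext <;> simp [site, offset]
  have s13 : ∀ x, site (site x 1) 3 = site x 2 := fun x => by ext <;> simp [site, offset]
  have s25 : ∀ x, site (site x 2) 5 = x := fun x => by ext <;> simp [site, offset]
  have s26 : ∀ x, site (site x 2) 6 = site x 1 := fun x => by ext <;> simp [site, offset]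
  have step1 : ∀ x, X.a (site (site x 1) 1) - X.a (site x 1) = X.a (site x 1) - X.a x ∧
      X.a (site (site x 1) 2) - X.a (site x 1) = X.a (site x 2) - X.a x := by
    intro x
    have h := hM (site x 1)
    rw [s14, s13] at h
    exact ⟨by linarith [h.2.1], by linarith [h.1, h.2.1]⟩
  have step2 : ∀ x, X.a (site (site x 2) 1) - X.a (site x 2) = X.a (site x 1) - X.a x ∧
      X.a (site (site x 2) 2) - X.a (site x 2) = X.a (site x 2) - X.a x := by
    intro x
    have h := hM (site x 2)
    rw [s25, s26] at h
    exact ⟨by linarith [h.2.2.1, h.2.2.2], by linarith [h.2.2.1]⟩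
  have hδ := eq_of_steps (g := fun x => X.a (site x 1) - X.a x) (fun x => (step1 x).1)
    (fun x => (step2 x).1)
  have hε := eq_of_steps (g := fun x => X.a (site x 2) - X.a x) (fun x => (step1 x).2)
    (fun x => (step2 x).2)
  obtain ⟨α, β, γ, hτ⟩ := smoothFn.exists_quadratic htau
  refine mem_sl2_sup.2 ⟨α, β, γ, X.a (site 0 1) - X.a 0, X.a (site 0 2) - X.a 0, ?_⟩
  refine SymField.ext' ?_ (fun x => ?_) fun x => ?_
  · rw [hτ]
    simp [sl2X1, sl2X2, sl2X3, scaleField]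
  -- The weight equation reads `(n + m + 1) a = n a_{n+1m} + m a_{nm+1}`. With constant steps `δ`,
  -- `ε` it becomes `a = n δ + m ε`, so no constant multiplier is left.
  · have h := (ha x).1
    simp only [expL, site_zero] at h
    have h1 := hδ x
    have h2 := hε x
    simp only [sl2X1, sl2X2, sl2X3, scaleField, SymField.a_add, SymField.a_smul, SymField.a_mk,
      Pi.zero_apply, mul_zero, zero_add, coord₁, coord₂]
    linear_combination (1 / 4) * h + (x.1 : ℝ) * h1 + (x.2 : ℝ) * h2
  · rw [hlam x]
    simp [sl2X1, sl2X2, sl2X3, scaleField]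

theorem maximality_NS51 : ∃ (a₁ a₂ : Site → ℝ) (f : Site → (Fin 4 → ℝ) → ℝ),
    NonDegenerate a₁ a₂ ∧ (∀ x, ContDiff ℝ ∞ (f x)) ∧
    IsNonlinearCoupled (fun x _ w => intNS51 a₁ a₂ x (f x) w) (domNS51 a₁ a₂ fun _ => Set.univ) ∧
    ∀ X : SymField, X.IsSymmetry (fun x _ w => intNS51 a₁ a₂ x (f x) w)
      (domNS51 a₁ a₂ fun _ => Set.univ) ↔ X ∈ algNS51 a₁ a₂ := by
  refine ⟨coord₁, coord₂, fun _ => linF, nonDegenerate_coord, fun _ => contDiff_linF,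
    isNonlinearCoupled_linG, fun X => ⟨mem_algNS51_of_isSymmetry, fun hX => ?_⟩⟩
  obtain ⟨L, hL, -, -, -, hsym⟩ := isSymmetryAlgebra5_NS51 coord₁ coord₂ (fun _ => Set.univ)
    (fun _ => linF) nonDegenerate_coord (fun _ => isOpen_univ) fun _ => contDiff_linF.contDiffOn
  refine hsym X ?_
  rw [← LieSubalgebra.mem_toSubmodule, hL]
  exact hX

theorem mainTheorem10 :
    -- every point symmetry of a coupled system has the form given by a triple `(τ, a, λ)`
    (∀ (F : Interaction) (Ω : Domain), IsNonlinearCoupled F Ω →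
      ∀ X : PointField, X.IsSmoothOn Ω → X.IsSymmetry F Ω →
        ∀ x, ∀ p ∈ Ω x, ∃ (τ : ℝ → ℝ) (a : ℝ) (l : ℝ → ℝ),
          ContDiffAt ℝ ∞ τ p.1 ∧ ContDiffAt ℝ ∞ l p.1 ∧
          ∀ᶠ q in nhds (p.1, p.2 0), X.tau q.1 q.2 = τ q.1 ∧
            X.phi x q.1 q.2 = (deriv τ q.1 / 2 + a) * q.2 + l q.1) ∧
    -- there are no other classes, and the two classes exclude each other
    (∀ (F : Interaction) (Ω : Domain) (L : LieSubalgebra ℝ SymField),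
      IsNonlinearCoupled F Ω → (∀ X ∈ L, X.IsSymmetry F Ω) →
      Module.finrank ℝ L = 5 → ¬ LieAlgebra.IsSolvable L → IsIsotropic L →
        (∀ t₀, EquivNS51At F Ω L t₀ ∧ ¬ EquivNS52At F Ω L t₀) ∨
        (∀ t₀, EquivNS52At F Ω L t₀ ∧ ¬ EquivNS51At F Ω L t₀)) ∧
    -- every interaction of the two classes admits the algebra
    (∀ (a₁ a₂ : Site → ℝ) (V : Site → Set (Fin 4 → ℝ)) (f : Site → (Fin 4 → ℝ) → ℝ),
      NonDegenerate a₁ a₂ → (∀ x, IsOpen (V x)) → (∀ x, ContDiffOn ℝ ∞ (f x) (V x)) →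
        IsSymmetryAlgebra5 (algNS51 a₁ a₂) (radNS51 a₁ a₂)
          (fun x _ w => intNS51 a₁ a₂ x (f x) w) (domNS51 a₁ a₂ V)) ∧
    (∀ (V : Site → Set (Fin 5 → ℝ)) (f : Site → (Fin 5 → ℝ) → ℝ),
      (∀ x, IsOpen (V x)) → (∀ x, ContDiffOn ℝ ∞ (f x) (V x)) →
        IsSymmetryAlgebra5 algNS52 radNS52
          (fun x _ w => intNS52 (f x) w) (domNS52 V)) ∧
    -- in both classes the algebra is maximal for suitable nonlinear coupled interactions
    (∃ (a₁ a₂ : Site → ℝ) (f : Site → (Fin 4 → ℝ) → ℝ),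
      NonDegenerate a₁ a₂ ∧ (∀ x, ContDiff ℝ ∞ (f x)) ∧
      IsNonlinearCoupled (fun x _ w => intNS51 a₁ a₂ x (f x) w)
        (domNS51 a₁ a₂ fun _ => Set.univ) ∧
      ∀ X : SymField, X.IsSymmetry (fun x _ w => intNS51 a₁ a₂ x (f x) w)
        (domNS51 a₁ a₂ fun _ => Set.univ) ↔ X ∈ algNS51 a₁ a₂) ∧
    (∃ f : Site → (Fin 5 → ℝ) → ℝ,
      (∀ x, ContDiff ℝ ∞ (f x)) ∧
      IsNonlinearCoupled (fun x _ w => intNS52 (f x) w) (domNS52 fun _ => Set.univ) ∧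
      ∀ X : SymField, X.IsSymmetry (fun x _ w => intNS52 (f x) w)
        (domNS52 fun _ => Set.univ) ↔ X ∈ algNS52) :=
  ⟨fun _ _ hF _ hX hs _ _ hp => PointField.form_of_isSymmetry hF hX hs hp,
    fun _ _ _ hF hsym hdim hns hiso => classification hF hsym hdim hns hiso,
    isSymmetryAlgebra5_NS51, isSymmetryAlgebra5_NS52, maximality_NS51, maximality_NS52⟩
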